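/- Let $m=m(n)$ be positive-integer valued for large $n$ with $\lim_{n\to\infty} m/n=\alpha\in(0,\infty)$. For every $n$ let $c=c^{(n)}\in\mathbb R^n$ with $\|c\|_2=\sqrt n$, and let $a=(a_1,\dots,a_m)\in\mathbb R^m$ where $(a_i)_{i\ge1}$ is a fixed sequence of reals (not depending on $n$). Let $A\in\mathbb R^{m\times n}$, $g\in\mathbb R^m$, $h\in\mathbb R^n$ have iid standard normal components, with $g$ and $h$ independent, and define the $[-\infty,\infty]$-valued random variables (with $\min$, $\max$ read as $\inf$, $\sup$) $$f_{rp}(A)=\frac1{\sqrt n}\min_{x\in\mathbb R^n}\max_{\lambda\in\mathbb R^m,\,\lambda\ge0}\left(c^Tx+\lambda^TAx-\lambda^Ta\right)\quad\text{(random primal)},$$ $$f_{rd}(g,h)=\frac1{\sqrt n}\min_{x\in\mathbb R^n}\max_{\lambda\in\mathbb R^m,\,\lambda\ge0}\left(c^Tx+\|x\|_2\lambda^Tg+\|\lambda\|_2h^Tx-\lambda^Ta\right)\quad\text{(random dual)}.$$ Here $f_{rp}(A)$ is $\frac1{\sqrt n}$ times the value of the linear program $\min c^Tx$ subject to $Ax\le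 a$. Assume that both are bounded with probability going to $1$: there are constants $B_p,B_d$ with $\mathbb P(|f_{rp}(A)|\le B_p)\to1$ and $\mathbb P(|f_{rd}(g,h)|\le B_d)\to1$ as $n\to\infty$. Expectations are taken on these events, that is, $\mathbb E f_{rp}(A)$ stands for $\mathbb E[f_{rp}(A)\mathbf 1_{\{|f_{rp}(A)|\le B_p\}}]$ and $\mathbb E f_{rd}(g,h)$ for $\mathbb E[f_{rd}(g,h)\mathbf 1_{\{|f_{rd}(g,h)|\le B_d\}}]$ (their limits do not depend on the choice of the constants). Suppose that $\xi_{rd}=\lim_{n\to\infty}\mathbb E f_{rd}(g,h)$ exists. Then $$\xi_{rd}\le\liminf_{n\to\infty}\mathbb E f_{rp}(A),$$ so that $\xi_{rd}\le\xi_{rp}$ whenever $\xi_{rp}=\lim_{n\to\infty}\mathbb E f_{rp}(A)$ exists. Moreover, if $\xi_{rd}\ne0$, then for every real $\epsilon\ne0$ $$\limsup_{n\to\infty}\mathbb P\left(f_{rd}(g,h)\ge(1-\epsilon)\xi_{rd}\right)\le\liminf_{n\to\infty}\mathbb P\left(f_{rp}(A)\ge(1-\epsilon)\xi_{rd}\right).$$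 -/

import Mathlib

open MeasureTheory ProbabilityTheory Filter Topology Matrix

noncomputable section

namespace RandomLP

/-- The Euclidean norm of a finite real vector. -/
def l2 {k : ℕ} (v : Fin k → ℝ) : ℝ := ‖WithLp.toLp 2 v‖

/-- Law of a vector of `k` iid standard normals. -/
def gaussVec (k : ℕ) : Measure (Fin k → ℝ) :=
  Measure.pi fun _ => gaussianReal 0 1

/-- Law of an `m × n` matrix with iid standard normal entries. -/
def gaussMat (m n : ℕ) : Measure (Fin m → Fin n → ℝ) :=
  Measure.pi fun _ : Fin m => gaussVec n

/-- Joint law of two independent vectors `g ∈ ℝ^m` and `h ∈ ℝ^n` of iid standard normals. -/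
def gaussPair (m n : ℕ) : Measure ((Fin m → ℝ) × (Fin n → ℝ)) :=
  (gaussVec m).prod (gaussVec n)

/-- The random primal
`f_rp(A) = (1/√n) min_x max_{l ≥ 0} (cᵀx + lᵀAx - lᵀa)`, with values in `[-∞, ∞]`
(`∞` if the linear program is infeasible, `-∞` if it is unbounded). -/
def frp {m n : ℕ} (c : Fin n → ℝ) (a : Fin m → ℝ) (A : Fin m → Fin n → ℝ) : EReal :=
  ⨅ x : Fin n → ℝ, ⨆ l : {l : Fin m → ℝ // 0 ≤ l},
    (((1 / √(n : ℝ)) * (c ⬝ᵥ x + l.1 ⬝ᵥ (Matrix.of A *ᵥ x) - l.1 ⬝ᵥ a) : ℝ) : EReal)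

/-- The random dual
`f_rd(g,h) = (1/√n) min_x max_{l ≥ 0} (cᵀx + ‖x‖ lᵀg + ‖l‖ hᵀx - lᵀa)`,
with values in `[-∞, ∞]`. -/
def frd {m n : ℕ} (c : Fin n → ℝ) (a : Fin m → ℝ) (gh : (Fin m → ℝ) × (Fin n → ℝ)) : EReal :=
  ⨅ x : Fin n → ℝ, ⨆ l : {l : Fin m → ℝ // 0 ≤ l},
    (((1 / √(n : ℝ)) *
      (c ⬝ᵥ x + l2 x * (l.1 ⬝ᵥ gh.1) + l2 l.1 * (gh.2 ⬝ᵥ x) - l.1 ⬝ᵥ a) : ℝ) : EReal)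

/-- The event that the extended-real quantity `f` is bounded by `B` in absolute value. -/
def bddEvent {Ω : Type*} (f : Ω → EReal) (B : ℝ) : Set Ω :=
  {ω | ((-B : ℝ) : EReal) ≤ f ω ∧ f ω ≤ (B : EReal)}

/-- `E[f ; |f| ≤ B]`, the expectation of `f` on the event that it is bounded by `B`. For a family
with `P(|f_n| ≤ B) → 1` the limit of these numbers does not depend on the choice of such a `B`.
(Without the restriction the expectation of `frp` is `-∞` or undefined for all `m, n ≥ 1`,
since a Gaussian linear program is unbounded with positive probability.) -/
def bddExp {Ω : Type*} [MeasurableSpace Ω] (μ : Measure Ω) (f : Ω → EReal) (B : ℝ) : ℝ :=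
  ∫ ω in bddEvent f B, (f ω).toReal ∂μ

end RandomLP

end

namespace RandomLP

/-! ### Gaussian integration by parts -/

/-! Gordon's inequality compares the processes `lᵀAx + ‖x‖‖l‖γ` and `‖x‖lᵀg + ‖l‖hᵀx`, where `γ` is
an extra independent standard normal. Their covariances agree for equal `x`, and in general the
first exceeds the second by `(‖x‖‖x'‖ - x·x')(‖l‖‖l'‖ - l·l') ≥ 0`. On `γ < 0` the extra term only
loosens the constraints, so `P(frp < s') P(γ < 0) ≤ P(frd < s)` for `s' < s`
(`measure_frp_lt_mul_le`). The theorem follows once the dual value concentrates at its limiting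
expectation.

Feasible points have no a priori norm bound, so the dual value is not treated as a Lipschitz
function. With `u = c/√n`, a point enters only through `y = -uᵀx` and `r = ‖x‖` (`IsDualPoint`), and
`h` only through `h·u`, of order one, and the norm `χ` of its part orthogonal to `u`, of order `√n`.

Large norms are improbable (`tendsto_largeNormSet`): a feasible point with bounded `y` and `r² >
ε√n` would, after dilating `h` by `1 + D/√n`, give a dual value below the assumed bound. That
dilation changes the Gaussian law by a density bounded in `L²` uniformly in `n`.

When `r² ≤ ε√n`, lowering `y ≥ 0` so that `y²` drops by a fixed amount gains slack of order `χ/r`,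
which beats the cost of order `r` of moving `(g, h)` by a bounded distance `D`. Up to negligible
events, `{frd < -T₂}` and `{frd ≥ -T₁}` with `0 ≤ T₁ < T₂` are therefore `D` apart, and a
dimension-free variance bound for Lipschitz functions prevents both from keeping mass. The same
trade moves a negative `y` to `0`, so positive dual values are improbable. Hence for `s < s'` one of
the tails is small for each large `n` (`eventually_measure_frd_lt_or_le`), and convergence of the
bounded expectations decides which. -/

lemma hasDerivAt_gaussianPDFReal (x : ℝ) :
    HasDerivAt (gaussianPDFReal 0 1) (-x * gaussianPDFReal 0 1 x) x := by
  have h : HasDerivAt (fun x : ℝ => -(x - 0) ^ 2 / (2 * ((1 : NNReal) : ℝ))) (-x) x := by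
    refine (((hasDerivAt_id x).sub_const 0).pow 2 |>.neg.div_const
      (2 * ((1 : NNReal) : ℝ))).congr_deriv ?_
    simp
    ring
  have h2 := (h.exp).const_mul ((√(2 * Real.pi * ((1 : NNReal) : ℝ)))⁻¹)
  rw [gaussianPDFReal_def]
  refine h2.congr_deriv ?_
  ring

/-- The Gaussian density `φ` satisfies `φ' = -xφ`, so this is integration by parts on the line;
boundedness of `f` and `f'` supplies the integrability that removes boundary terms. -/
lemma integral_id_mul_gaussianReal {f f' : ℝ → ℝ} {C : ℝ} (hf : ∀ x, HasDerivAt f (f' x) x)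
    (hf' : Continuous f') (hC : ∀ x, |f x| ≤ C) (hC' : ∀ x, |f' x| ≤ C) :
    ∫ x, x * f x ∂gaussianReal 0 1 = ∫ x, f' x ∂gaussianReal 0 1 := by
  have hfc : Continuous f := continuous_iff_continuousAt.2 fun x => (hf x).continuousAt
  have hpdf : Integrable (gaussianPDFReal 0 1) := integrable_gaussianPDFReal 0 1
  have hxpdf : Integrable (fun x : ℝ => -x * gaussianPDFReal 0 1 x) := by
    have h := (integrable_mul_exp_neg_mul_sq (b := 1 / 2) (by norm_num)).const_mul
      (-(√(2 * Real.pi * ((1 : NNReal) : ℝ)))⁻¹)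
    convert h using 2 with x
    rw [gaussianPDFReal]
    simp
    ring_nf
  rw [integral_gaussianReal_eq_integral_smul one_ne_zero,
    integral_gaussianReal_eq_integral_smul one_ne_zero]
  have key := integral_mul_deriv_eq_deriv_mul_of_integrable (u := f) (u' := f')
    (v := gaussianPDFReal 0 1) (v' := fun x => -x * gaussianPDFReal 0 1 x)
    (fun x _ => hf x) (fun x _ => hasDerivAt_gaussianPDFReal x)
    (hxpdf.bdd_mul hfc.aestronglyMeasurable (Eventually.of_forall hC))
    (hpdf.bdd_mul hf'.aestronglyMeasurable (Eventually.of_forall hC'))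
    (hpdf.bdd_mul hfc.aestronglyMeasurable (Eventually.of_forall hC))
  rw [← neg_eq_iff_eq_neg] at key
  rw [← integral_neg] at key
  calc _ = ∫ x, -(f x * (-x * gaussianPDFReal 0 1 x)) := by
        congr with x; simp; ring
    _ = _ := key
    _ = _ := by congr with x; simp; ring

variable {ι : Type*} [Fintype ι] [DecidableEq ι]

/-- Resampling one coordinate preserves a product measure. -/
lemma measurePreserving_update (μ : Measure ℝ) [IsProbabilityMeasure μ] (d : ι) :
    MeasurePreserving (fun p : (ι → ℝ) × ℝ => Function.update p.1 d p.2)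
      ((Measure.pi fun _ : ι => μ).prod μ) (Measure.pi fun _ : ι => μ) := by
  have hmeas : Measurable (fun p : (ι → ℝ) × ℝ => Function.update p.1 d p.2) := by
    refine measurable_pi_lambda _ fun i => ?_
    by_cases h : i = d
    · subst h; simpa using measurable_snd
    · simp only [Function.update_of_ne h]
      exact (measurable_pi_apply i).comp measurable_fst
  refine ⟨hmeas, ?_⟩
  refine (Measure.pi_eq fun s hs => ?_).symm
  rw [Measure.map_apply hmeas (MeasurableSet.univ_pi hs)]
  have : (fun p : (ι → ℝ) × ℝ => Function.update p.1 d p.2) ⁻¹' (Set.univ.pi s)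
      = (Set.univ.pi (Function.update s d Set.univ)) ×ˢ s d := by
    ext ⟨x, t⟩
    simp only [Set.mem_preimage, Set.mem_univ_pi, Set.mem_prod]
    constructor
    · intro h
      refine ⟨fun i => ?_, by simpa using h d⟩
      by_cases hi : i = d
      · subst hi; simp
      · simpa [Function.update_of_ne hi] using h i
    · rintro ⟨h1, h2⟩ i
      by_cases hi : i = d
      · subst hi; simpa using h2
      · simpa [Function.update_of_ne hi] using h1 i
  rw [this, Measure.prod_prod, Measure.pi_pi,
    ← Finset.mul_prod_erase Finset.univ (fun i => μ (s i)) (Finset.mem_univ d),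
    ← Finset.mul_prod_erase Finset.univ _ (Finset.mem_univ d), mul_comm]
  simp only [Function.update_self, measure_univ, one_mul]
  congr 1
  refine Finset.prod_congr rfl fun i hi => ?_
  rw [Function.update_of_ne (Finset.ne_of_mem_erase hi)]

lemma integrable_eval_pi_gaussian {ι : Type*} [Fintype ι] (d : ι) :
    Integrable (fun x : ι → ℝ => x d) (Measure.pi fun _ : ι => gaussianReal 0 1) := by
  have h : Integrable (fun x : ℝ => x) (gaussianReal 0 1) :=
    (memLp_id_gaussianReal 1).integrable (by simp)
  exact (measurePreserving_eval (fun _ : ι => gaussianReal 0 1) d).integrable_comp_of_integrable h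

/-- Gaussian integration by parts for a standard Gaussian vector. -/
lemma integral_eval_mul_pi_gaussian {f f' : (ι → ℝ) → ℝ} {C : ℝ} (d : ι)
    (hfc : Continuous f) (hf' : Continuous f')
    (hf : ∀ x, HasDerivAt (fun t => f (Function.update x d t)) (f' x) (x d))
    (hC : ∀ x, |f x| ≤ C) (hC' : ∀ x, |f' x| ≤ C) :
    ∫ x, x d * f x ∂(Measure.pi fun _ : ι => gaussianReal 0 1)
      = ∫ x, f' x ∂(Measure.pi fun _ : ι => gaussianReal 0 1) := by
  have mp := measurePreserving_update (gaussianReal 0 1) d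
  have hupd : ∀ x : ι → ℝ, Continuous fun t => Function.update x d t := fun x => by fun_prop
  have i1 : Integrable (fun x : ι → ℝ => x d * f x) (Measure.pi fun _ : ι => gaussianReal 0 1) :=
    (integrable_eval_pi_gaussian d).mul_bdd hfc.aestronglyMeasurable (Eventually.of_forall hC)
  have i2 : Integrable f' (Measure.pi fun _ : ι => gaussianReal 0 1) :=
    Integrable.of_bound hf'.aestronglyMeasurable C (Eventually.of_forall hC')
  have e : ∀ F : (ι → ℝ) → ℝ, Integrable F (Measure.pi fun _ : ι => gaussianReal 0 1) →
      ∫ x, F x ∂(Measure.pi fun _ : ι => gaussianReal 0 1) =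
        ∫ x, ∫ t, F (Function.update x d t) ∂gaussianReal 0 1
          ∂(Measure.pi fun _ : ι => gaussianReal 0 1) := fun F hF => by
    rw [← integral_prod (fun p : (ι → ℝ) × ℝ => F (Function.update p.1 d p.2))
      (mp.integrable_comp_of_integrable hF)]
    conv_lhs => rw [← mp.map_eq]
    exact integral_map mp.aemeasurable (mp.map_eq.symm ▸ hF.aestronglyMeasurable)
  rw [e _ i1, e _ i2]
  congr with x
  simp only [Function.update_self]
  refine integral_id_mul_gaussianReal (C := C) (fun t => ?_) (hf'.comp (hupd x))
    (fun t => hC _) (fun t => hC' _)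
  simpa using hf (Function.update x d t)

/-! ### Functions that are affine in each variable -/

variable {K : Type*} [DecidableEq K]

/-- The difference of `M` in the `k`-th variable between `1` and `0`. -/
def coordDiff (k : K) (M : (K → ℝ) → ℝ) (a : K → ℝ) : ℝ :=
  M (Function.update a k 1) - M (Function.update a k 0)

/-- `M` is affine in each variable. -/
def CoordAffine (M : (K → ℝ) → ℝ) : Prop :=
  ∀ a k t, M (Function.update a k t) = M (Function.update a k 0) + t * coordDiff k M a

lemma CoordAffine.coordDiff {M : (K → ℝ) → ℝ} (h : CoordAffine M) (l : K) :
    CoordAffine (coordDiff l M) := by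
  intro a k t
  by_cases hkl : k = l
  · subst hkl
    simp [RandomLP.coordDiff]
  · simp only [RandomLP.coordDiff, Function.update_comm hkl]
    rw [h (Function.update a l 1) k t, h (Function.update a l 0) k t]
    simp only [RandomLP.coordDiff]
    ring

lemma differentiable_coordDiff [Fintype K] {M : (K → ℝ) → ℝ} (h : Differentiable ℝ M) (l : K) :
    Differentiable ℝ (coordDiff l M) := by
  have : ∀ t : ℝ, Differentiable ℝ (fun a : K → ℝ => Function.update a l t) := fun t => by
    rw [differentiable_pi]
    intro i
    by_cases hi : i = l
    · subst hi; simp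
    · simp only [Function.update_of_ne hi]; fun_prop
  exact (h.comp (this 1)).sub (h.comp (this 0))

/-- Along a coordinate line `M` is affine, so its partial derivative is the exact difference
`coordDiff`. Bounds on `M` over the cube thus bound its derivatives there. -/
lemma CoordAffine.hasDerivAt_comp [Fintype K] {M : (K → ℝ) → ℝ} (h : CoordAffine M) (hd : Differentiable ℝ M)
    {a : ℝ → K → ℝ} {a' : K → ℝ} {x : ℝ} (ha : ∀ k, HasDerivAt (fun t => a t k) (a' k) x) :
    HasDerivAt (fun t => M (a t)) (∑ k, RandomLP.coordDiff k M (a x) * a' k) x := by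
  have h1 := (hd (a x)).hasFDerivAt.comp_hasDerivAt x (hasDerivAt_pi.2 ha)
  refine h1.congr_deriv ?_
  symm
  rw [← ContinuousLinearMap.coe_coe, LinearMap.pi_apply_eq_sum_univ]
  refine Finset.sum_congr rfl fun k _ => ?_
  rw [smul_eq_mul, mul_comm]
  congr 1
  have h2 : HasDerivAt (fun t => M (Function.update (a x) k t))
      (fderiv ℝ M (a x) (Pi.single k 1)) (a x k) := by
    have h3 := hasDerivAt_update (a x) k (a x k)
    have h4 : HasFDerivAt M (fderiv ℝ M (a x)) (Function.update (a x) k (a x k)) := by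
      rw [Function.update_eq_self]; exact (hd (a x)).hasFDerivAt
    exact h4.comp_hasDerivAt _ h3
  have h5 : HasDerivAt (fun t => M (Function.update (a x) k t))
      (RandomLP.coordDiff k M (a x)) (a x k) := by
    have : (fun t => M (Function.update (a x) k t)) = fun t =>
        M (Function.update (a x) k 0) + t * RandomLP.coordDiff k M (a x) := funext fun t => h _ _ _
    rw [this]
    simpa using ((hasDerivAt_id (a x k)).mul_const (RandomLP.coordDiff k M (a x))).const_add
      (M (Function.update (a x) k 0))
  have e : (fun i => if k = i then (1 : ℝ) else 0) = Pi.single k 1 := by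
    ext i; simp [Pi.single_apply, eq_comm]
  rw [h5.unique h2]
  simp [e]

/-! ### Gaussian interpolation and Gordon's comparison inequality -/

variable {ι K : Type*} [Fintype ι] [DecidableEq ι] [DecidableEq K]

lemma continuous_of_hasDerivAt {f f' : ℝ → ℝ} (h : ∀ x, HasDerivAt f (f' x) x) : Continuous f :=
  continuous_iff_continuousAt.2 fun x => (h x).continuousAt

lemma abs_coordDiff_le {M : (K → ℝ) → ℝ} {C : ℝ}
    (h : ∀ a : K → ℝ, (∀ k, a k ∈ Set.Icc (0 : ℝ) 1) → |M a| ≤ C) (k : K) (a : K → ℝ)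
    (ha : ∀ k, a k ∈ Set.Icc (0 : ℝ) 1) : |coordDiff k M a| ≤ 2 * C := by
  have h' : ∀ t ∈ Set.Icc (0 : ℝ) 1, |M (Function.update a k t)| ≤ C := fun t ht =>
    h _ fun l => by
      by_cases hl : l = k
      · subst hl; simpa using ht
      · simpa [Function.update_of_ne hl] using ha l
  have h1 := h' 1 (by simp)
  have h0 := h' 0 (by simp)
  rw [coordDiff]
  calc _ ≤ _ := abs_sub _ _
    _ ≤ 2 * C := by linarith

/-- A test function: `M` of bounded smooth functions of the coordinates. -/
structure IsTest (M : (K → ℝ) → ℝ) (ψ ψ' ψ'' : K → ℝ → ℝ) (C : ℝ) : Prop where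
  affine : CoordAffine M
  diff : Differentiable ℝ M
  bdd : ∀ a : K → ℝ, (∀ k, a k ∈ Set.Icc (0 : ℝ) 1) → |M a| ≤ 1
  mem : ∀ k x, ψ k x ∈ Set.Icc (0 : ℝ) 1
  deriv : ∀ k x, HasDerivAt (ψ k) (ψ' k x) x
  deriv2 : ∀ k x, HasDerivAt (ψ' k) (ψ'' k x) x
  cont2 : ∀ k, Continuous (ψ'' k)
  bdd1 : ∀ k x, |ψ' k x| ≤ C
  bdd2 : ∀ k x, |ψ'' k x| ≤ C

variable {M : (K → ℝ) → ℝ} {ψ ψ' ψ'' : K → ℝ → ℝ} {C : ℝ}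

/-- The derivative of `M (ψ (z))` in the `k`-th coordinate of `z`. -/
def testDeriv (M : (K → ℝ) → ℝ) (ψ ψ' : K → ℝ → ℝ) (k : K) (z : K → ℝ) : ℝ :=
  coordDiff k M (fun l => ψ l (z l)) * ψ' k (z k)

lemma IsTest.continuous_testDeriv [Fintype K] (h : IsTest M ψ ψ' ψ'' C) (k : K) :
    Continuous (testDeriv M ψ ψ' k) := by
  have h1 := (differentiable_coordDiff h.diff k).continuous
  have h2 : ∀ k, Continuous (ψ k) := fun k => continuous_of_hasDerivAt (h.deriv k)
  have h3 : Continuous (ψ' k) := continuous_of_hasDerivAt (h.deriv2 k)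
  unfold testDeriv
  refine (h1.comp (continuous_pi fun l => (h2 l).comp (continuous_apply l))).mul
    (h3.comp (continuous_apply k))

lemma IsTest.abs_testDeriv_le (h : IsTest M ψ ψ' ψ'' C) (k : K) (z : K → ℝ) :
    |testDeriv M ψ ψ' k z| ≤ 2 * C := by
  have h1 := abs_coordDiff_le h.bdd k (fun l => ψ l (z l)) fun l => h.mem _ _
  have h2 := h.bdd1 k (z k)
  rw [testDeriv, abs_mul]
  calc _ ≤ (2 * 1) * C := mul_le_mul h1 h2 (abs_nonneg _) (by norm_num)
    _ = _ := by ring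

/-- Integration by parts against the `d`-th Gaussian coordinate. -/
lemma IsTest.integral_eval_mul_testDeriv [Fintype K] (h : IsTest M ψ ψ' ψ'' C) (k : K) (R : K → ι → ℝ)
    (d : ι) :
    ∫ x, x d * testDeriv M ψ ψ' k (fun l => ∑ e, R l e * x e)
        ∂(Measure.pi fun _ : ι => gaussianReal 0 1) =
      ∑ l, R l d * ∫ x, coordDiff l (coordDiff k M) (fun l => ψ l (∑ e, R l e * x e)) *
          ψ' l (∑ e, R l e * x e) * ψ' k (∑ e, R k e * x e)
          ∂(Measure.pi fun _ : ι => gaussianReal 0 1) +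
      R k d * ∫ x, coordDiff k M (fun l => ψ l (∑ e, R l e * x e)) * ψ'' k (∑ e, R k e * x e)
          ∂(Measure.pi fun _ : ι => gaussianReal 0 1) := by
  have hC : 0 ≤ C := (abs_nonneg _).trans (h.bdd1 k 0)
  have cψ : ∀ k, Continuous (ψ k) := fun k => continuous_of_hasDerivAt (h.deriv k)
  have cψ' : ∀ k, Continuous (ψ' k) := fun k => continuous_of_hasDerivAt (h.deriv2 k)
  have cψ'' := h.cont2
  have cl : ∀ l, Continuous fun x : ι → ℝ => ∑ e, R l e * x e := fun l => by fun_prop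
  have cvec : Continuous fun (x : ι → ℝ) l => ψ l (∑ e, R l e * x e) :=
    continuous_pi fun l => (cψ l).comp (cl l)
  have cD : ∀ k, Continuous (coordDiff k M) := fun k =>
    (differentiable_coordDiff h.diff k).continuous
  have cDD : ∀ l, Continuous (coordDiff l (coordDiff k M)) := fun l =>
    (differentiable_coordDiff (differentiable_coordDiff h.diff k) l).continuous
  have c2 : ∀ l, Continuous fun x : ι → ℝ =>
      coordDiff l (coordDiff k M) (fun l => ψ l (∑ e, R l e * x e)) *
          ψ' l (∑ e, R l e * x e) * ψ' k (∑ e, R k e * x e) := fun l =>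
    (((cDD l).comp cvec).mul ((cψ' l).comp (cl l))).mul ((cψ' k).comp (cl k))
  have c3 : Continuous fun x : ι → ℝ =>
      coordDiff k M (fun l => ψ l (∑ e, R l e * x e)) * ψ'' k (∑ e, R k e * x e) :=
    ((cD k).comp cvec).mul ((cψ'' k).comp (cl k))
  have b2 : ∀ l (x : ι → ℝ), |coordDiff l (coordDiff k M) (fun l => ψ l (∑ e, R l e * x e)) *
          ψ' l (∑ e, R l e * x e) * ψ' k (∑ e, R k e * x e)| ≤ 4 * C * C := fun l x => by
    rw [abs_mul, abs_mul]
    have := abs_coordDiff_le (abs_coordDiff_le h.bdd k) l (fun l => ψ l (∑ e, R l e * x e))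
      fun l => h.mem _ _
    norm_num at this
    gcongr
    · exact h.bdd1 _ _
    · exact h.bdd1 _ _
  have b3 : ∀ (x : ι → ℝ), |coordDiff k M (fun l => ψ l (∑ e, R l e * x e)) *
      ψ'' k (∑ e, R k e * x e)| ≤ 2 * C := fun x => by
    rw [abs_mul]
    have := abs_coordDiff_le h.bdd k (fun l => ψ l (∑ e, R l e * x e)) fun l => h.mem _ _
    norm_num at this
    gcongr
    exact h.bdd2 _ _
  have i2 : ∀ l, Integrable (fun x : ι → ℝ =>
      coordDiff l (coordDiff k M) (fun l => ψ l (∑ e, R l e * x e)) *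
          ψ' l (∑ e, R l e * x e) * ψ' k (∑ e, R k e * x e))
      (Measure.pi fun _ : ι => gaussianReal 0 1) := fun l =>
    Integrable.of_bound (c2 l).aestronglyMeasurable _ (Eventually.of_forall (b2 l))
  have i3 : Integrable (fun x : ι → ℝ =>
      coordDiff k M (fun l => ψ l (∑ e, R l e * x e)) * ψ'' k (∑ e, R k e * x e))
      (Measure.pi fun _ : ι => gaussianReal 0 1) :=
    Integrable.of_bound c3.aestronglyMeasurable _ (Eventually.of_forall b3)
  -- One constant has to bound both the function and its derivative, hence the maximum.
  rw [integral_eval_mul_pi_gaussian (C := max (2 * C)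
    (∑ l, |R l d| * (4 * C * C) + |R k d| * (2 * C))) d
    (f := fun x => testDeriv M ψ ψ' k (fun l => ∑ e, R l e * x e))
    (f' := fun x => ∑ l, R l d * (coordDiff l (coordDiff k M) (fun l => ψ l (∑ e, R l e * x e)) *
          ψ' l (∑ e, R l e * x e) * ψ' k (∑ e, R k e * x e)) +
      R k d * (coordDiff k M (fun l => ψ l (∑ e, R l e * x e)) * ψ'' k (∑ e, R k e * x e)))
    ((h.continuous_testDeriv k).comp (continuous_pi cl))
    ((continuous_finsetSum _ fun l _ => (c2 l).const_mul _).add (c3.const_mul _))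
    ?_ ?_ ?_]
  · rw [integral_add (integrable_finsetSum _ fun l _ => (i2 l).const_mul _) (i3.const_mul _),
      integral_finsetSum _ fun l _ => (i2 l).const_mul _, integral_const_mul]
    simp_rw [integral_const_mul]
  · intro x
    have hl : ∀ l, HasDerivAt (fun t => ∑ e, R l e * Function.update x d t e) (R l d) (x d) := by
      intro l
      have := HasDerivAt.fun_sum (u := Finset.univ) fun (e : ι) _ =>
        ((hasDerivAt_pi.1 (hasDerivAt_update x d (x d)) e).const_mul (R l e))
      refine this.congr_deriv ?_
      simp [Pi.single_apply]
    have e : Function.update x d (x d) = x := Function.update_eq_self _ _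
    have h1 := (h.affine.coordDiff k).hasDerivAt_comp (differentiable_coordDiff h.diff k)
      (a := fun t l => ψ l (∑ e, R l e * Function.update x d t e))
      (x := x d) (fun l => (h.deriv l _).comp (x d) (hl l))
    have h2 := (h.deriv2 k _).comp (x d) (hl k)
    refine (h1.mul h2).congr_deriv ?_
    simp only [e, Finset.sum_mul, Function.comp]
    congr 1
    · exact Finset.sum_congr rfl fun l _ => by ring
    · ring
  · exact fun x => (h.abs_testDeriv_le k _).trans (le_max_left _ _)
  · intro x
    refine le_trans ?_ (le_max_right _ _)
    refine (abs_add_le _ _).trans (add_le_add ((Finset.abs_sum_le_sum_abs _ _).trans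
      (Finset.sum_le_sum fun l _ => ?_)) ?_)
    · rw [abs_mul]
      exact mul_le_mul_of_nonneg_left (b2 l x) (abs_nonneg _)
    · rw [abs_mul]
      exact mul_le_mul_of_nonneg_left (b3 x) (abs_nonneg _)

/-- Gaussian comparison along the rotation `sin θ • P + cos θ • Q`. -/
theorem IsTest.integral_comparison [Fintype K] (h : IsTest M ψ ψ' ψ'' C) (P Q : K → ι → ℝ)
    (horth : ∀ k l, ∑ d, P k d * Q l d = 0)
    (hdiag : ∀ k, ∑ d, P k d * P k d = ∑ d, Q k d * Q k d)
    (hsign : ∀ k l (z : K → ℝ), 0 ≤ (∑ d, P k d * P l d - ∑ d, Q k d * Q l d) *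
      (coordDiff l (coordDiff k M) (fun l => ψ l (z l)) * ψ' l (z l) * ψ' k (z k))) :
    ∫ x, M (fun k => ψ k (∑ d, Q k d * x d)) ∂(Measure.pi fun _ : ι => gaussianReal 0 1) ≤
      ∫ x, M (fun k => ψ k (∑ d, P k d * x d)) ∂(Measure.pi fun _ : ι => gaussianReal 0 1) := by
  set μ := Measure.pi fun _ : ι => gaussianReal 0 1 with hμ
  -- `R` runs from `Q` at `θ = 0` to `P` at `θ = π/2`, and `R'` is its derivative in `θ`.
  set R : ℝ → K → ι → ℝ := fun θ k d => Real.sin θ * P k d + Real.cos θ * Q k d with hR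
  set R' : ℝ → K → ι → ℝ := fun θ k d => Real.cos θ * P k d - Real.sin θ * Q k d with hR'
  set F : ℝ → ℝ := fun θ => ∫ x, M (fun k => ψ k (∑ d, R θ k d * x d)) ∂μ with hF
  have cψ : ∀ k, Continuous (ψ k) := fun k => continuous_of_hasDerivAt (h.deriv k)
  have cF : ∀ θ, Continuous fun x : ι → ℝ => M (fun k => ψ k (∑ d, R θ k d * x d)) := fun θ =>
    h.diff.continuous.comp (continuous_pi fun k => (cψ k).comp (by fun_prop))
  have cF' : ∀ θ k, Continuous fun x : ι → ℝ =>
      testDeriv M ψ ψ' k (fun l => ∑ e, R θ l e * x e) := fun θ k =>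
    (h.continuous_testDeriv k).comp (by fun_prop)
  -- Orthogonality kills the mixed terms. What remains is the covariance difference with weight `sin
  -- θ cos θ`, nonnegative on the interval.
  have hRR : ∀ θ k l, ∑ d, R' θ k d * R θ l d =
      (Real.sin θ * Real.cos θ) * (∑ d, P k d * P l d - ∑ d, Q k d * Q l d) := fun θ k l => by
    have e : ∀ d, R' θ k d * R θ l d = (Real.sin θ * Real.cos θ) * (P k d * P l d) -
        (Real.sin θ * Real.cos θ) * (Q k d * Q l d) + Real.cos θ ^ 2 * (P k d * Q l d) -
        Real.sin θ ^ 2 * (P l d * Q k d) := fun d => by simp only [hR, hR']; ring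
    simp_rw [e]
    rw [Finset.sum_sub_distrib, Finset.sum_add_distrib, Finset.sum_sub_distrib]
    simp_rw [← Finset.mul_sum]
    rw [horth, horth]
    ring
  have hder : ∀ θ, HasDerivAt F
      (∫ x, ∑ k, testDeriv M ψ ψ' k (fun l => ∑ e, R θ l e * x e) * ∑ d, R' θ k d * x d ∂μ) θ := by
    intro θ
    refine (hasDerivAt_integral_of_dominated_loc_of_deriv_le
      (F := fun θ (x : ι → ℝ) => M (fun k => ψ k (∑ d, R θ k d * x d)))
      (F' := fun θ (x : ι → ℝ) => ∑ k, testDeriv M ψ ψ' k (fun l => ∑ e, R θ l e * x e) *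
        ∑ d, R' θ k d * x d)
      (bound := fun x : ι → ℝ => ∑ k, (2 * C) * ∑ d, (|P k d| + |Q k d|) * |x d|) (s := Set.univ)
      univ_mem ?_ ?_ ?_ ?_ ?_ ?_).2
    · exact Eventually.of_forall fun θ => (cF θ).aestronglyMeasurable
    · exact Integrable.of_bound (cF θ).aestronglyMeasurable 1
        (Eventually.of_forall fun x => h.bdd _ fun k => h.mem _ _)
    · exact (continuous_finsetSum _ fun k _ => (cF' θ k).mul (by fun_prop)).aestronglyMeasurable
    · refine Eventually.of_forall fun x θ _ => ?_
      refine (Finset.abs_sum_le_sum_abs _ _).trans (Finset.sum_le_sum fun k _ => ?_)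
      rw [abs_mul]
      refine mul_le_mul (h.abs_testDeriv_le k _) ?_ (abs_nonneg _)
        ((abs_nonneg _).trans (h.abs_testDeriv_le k fun _ => 0))
      refine (Finset.abs_sum_le_sum_abs _ _).trans (Finset.sum_le_sum fun d _ => ?_)
      rw [abs_mul]
      refine mul_le_mul_of_nonneg_right ?_ (abs_nonneg _)
      refine (abs_sub _ _).trans (add_le_add ?_ ?_)
      · rw [abs_mul]
        exact mul_le_of_le_one_left (abs_nonneg _) (Real.abs_cos_le_one _)
      · rw [abs_mul]
        exact mul_le_of_le_one_left (abs_nonneg _) (Real.abs_sin_le_one _)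
    · exact integrable_finsetSum _ fun k _ => (integrable_finsetSum _ fun d _ =>
        (integrable_eval_pi_gaussian d).abs.const_mul _).const_mul _
    · refine Eventually.of_forall fun x θ _ => ?_
      have hl : ∀ k, HasDerivAt (fun θ => ∑ d, R θ k d * x d) (∑ d, R' θ k d * x d) θ := fun k => by
        refine HasDerivAt.fun_sum fun d _ => HasDerivAt.mul_const ?_ _
        refine (((Real.hasDerivAt_sin θ).mul_const _).add
          ((Real.hasDerivAt_cos θ).mul_const _)).congr_deriv ?_
        simp only [hR']; ring
      refine (h.affine.hasDerivAt_comp h.diff (a := fun θ k => ψ k (∑ d, R θ k d * x d))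
        (fun k => (h.deriv k _).comp θ (hl k))).congr_deriv ?_
      refine Finset.sum_congr rfl fun k _ => ?_
      rw [testDeriv]; ring
  have hval : ∀ θ, ∫ x, ∑ k, testDeriv M ψ ψ' k (fun l => ∑ e, R θ l e * x e) *
      ∑ d, R' θ k d * x d ∂μ = (Real.sin θ * Real.cos θ) * ∑ k, ∑ l,
        ∫ x, (∑ d, P k d * P l d - ∑ d, Q k d * Q l d) *
        (coordDiff l (coordDiff k M) (fun l => ψ l (∑ e, R θ l e * x e)) *
          ψ' l (∑ e, R θ l e * x e) * ψ' k (∑ e, R θ k e * x e)) ∂μ := by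
    intro θ
    have hi : ∀ k d, Integrable (fun x : ι → ℝ => x d *
        testDeriv M ψ ψ' k (fun l => ∑ e, R θ l e * x e)) μ := fun k d =>
      (integrable_eval_pi_gaussian d).mul_bdd (cF' θ k).aestronglyMeasurable
        (Eventually.of_forall fun x => h.abs_testDeriv_le k _)
    have e1 : ∀ (x : ι → ℝ) k, testDeriv M ψ ψ' k (fun l => ∑ e, R θ l e * x e) *
        ∑ d, R' θ k d * x d = ∑ d, R' θ k d * (x d *
          testDeriv M ψ ψ' k (fun l => ∑ e, R θ l e * x e)) := fun x k => by
      rw [Finset.mul_sum]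
      exact Finset.sum_congr rfl fun d _ => by ring
    simp_rw [e1]
    rw [integral_finsetSum _ fun k _ => integrable_finsetSum _ fun d _ => (hi k d).const_mul _,
      Finset.mul_sum]
    refine Finset.sum_congr rfl fun k _ => ?_
    rw [integral_finsetSum _ fun d _ => (hi k d).const_mul _]
    simp_rw [integral_const_mul]
    have e2 := fun d => h.integral_eval_mul_testDeriv k (R θ) d
    simp_rw [hμ, e2, mul_add, ← hμ, Finset.sum_add_distrib, Finset.mul_sum]
    rw [Finset.sum_comm]
    simp_rw [← mul_assoc, ← Finset.sum_mul, hRR]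
    -- Equal variances remove the term with `ψ''`.
    rw [hdiag k]
    simp
  have hmono : MonotoneOn F (Set.Icc 0 (Real.pi / 2)) := by
    refine monotoneOn_of_deriv_nonneg (convex_Icc _ _)
      (fun θ _ => (hder θ).continuousAt.continuousWithinAt)
      (fun θ _ => (hder θ).differentiableAt.differentiableWithinAt) fun θ hθ => ?_
    rw [interior_Icc] at hθ
    rw [(hder θ).deriv, hval θ]
    have hs : 0 ≤ Real.sin θ := Real.sin_nonneg_of_nonneg_of_le_pi hθ.1.le
      (by linarith [hθ.2, Real.pi_pos])
    have hc : 0 ≤ Real.cos θ := Real.cos_nonneg_of_mem_Icc ⟨by linarith [hθ.1, Real.pi_pos], hθ.2.le⟩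
    exact mul_nonneg (mul_nonneg hs hc) (Finset.sum_nonneg fun k _ => Finset.sum_nonneg fun l _ =>
      integral_nonneg fun x => hsign k l _)
  have hpi : (0 : ℝ) ≤ Real.pi / 2 := by positivity
  have := hmono (Set.left_mem_Icc.2 hpi) (Set.right_mem_Icc.2 hpi) hpi
  simpa [hF, hR] using this

/-! ### Gordon's inequality through a coordinatewise affine test function -/

section Gordon

variable {I J : Type*} [Fintype I] [Fintype J]

/-- For `a` with values in `{0, 1}`, the indicator of `∀ i, ∃ j, a (i, j) = 0`. -/
def minMaxProd (a : I × J → ℝ) : ℝ := ∏ i, (1 - ∏ j, a (i, j))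

lemma differentiable_minMaxProd : Differentiable ℝ (minMaxProd : (I × J → ℝ) → ℝ) := by
  unfold minMaxProd
  fun_prop

lemma prod_mem_Icc {κ : Type*} (s : Finset κ) {f : κ → ℝ} (h : ∀ k, f k ∈ Set.Icc (0 : ℝ) 1) :
    ∏ k ∈ s, f k ∈ Set.Icc (0 : ℝ) 1 :=
  ⟨Finset.prod_nonneg fun k _ => (h k).1, Finset.prod_le_one (fun k _ => (h k).1) fun k _ => (h k).2⟩

lemma one_sub_prod_mem_Icc {κ : Type*} (s : Finset κ) {f : κ → ℝ}
    (h : ∀ k, f k ∈ Set.Icc (0 : ℝ) 1) : 1 - ∏ k ∈ s, f k ∈ Set.Icc (0 : ℝ) 1 :=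
  ⟨by linarith [(prod_mem_Icc s h).2], by linarith [(prod_mem_Icc s h).1]⟩

lemma minMaxProd_mem_Icc {a : I × J → ℝ} (h : ∀ k, a k ∈ Set.Icc (0 : ℝ) 1) :
    minMaxProd a ∈ Set.Icc (0 : ℝ) 1 :=
  prod_mem_Icc _ fun i => one_sub_prod_mem_Icc _ fun j => h (i, j)

/-- A smooth approximation of the indicator of `{s | s ≤ τ}`. -/
noncomputable def smoothStep (N τ s : ℝ) : ℝ := Real.sigmoid (N - N ^ 2 * (s - τ))

lemma smoothStep_mem (N τ s : ℝ) : smoothStep N τ s ∈ Set.Icc (0 : ℝ) 1 :=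
  ⟨Real.sigmoid_nonneg _, Real.sigmoid_le_one _⟩

lemma hasDerivAt_smoothStep (N τ s : ℝ) : HasDerivAt (smoothStep N τ)
    (-N ^ 2 * (smoothStep N τ s * (1 - smoothStep N τ s))) s := by
  have h : HasDerivAt (fun s => N - N ^ 2 * (s - τ)) (-N ^ 2) s := by
    simpa using (((hasDerivAt_id s).sub_const τ).const_mul (N ^ 2)).const_sub N
  refine ((Real.hasDerivAt_sigmoid _).comp s h).congr_deriv ?_
  rw [smoothStep]
  ring

lemma hasDerivAt_deriv_smoothStep (N τ s : ℝ) :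
    HasDerivAt (fun s => -N ^ 2 * (smoothStep N τ s * (1 - smoothStep N τ s)))
      (N ^ 4 * (smoothStep N τ s * (1 - smoothStep N τ s) * (1 - 2 * smoothStep N τ s))) s := by
  have h := hasDerivAt_smoothStep N τ s
  refine ((h.mul (h.const_sub 1)).const_mul (-N ^ 2)).congr_deriv ?_
  ring

/-- The shift `N` makes the limit at `s = τ` equal to `1`, so the limit is the indicator of a closed
half-line everywhere; for `s > τ` the quadratic term wins. -/
lemma tendsto_smoothStep (τ s : ℝ) :
    Tendsto (fun N : ℕ => smoothStep N τ s) atTop (𝓝 (if s ≤ τ then 1 else 0)) := by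
  have hN : Tendsto (fun N : ℕ => (N : ℝ)) atTop atTop := tendsto_natCast_atTop_atTop
  split_ifs with h
  · refine Real.tendsto_sigmoid_atTop.comp (tendsto_atTop_mono (fun N => ?_) hN)
    have : 0 ≤ (N : ℝ) ^ 2 * (τ - s) := mul_nonneg (by positivity) (by linarith)
    linarith
  · refine Real.tendsto_sigmoid_atBot.comp ?_
    have h1 : Tendsto (fun N : ℕ => 1 - (N : ℝ) * (s - τ)) atTop atBot := by
      refine tendsto_atBot_add_const_left _ 1 (tendsto_neg_atTop_atBot.comp
        (hN.atTop_mul_const (by linarith)))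
    refine (hN.atTop_mul_atBot₀ h1).congr fun N => ?_
    ring

lemma minMaxProd_indicator (p : I × J → Prop) [DecidablePred p] :
    minMaxProd (fun k => if p k then (1 : ℝ) else 0) =
      Set.indicator {_u : Unit | ∀ i, ∃ j, ¬ p (i, j)} (fun _ => (1 : ℝ)) () := by
  rw [minMaxProd]
  by_cases h : ∀ i, ∃ j, ¬ p (i, j)
  · rw [Set.indicator_of_mem (by exact h)]
    refine Finset.prod_eq_one fun i _ => ?_
    obtain ⟨j, hj⟩ := h i
    rw [Finset.prod_eq_zero (Finset.mem_univ j) (by simp [hj]), sub_zero]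
  · rw [Set.indicator_of_notMem (by exact h)]
    push Not at h
    obtain ⟨i, hi⟩ := h
    exact Finset.prod_eq_zero (Finset.mem_univ i) (by simp [hi])

lemma tendsto_integral_minMaxProd {ι : Type*} [Fintype ι] (τ : I × J → ℝ) (P : I × J → ι → ℝ) :
    Tendsto (fun N : ℕ => ∫ x, minMaxProd (fun k => smoothStep N (τ k) (∑ d, P k d * x d))
      ∂(Measure.pi fun _ : ι => gaussianReal 0 1)) atTop
      (𝓝 ((Measure.pi fun _ : ι => gaussianReal 0 1).real
        {x | ∀ i, ∃ j, τ (i, j) < ∑ d, P (i, j) d * x d})) := by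
  have hms : MeasurableSet {x : ι → ℝ | ∀ i, ∃ j, τ (i, j) < ∑ d, P (i, j) d * x d} := by
    have : {x : ι → ℝ | ∀ i, ∃ j, τ (i, j) < ∑ d, P (i, j) d * x d} =
        ⋂ i, ⋃ j, {x : ι → ℝ | τ (i, j) < ∑ d, P (i, j) d * x d} := by ext; simp
    rw [this]
    exact MeasurableSet.iInter fun i => MeasurableSet.iUnion fun j =>
      measurableSet_lt measurable_const (by fun_prop)
  rw [← integral_indicator_one hms]
  refine tendsto_integral_of_dominated_convergence (fun _ => 1) (fun N => ?_)
    (integrable_const _) (fun N => Eventually.of_forall fun x => ?_)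
    (Eventually.of_forall fun x => ?_)
  · have hc : ∀ k, Continuous (smoothStep N (τ k)) := fun k =>
      continuous_of_hasDerivAt (hasDerivAt_smoothStep N (τ k))
    refine (differentiable_minMaxProd.continuous.comp (continuous_pi fun k =>
      (hc k).comp ?_)).aestronglyMeasurable
    fun_prop
  · have := minMaxProd_mem_Icc (a := fun k => smoothStep N (τ k) (∑ d, P k d * x d))
      fun k => smoothStep_mem _ _ _
    rw [Real.norm_eq_abs, abs_le]; constructor <;> linarith [this.1, this.2]
  · have h1 : Tendsto (fun (N : ℕ) k => smoothStep N (τ k) (∑ d, P k d * x d)) atTop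
        (𝓝 fun k => if ∑ d, P k d * x d ≤ τ k then (1 : ℝ) else 0) :=
      tendsto_pi_nhds.2 fun k => tendsto_smoothStep _ _
    have h2 := (differentiable_minMaxProd.continuous.tendsto _).comp h1
    rw [minMaxProd_indicator] at h2
    convert! h2 using 2
    simp only [Set.indicator, Set.mem_ofPred_eq, not_le, Pi.one_apply]

variable [DecidableEq I] [DecidableEq J]

/-- Only the factor of row `i` contains the coordinate `(i, j)`, and it is affine in it. -/
lemma minMaxProd_update (a : I × J → ℝ) (i : I) (j : J) (t : ℝ) :
    minMaxProd (Function.update a (i, j) t) =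
      (1 - t * ∏ j' ∈ Finset.univ.erase j, a (i, j')) *
        ∏ i' ∈ Finset.univ.erase i, (1 - ∏ j', a (i', j')) := by
  rw [minMaxProd, ← Finset.mul_prod_erase Finset.univ _ (Finset.mem_univ i),
    ← Finset.mul_prod_erase Finset.univ _ (Finset.mem_univ j)]
  congr 1
  · rw [Function.update_self]
    congr 2
    refine Finset.prod_congr rfl fun j' hj' => ?_
    rw [Function.update_of_ne]
    simpa using Finset.ne_of_mem_erase hj'
  · refine Finset.prod_congr rfl fun i' hi' => ?_
    congr 1
    refine Finset.prod_congr rfl fun j' _ => ?_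
    rw [Function.update_of_ne]
    simp [Finset.ne_of_mem_erase hi']

lemma coordAffine_minMaxProd : CoordAffine (minMaxProd : (I × J → ℝ) → ℝ) := by
  rintro a ⟨i, j⟩ t
  simp only [coordDiff, minMaxProd_update]
  ring

lemma coordDiff_minMaxProd (a : I × J → ℝ) (i : I) (j : J) :
    coordDiff (i, j) minMaxProd a = -((∏ j' ∈ Finset.univ.erase j, a (i, j')) *
      ∏ i' ∈ Finset.univ.erase i, (1 - ∏ j', a (i', j'))) := by
  simp only [coordDiff, minMaxProd_update]
  ring

/-- The first difference is minus a product over the rest of row `i` times the factors of the other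
rows. Raising a coordinate in another row lowers one of those factors, so this negative quantity
increases. -/
lemma coordDiff_coordDiff_minMaxProd_nonneg (a : I × J → ℝ)
    (ha : ∀ k, a k ∈ Set.Icc (0 : ℝ) 1) {i i' : I} (hi : i ≠ i') (j j' : J) :
    0 ≤ coordDiff (i', j') (coordDiff (i, j) minMaxProd) a := by
  have hrow : ∀ t, ∏ j'' ∈ Finset.univ.erase j, Function.update a (i', j') t (i, j'') =
      ∏ j'' ∈ Finset.univ.erase j, a (i, j'') := fun t =>
    Finset.prod_congr rfl fun j'' _ => by rw [Function.update_of_ne]; simp [hi]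
  have hupd : ∀ t ∈ Set.Icc (0 : ℝ) 1, ∀ k, Function.update a (i', j') t k ∈ Set.Icc (0 : ℝ) 1 := by
    intro t ht k
    by_cases hk : k = (i', j')
    · subst hk; simpa using ht
    · simpa [Function.update_of_ne hk] using ha k
  rw [coordDiff, coordDiff_minMaxProd, coordDiff_minMaxProd, hrow, hrow]
  have h0 : 0 ≤ ∏ j'' ∈ Finset.univ.erase j, a (i, j'') :=
    (prod_mem_Icc _ fun j'' => ha (i, j'')).1
  have h1 : ∏ i'' ∈ Finset.univ.erase i, (1 - ∏ j'', Function.update a (i', j') 1 (i'', j'')) ≤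
      ∏ i'' ∈ Finset.univ.erase i, (1 - ∏ j'', Function.update a (i', j') 0 (i'', j'')) := by
    refine Finset.prod_le_prod
      (fun i'' _ => (one_sub_prod_mem_Icc _ fun j'' => hupd 1 (by simp) (i'', j'')).1)
      fun i'' _ => sub_le_sub_left (Finset.prod_le_prod (fun j'' _ => (hupd 0 (by simp) _).1)
        fun j'' _ => ?_) 1
    by_cases hk : (i'', j'') = (i', j')
    · rw [hk]; simp
    · rw [Function.update_of_ne hk, Function.update_of_ne hk]
  nlinarith [mul_le_mul_of_nonneg_left h1 h0]

lemma isTest_minMaxProd (N : ℝ) (τ : I × J → ℝ) :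
    IsTest (minMaxProd : (I × J → ℝ) → ℝ) (fun k => smoothStep N (τ k))
      (fun k s => -N ^ 2 * (smoothStep N (τ k) s * (1 - smoothStep N (τ k) s)))
      (fun k s => N ^ 4 * (smoothStep N (τ k) s * (1 - smoothStep N (τ k) s) *
        (1 - 2 * smoothStep N (τ k) s))) (N ^ 2 + N ^ 4) where
  affine := coordAffine_minMaxProd
  diff := differentiable_minMaxProd
  bdd a ha := by
    have := minMaxProd_mem_Icc ha
    rw [abs_le]; constructor <;> linarith [this.1, this.2]
  mem k x := smoothStep_mem _ _ _
  deriv k x := hasDerivAt_smoothStep _ _ _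
  deriv2 k x := hasDerivAt_deriv_smoothStep _ _ _
  cont2 k := by
    have : Continuous (smoothStep N (τ k)) :=
      continuous_of_hasDerivAt (hasDerivAt_smoothStep N (τ k))
    fun_prop
  bdd1 k x := by
    obtain ⟨h0, h1⟩ := smoothStep_mem N (τ k) x
    have h2 : 0 ≤ smoothStep N (τ k) x * (1 - smoothStep N (τ k) x) :=
      mul_nonneg h0 (by linarith)
    have h3 : smoothStep N (τ k) x * (1 - smoothStep N (τ k) x) ≤ 1 := by nlinarith
    have h4 : 0 ≤ N ^ 4 := by positivity
    rw [abs_mul, abs_neg, abs_of_nonneg (by positivity : 0 ≤ N ^ 2), abs_of_nonneg h2]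
    nlinarith [sq_nonneg N]
  bdd2 k x := by
    obtain ⟨h0, h1⟩ := smoothStep_mem N (τ k) x
    have h2 : 0 ≤ smoothStep N (τ k) x * (1 - smoothStep N (τ k) x) :=
      mul_nonneg h0 (by linarith)
    have h3 : smoothStep N (τ k) x * (1 - smoothStep N (τ k) x) ≤ 1 := by nlinarith
    have h4 : 0 ≤ N ^ 4 := by positivity
    have h5 : |1 - 2 * smoothStep N (τ k) x| ≤ 1 := by
      rw [abs_le]; constructor <;> linarith
    rw [abs_mul, abs_mul, abs_of_nonneg h4, abs_of_nonneg h2]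
    nlinarith [sq_nonneg N, mul_le_one₀ h3 (abs_nonneg _) h5]

/-- **Gordon's comparison inequality** for finite Gaussian families. -/
theorem gordon {ι : Type*} [Fintype ι] [DecidableEq ι] (P Q : I × J → ι → ℝ) (τ : I × J → ℝ)
    (horth : ∀ k l, ∑ d, P k d * Q l d = 0)
    (hsame : ∀ i j j', ∑ d, P (i, j) d * P (i, j') d = ∑ d, Q (i, j) d * Q (i, j') d)
    (hne : ∀ i j i' j', ∑ d, Q (i, j) d * Q (i', j') d ≤ ∑ d, P (i, j) d * P (i', j') d) :
    (Measure.pi fun _ : ι => gaussianReal 0 1)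
        {x | ∀ i, ∃ j, τ (i, j) < ∑ d, Q (i, j) d * x d} ≤
      (Measure.pi fun _ : ι => gaussianReal 0 1)
        {x | ∀ i, ∃ j, τ (i, j) < ∑ d, P (i, j) d * x d} := by
  have h := le_of_tendsto_of_tendsto' (tendsto_integral_minMaxProd τ Q)
    (tendsto_integral_minMaxProd τ P) fun N => by
      refine (isTest_minMaxProd N τ).integral_comparison P Q horth
        (fun k => hsame k.1 k.2 k.2) fun k l z => ?_
      obtain ⟨i, j⟩ := k
      obtain ⟨i', j'⟩ := l
      -- Within a row the covariances agree and the sign condition reads `0 ≤ 0`. Across rows the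
      -- second difference is nonnegative and the two slopes are both nonpositive.
      by_cases hi : i = i'
      · subst hi
        rw [hsame]; simp
      · have hs := fun k => smoothStep_mem (N : ℝ) (τ k) (z k)
        have hd : ∀ k, -(N : ℝ) ^ 2 * (smoothStep N (τ k) (z k) * (1 - smoothStep N (τ k) (z k))) ≤ 0 :=
          fun k => mul_nonpos_of_nonpos_of_nonneg (by simp)
            (mul_nonneg (hs k).1 (by linarith [(hs k).2]))
        refine mul_nonneg (sub_nonneg.2 (hne _ _ _ _)) ?_
        rw [mul_assoc]
        exact mul_nonneg (coordDiff_coordDiff_minMaxProd_nonneg _ hs hi _ _)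
          (mul_nonneg_of_nonpos_of_nonpos (hd _) (hd _))
  rwa [measureReal_def, measureReal_def, ENNReal.toReal_le_toReal (measure_ne_top _ _)
    (measure_ne_top _ _)] at h

end Gordon

/-! ### The Euclidean norm -/

section L2

variable {k : ℕ}

lemma l2_nonneg (v : Fin k → ℝ) : 0 ≤ l2 v := norm_nonneg _

lemma l2_sq (v : Fin k → ℝ) : l2 v ^ 2 = v ⬝ᵥ v := by
  rw [l2, EuclideanSpace.real_norm_sq_eq]
  simp [dotProduct, sq]

lemma l2_zero : l2 (0 : Fin k → ℝ) = 0 := by simp [l2]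

lemma l2_pos {v : Fin k → ℝ} (h : v ≠ 0) : 0 < l2 v := by
  rw [l2, norm_pos_iff]; simpa using h

lemma l2_smul (t : ℝ) (v : Fin k → ℝ) : l2 (t • v) = |t| * l2 v := by
  simp [l2, norm_smul]

lemma l2_sub_le (v w : Fin k → ℝ) : |l2 v - l2 w| ≤ l2 (v - w) := by
  simpa [l2] using abs_norm_sub_norm_le (WithLp.toLp 2 v) (WithLp.toLp 2 w)

lemma abs_dotProduct_le_l2 (v w : Fin k → ℝ) : |v ⬝ᵥ w| ≤ l2 v * l2 w := by
  have h := abs_real_inner_le_norm (WithLp.toLp 2 w) (WithLp.toLp 2 v)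
  rw [EuclideanSpace.inner_toLp_toLp] at h
  simpa [l2, mul_comm, dotProduct_comm] using h

lemma dotProduct_le_l2 (v w : Fin k → ℝ) : v ⬝ᵥ w ≤ l2 v * l2 w :=
  (le_abs_self _).trans (abs_dotProduct_le_l2 v w)

lemma continuous_l2 : Continuous (l2 : (Fin k → ℝ) → ℝ) := by
  unfold l2; fun_prop

end L2

/-! ### Comparison of the primal and the dual processes -/

section Comparison

variable {m n : ℕ}

instance : IsProbabilityMeasure (gaussVec n) := by unfold gaussVec; infer_instance
instance : IsProbabilityMeasure (gaussMat m n) := by unfold gaussMat; infer_instance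
instance : IsProbabilityMeasure (gaussPair m n) := by unfold gaussPair; infer_instance

lemma measurePreserving_gaussPair :
    MeasurePreserving (fun G : Fin m ⊕ Fin n → ℝ => (fun i => G (Sum.inl i), fun j => G (Sum.inr j)))
      (Measure.pi fun _ => gaussianReal 0 1) (gaussPair m n) :=
  measurePreserving_sumPiEquivProdPi fun _ : Fin m ⊕ Fin n => gaussianReal 0 1

lemma measurePreserving_gaussMat :
    MeasurePreserving (fun (G : Fin m × Fin n → ℝ) i j => G (i, j))
      (Measure.pi fun _ => gaussianReal 0 1) (gaussMat m n) := by
  refine ⟨by fun_prop, ?_⟩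
  have h := Measure.infinitePi_map_curry (ι := Fin m) (κ := Fin n) (X := ℝ)
    (fun _ _ => gaussianReal 0 1)
  simp only [Measure.infinitePi_eq_pi] at h
  exact h

lemma measurePreserving_gaussMat_prod :
    MeasurePreserving (fun G : (Fin m × Fin n) ⊕ Unit → ℝ =>
        ((fun i j => G (Sum.inl (i, j))), G (Sum.inr ())))
      (Measure.pi fun _ => gaussianReal 0 1) ((gaussMat m n).prod (gaussianReal 0 1)) := by
  have h := measurePreserving_sumPiEquivProdPi fun _ : (Fin m × Fin n) ⊕ Unit => gaussianReal 0 1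
  exact ((measurePreserving_gaussMat (m := m) (n := n)).prod
    (measurePreserving_eval (fun _ : Unit => gaussianReal 0 1) ())).comp h

/-- The index type of all Gaussian coordinates involved in the comparison. -/
abbrev CompIdx (m n : ℕ) := ((Fin m × Fin n) ⊕ Unit) ⊕ (Fin m ⊕ Fin n)

/-- Coefficients of `lᵀAx + ‖x‖‖l‖γ`. -/
noncomputable def primalCoeff (x : Fin n → ℝ) (l : Fin m → ℝ) : CompIdx m n → ℝ :=
  Sum.elim (Sum.elim (fun ij => l ij.1 * x ij.2) fun _ => l2 x * l2 l) fun _ => 0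

/-- Coefficients of `‖x‖lᵀg + ‖l‖hᵀx`. -/
noncomputable def dualCoeff (x : Fin n → ℝ) (l : Fin m → ℝ) : CompIdx m n → ℝ :=
  Sum.elim (fun _ => 0) (Sum.elim (fun i => l2 x * l i) fun j => l2 l * x j)

lemma sum_primalCoeff_mul (x : Fin n → ℝ) (l : Fin m → ℝ) (G : CompIdx m n → ℝ) :
    ∑ d, primalCoeff x l d * G d =
      l ⬝ᵥ (Matrix.of (fun i j => G (Sum.inl (Sum.inl (i, j)))) *ᵥ x) +
        l2 x * l2 l * G (Sum.inl (Sum.inr ())) := by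
  simp only [Fintype.sum_sum_type, primalCoeff, Sum.elim_inl, Sum.elim_inr, Fintype.sum_prod_type,
    dotProduct, mulVec, Matrix.of_apply, Finset.mul_sum, zero_mul, Finset.sum_const_zero, add_zero]
  congr 1
  · exact Finset.sum_congr rfl fun i _ => Finset.sum_congr rfl fun j _ => by ring
  · simp

lemma sum_dualCoeff_mul (x : Fin n → ℝ) (l : Fin m → ℝ) (G : CompIdx m n → ℝ) :
    ∑ d, dualCoeff x l d * G d = l2 x * (l ⬝ᵥ fun i => G (Sum.inr (Sum.inl i))) +
        l2 l * ((fun j => G (Sum.inr (Sum.inr j))) ⬝ᵥ x) := by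
  simp only [Fintype.sum_sum_type, dualCoeff, Sum.elim_inl, Sum.elim_inr,
    dotProduct, Finset.mul_sum, zero_mul, Finset.sum_const_zero, zero_add]
  congr 1
  · exact Finset.sum_congr rfl fun i _ => by ring
  · exact Finset.sum_congr rfl fun i _ => by ring

lemma sum_primalCoeff_mul_primalCoeff (x x' : Fin n → ℝ) (l l' : Fin m → ℝ) :
    ∑ d, primalCoeff x l d * primalCoeff x' l' d =
      (l ⬝ᵥ l') * (x ⬝ᵥ x') + l2 x * l2 l * (l2 x' * l2 l') := by
  rw [sum_primalCoeff_mul]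
  congr 1
  simp only [primalCoeff, Sum.elim_inl, dotProduct, mulVec, Matrix.of_apply, Finset.mul_sum,
    Finset.sum_mul]
  rw [Finset.sum_comm]
  exact Finset.sum_congr rfl fun i _ => Finset.sum_congr rfl fun j _ => by ring

lemma sum_dualCoeff_mul_dualCoeff (x x' : Fin n → ℝ) (l l' : Fin m → ℝ) :
    ∑ d, dualCoeff x l d * dualCoeff x' l' d =
      l2 x * l2 x' * (l ⬝ᵥ l') + l2 l * l2 l' * (x ⬝ᵥ x') := by
  rw [sum_dualCoeff_mul]
  simp only [dualCoeff, Sum.elim_inl, Sum.elim_inr, dotProduct, Finset.mul_sum]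
  congr 1
  · exact Finset.sum_congr rfl fun i _ => by ring
  · exact Finset.sum_congr rfl fun i _ => by ring

lemma sum_primalCoeff_mul_dualCoeff (x x' : Fin n → ℝ) (l l' : Fin m → ℝ) :
    ∑ d, primalCoeff x l d * dualCoeff x' l' d = 0 := by
  simp [primalCoeff, dualCoeff]

/-- Gordon's inequality for the primal and dual processes, on finite families. -/
lemma gordon_finite (N M : ℕ) (xs : ℕ → Fin n → ℝ) (ls : ℕ → Fin m → ℝ)
    (τ : (Fin n → ℝ) → (Fin m → ℝ) → ℝ) :
    gaussPair m n {gh | ∀ i : Fin N, ∃ j : Fin M, τ (xs i) (ls j) <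
        l2 (xs i) * (ls j ⬝ᵥ gh.1) + l2 (ls j) * (gh.2 ⬝ᵥ xs i)} ≤
      ((gaussMat m n).prod (gaussianReal 0 1)) {p | ∀ i : Fin N, ∃ j : Fin M, τ (xs i) (ls j) <
        ls j ⬝ᵥ (Matrix.of p.1 *ᵥ xs i) + l2 (xs i) * l2 (ls j) * p.2} := by
  have h := gordon (I := Fin N) (J := Fin M) (fun k => primalCoeff (xs k.1) (ls k.2))
    (fun k => dualCoeff (xs k.1) (ls k.2)) (fun k => τ (xs k.1) (ls k.2))
    (fun k l => sum_primalCoeff_mul_dualCoeff _ _ _ _) (fun i j j' => by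
      rw [sum_primalCoeff_mul_primalCoeff, sum_dualCoeff_mul_dualCoeff, ← l2_sq]; ring)
    (fun i j i' j' => by
      rw [sum_primalCoeff_mul_primalCoeff, sum_dualCoeff_mul_dualCoeff]
      -- The covariance difference is exactly this product of two Cauchy–Schwarz defects; for equal
      -- `x` the first defect is zero, which was the preceding condition.
      nlinarith [mul_nonneg (sub_nonneg.2 (dotProduct_le_l2 (xs i) (xs i')))
        (sub_nonneg.2 (dotProduct_le_l2 (ls j) (ls j')))])
  simp only [sum_primalCoeff_mul, sum_dualCoeff_mul] at h
  have hsum := measurePreserving_sumPiEquivProdPi fun _ : CompIdx m n => gaussianReal 0 1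
  have h1 := measurePreserving_gaussPair.comp (measurePreserving_snd.comp hsum)
  have h2 := measurePreserving_gaussMat_prod.comp (measurePreserving_fst.comp hsum)
  have m1 : MeasurableSet {gh : (Fin m → ℝ) × (Fin n → ℝ) | ∀ i : Fin N, ∃ j : Fin M,
      τ (xs i) (ls j) < l2 (xs i) * (ls j ⬝ᵥ gh.1) + l2 (ls j) * (gh.2 ⬝ᵥ xs i)} := by
    simp only [Set.ofPred_forall, Set.ofPred_exists]
    refine MeasurableSet.iInter fun i => MeasurableSet.iUnion fun j =>
      measurableSet_lt measurable_const ?_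
    unfold dotProduct; fun_prop
  have m2 : MeasurableSet {p : (Fin m → Fin n → ℝ) × ℝ | ∀ i : Fin N, ∃ j : Fin M,
      τ (xs i) (ls j) < ls j ⬝ᵥ (Matrix.of p.1 *ᵥ xs i) + l2 (xs i) * l2 (ls j) * p.2} := by
    simp only [Set.ofPred_forall, Set.ofPred_exists]
    refine MeasurableSet.iInter fun i => MeasurableSet.iUnion fun j =>
      measurableSet_lt measurable_const ?_
    simp only [dotProduct, mulVec, Matrix.of_apply]; fun_prop
  rw [← h1.measure_preimage m1.nullMeasurableSet, ← h2.measure_preimage m2.nullMeasurableSet]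
  exact h

/-- Gordon's inequality for the primal and dual processes, on countable families. -/
lemma gordon_countable (xs : ℕ → Fin n → ℝ) (ls : ℕ → Fin m → ℝ)
    (τ : (Fin n → ℝ) → (Fin m → ℝ) → ℝ) :
    gaussPair m n {gh | ∀ i, ∃ j, τ (xs i) (ls j) <
        l2 (xs i) * (ls j ⬝ᵥ gh.1) + l2 (ls j) * (gh.2 ⬝ᵥ xs i)} ≤
      ((gaussMat m n).prod (gaussianReal 0 1)) {p | ∀ i, ∃ j, τ (xs i) (ls j) <
        ls j ⬝ᵥ (Matrix.of p.1 *ᵥ xs i) + l2 (xs i) * l2 (ls j) * p.2} := by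
  have step : ∀ N : ℕ, gaussPair m n {gh | ∀ i : Fin N, ∃ j, τ (xs i) (ls j) <
        l2 (xs i) * (ls j ⬝ᵥ gh.1) + l2 (ls j) * (gh.2 ⬝ᵥ xs i)} ≤
      ((gaussMat m n).prod (gaussianReal 0 1)) {p | ∀ i : Fin N, ∃ j, τ (xs i) (ls j) <
        ls j ⬝ᵥ (Matrix.of p.1 *ᵥ xs i) + l2 (xs i) * l2 (ls j) * p.2} := by
    intro N
    have hU : {gh : (Fin m → ℝ) × (Fin n → ℝ) | ∀ i : Fin N, ∃ j, τ (xs i) (ls j) <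
        l2 (xs i) * (ls j ⬝ᵥ gh.1) + l2 (ls j) * (gh.2 ⬝ᵥ xs i)} =
        ⋃ M : ℕ, {gh | ∀ i : Fin N, ∃ j : Fin M, τ (xs i) (ls j) <
        l2 (xs i) * (ls j ⬝ᵥ gh.1) + l2 (ls j) * (gh.2 ⬝ᵥ xs i)} := by
      ext gh
      simp only [Set.mem_ofPred_eq, Set.mem_iUnion]
      constructor
      · intro h
        choose j hj using h
        -- The witnesses `j i` have a common bound because the rows are still finite in number. So
        -- the columns are exhausted first and the rows afterwards.
        exact ⟨Finset.univ.sup j + 1, fun i =>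
          ⟨⟨j i, Nat.lt_succ_of_le (Finset.le_sup (Finset.mem_univ i))⟩, hj i⟩⟩
      · rintro ⟨M, h⟩ i
        obtain ⟨j, hj⟩ := h i
        exact ⟨j, hj⟩
    rw [hU, Monotone.measure_iUnion]
    · refine iSup_le fun M => (gordon_finite N M xs ls τ).trans (measure_mono fun p hp i => ?_)
      obtain ⟨j, hj⟩ := hp i
      exact ⟨j, hj⟩
    · intro M M' hM gh hgh i
      obtain ⟨j, hj⟩ := hgh i
      exact ⟨Fin.castLE hM j, hj⟩
  have hI : {p : (Fin m → Fin n → ℝ) × ℝ | ∀ i, ∃ j, τ (xs i) (ls j) <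
        ls j ⬝ᵥ (Matrix.of p.1 *ᵥ xs i) + l2 (xs i) * l2 (ls j) * p.2} =
      ⋂ N : ℕ, {p | ∀ i : Fin N, ∃ j, τ (xs i) (ls j) <
        ls j ⬝ᵥ (Matrix.of p.1 *ᵥ xs i) + l2 (xs i) * l2 (ls j) * p.2} := by
    ext p
    simp only [Set.mem_ofPred_eq, Set.mem_iInter]
    exact ⟨fun h N i => h i, fun h i => h (i + 1) ⟨i, Nat.lt_succ_self i⟩⟩
  rw [hI, Antitone.measure_iInter]
  · refine le_iInf fun N => le_trans (measure_mono ?_) (step N)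
    exact fun gh h i => h i
  · intro N N' hN p hp i
    exact hp (Fin.castLE hN i)
  · intro N
    refine MeasurableSet.nullMeasurableSet ?_
    simp only [Set.ofPred_forall, Set.ofPred_exists]
    refine MeasurableSet.iInter fun i => MeasurableSet.iUnion fun j =>
      measurableSet_lt measurable_const ?_
    simp only [dotProduct, mulVec, Matrix.of_apply]; fun_prop
  · exact ⟨0, measure_ne_top _ _⟩

end Comparison

/-! ### Passing from the saddle values to countable families -/

section FrpFrd

variable {m n : ℕ}

/-- The gap `s' < s` turns the supremum into an actual multiplier; the strict inequality is open in
it, so it also holds on the dense sequence. -/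
lemma exists_lt_of_le_frd {c : Fin n → ℝ} {a : Fin m → ℝ} {gh : (Fin m → ℝ) × (Fin n → ℝ)}
    {s s' : ℝ} (hs : s' < s) (h : (s : EReal) ≤ frd c a gh) {ls : ℕ → {l : Fin m → ℝ // 0 ≤ l}}
    (hls : DenseRange ls) (x : Fin n → ℝ) :
    ∃ j, s' < (1 / √(n : ℝ)) *
      (c ⬝ᵥ x + l2 x * ((ls j).1 ⬝ᵥ gh.1) + l2 (ls j).1 * (gh.2 ⬝ᵥ x) - (ls j).1 ⬝ᵥ a) := by
  have h1 : (s' : EReal) < ⨆ l : {l : Fin m → ℝ // 0 ≤ l}, (((1 / √(n : ℝ)) *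
      (c ⬝ᵥ x + l2 x * (l.1 ⬝ᵥ gh.1) + l2 l.1 * (gh.2 ⬝ᵥ x) - l.1 ⬝ᵥ a) : ℝ) : EReal) :=
    (EReal.coe_lt_coe_iff.2 hs).trans_le (h.trans (iInf_le _ x))
  obtain ⟨l, hl⟩ := lt_iSup_iff.1 h1
  have hc : Continuous fun l : {l : Fin m → ℝ // 0 ≤ l} => (1 / √(n : ℝ)) *
      (c ⬝ᵥ x + l2 x * (l.1 ⬝ᵥ gh.1) + l2 l.1 * (gh.2 ⬝ᵥ x) - l.1 ⬝ᵥ a) := by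
    refine Continuous.comp (g := fun l : Fin m → ℝ => (1 / √(n : ℝ)) *
      (c ⬝ᵥ x + l2 x * (l ⬝ᵥ gh.1) + l2 l * (gh.2 ⬝ᵥ x) - l ⬝ᵥ a)) ?_ continuous_subtype_val
    have h1 := continuous_l2 (k := m)
    unfold dotProduct
    fun_prop
  exact hls.exists_mem_open (isOpen_lt continuous_const hc) ⟨l, EReal.coe_lt_coe_iff.1 hl⟩

/-- If the primal value is less than `s`, then some point is feasible with objective below `s`. -/
lemma exists_feasible_of_frp_lt {c : Fin n → ℝ} {a : Fin m → ℝ} {A : Fin m → Fin n → ℝ} {s : ℝ}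
    (hn : 0 < n) (h : frp c a A < s) :
    ∃ x : Fin n → ℝ, (1 / √(n : ℝ)) * (c ⬝ᵥ x) < s ∧
      ∀ l : Fin m → ℝ, 0 ≤ l → l ⬝ᵥ (Matrix.of A *ᵥ x) - l ⬝ᵥ a ≤ 0 := by
  obtain ⟨x, hx⟩ := iInf_lt_iff.1 h
  have hx' : ∀ l : Fin m → ℝ, 0 ≤ l →
      (1 / √(n : ℝ)) * (c ⬝ᵥ x + l ⬝ᵥ (Matrix.of A *ᵥ x) - l ⬝ᵥ a) < s := fun l hl =>
    EReal.coe_lt_coe_iff.1 ((le_iSup (fun l : {l : Fin m → ℝ // 0 ≤ l} =>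
      (((1 / √(n : ℝ)) * (c ⬝ᵥ x + l.1 ⬝ᵥ (Matrix.of A *ᵥ x) - l.1 ⬝ᵥ a) : ℝ) : EReal))
      ⟨l, hl⟩).trans_lt hx)
  have hn' : 0 < 1 / √(n : ℝ) := by positivity
  refine ⟨x, by simpa using hx' 0 le_rfl, fun l hl => ?_⟩
  -- A violation `w > 0` can be scaled: `t • l` contributes exactly `|s√n - cᵀx|`, enough to bring
  -- the value up to `s`.
  by_contra! hpos
  set w := l ⬝ᵥ (Matrix.of A *ᵥ x) - l ⬝ᵥ a with hw
  set t := |s * √n - c ⬝ᵥ x| / w with ht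
  have h1 := hx' (t • l) (smul_nonneg (by positivity) hl)
  rw [smul_dotProduct, smul_dotProduct, smul_eq_mul, smul_eq_mul, add_sub_assoc, ← mul_sub, ← hw,
    ht, div_mul_cancel₀ _ hpos.ne', one_div, inv_mul_lt_iff₀ (by positivity)] at h1
  linarith [le_abs_self (s * √n - c ⬝ᵥ x)]

/-- A feasible point can be moved into a dense set at the cost of a slack proportional to
`‖x‖‖l‖`. -/
lemma exists_dense_of_frp_lt {c : Fin n → ℝ} {a : Fin m → ℝ} {A : Fin m → Fin n → ℝ} {s γ : ℝ}
    (hn : 0 < n) (h : frp c a A < s) (hγ : γ < 0) {xs : ℕ → Fin n → ℝ} (hxs : DenseRange xs)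
    (hx0 : ∃ i, xs i = 0) :
    ∃ i, ∀ l : Fin m → ℝ, 0 ≤ l → (1 / √(n : ℝ)) *
      (c ⬝ᵥ xs i + (l ⬝ᵥ (Matrix.of A *ᵥ xs i) + l2 (xs i) * l2 l * γ) - l ⬝ᵥ a) ≤ s := by
  obtain ⟨x, hxs', hxl⟩ := exists_feasible_of_frp_lt hn h
  have hn' : 0 < 1 / √(n : ℝ) := by positivity
  -- The slack `‖x‖‖l‖γ` vanishes at the origin, so the origin itself has to be in the sequence.
  -- Elsewhere the slack absorbs the error `‖l‖‖A(y - x)‖` of a small move.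
  by_cases hx : x = 0
  · obtain ⟨i, hi⟩ := hx0
    refine ⟨i, fun l hl => le_trans ?_ hxs'.le⟩
    have := hxl l hl
    rw [hi, ← hx]
    refine mul_le_mul_of_nonneg_left ?_ hn'.le
    rw [hx, l2_zero]
    rw [hx] at this
    linarith
  · have hcont : Continuous fun y : Fin n → ℝ =>
        l2 (Matrix.of A *ᵥ (y - x)) + l2 y * γ :=
      (continuous_l2.comp (Continuous.matrix_mulVec continuous_const (by fun_prop))).add
        (continuous_l2.mul continuous_const)
    have hopen : IsOpen {y : Fin n → ℝ | (1 / √(n : ℝ)) * (c ⬝ᵥ y) < s ∧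
        l2 (Matrix.of A *ᵥ (y - x)) + l2 y * γ < 0} := by
      refine IsOpen.and (isOpen_lt ?_ continuous_const) (isOpen_lt hcont continuous_const)
      unfold dotProduct; fun_prop
    obtain ⟨i, hi1, hi2⟩ := hxs.exists_mem_open hopen ⟨x, hxs', by
      simpa [l2_zero] using mul_neg_of_pos_of_neg (l2_pos hx) hγ⟩
    refine ⟨i, fun l hl => le_trans (mul_le_mul_of_nonneg_left ?_ hn'.le) hi1.le⟩
    have h1 := hxl l hl
    have h2 := dotProduct_le_l2 l (Matrix.of A *ᵥ (xs i - x))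
    rw [mulVec_sub, dotProduct_sub, ← mulVec_sub] at h2
    nlinarith [l2_nonneg l]

/-- The lower tail of the primal is controlled by the lower tail of the dual. -/
theorem measure_frp_lt_mul_le (hn : 0 < n) (c : Fin n → ℝ) (a : Fin m → ℝ) {s s' : ℝ}
    (hs : s' < s) :
    gaussMat m n {A | frp c a A < s'} * gaussianReal 0 1 (Set.Iio 0) ≤
      gaussPair m n {gh | frd c a gh < s} := by
  set ls := TopologicalSpace.denseSeq {l : Fin m → ℝ // 0 ≤ l} with hls
  set xs : ℕ → Fin n → ℝ := fun i => Nat.casesOn i 0 (TopologicalSpace.denseSeq (Fin n → ℝ)) with hxs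
  have hxd : DenseRange xs := by
    refine (TopologicalSpace.denseRange_denseSeq (Fin n → ℝ)).mono ?_
    rintro _ ⟨i, rfl⟩
    exact ⟨i + 1, rfl⟩
  have hn' : 0 < √(n : ℝ) := by positivity
  -- The threshold carries the deterministic part of the Lagrangian, so that exceeding it means a
  -- normalized Lagrangian above `s'`.
  set τ : (Fin n → ℝ) → (Fin m → ℝ) → ℝ := fun x l => √(n : ℝ) * s' - c ⬝ᵥ x + l ⬝ᵥ a with hτ
  have hτiff : ∀ x l (w : ℝ), τ x l < w ↔ s' < (1 / √(n : ℝ)) * (c ⬝ᵥ x + w - l ⬝ᵥ a) := by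
    intro x l w
    rw [one_div, lt_inv_mul_iff₀ hn', hτ]
    constructor <;> intro h <;> linarith
  have hG := gordon_countable xs (fun j => (ls j).1) τ
  set V := {p : (Fin m → Fin n → ℝ) × ℝ | ∀ i, ∃ j, τ (xs i) (ls j).1 <
        (ls j).1 ⬝ᵥ (Matrix.of p.1 *ᵥ xs i) + l2 (xs i) * l2 (ls j).1 * p.2} with hV
  have hVm : MeasurableSet V := by
    simp only [hV, Set.ofPred_forall, Set.ofPred_exists]
    refine MeasurableSet.iInter fun i => MeasurableSet.iUnion fun j =>
      measurableSet_lt measurable_const ?_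
    simp only [dotProduct, mulVec, Matrix.of_apply]; fun_prop
  -- If `frp < s'` and `γ < 0`, some point of the sequence admits no multiplier beating `s'`, so the
  -- sample lies outside `V`. Independence gives the product.
  have h1 : gaussMat m n {A | frp c a A < s'} * gaussianReal 0 1 (Set.Iio 0) ≤
      ((gaussMat m n).prod (gaussianReal 0 1)) Vᶜ := by
    rw [← Measure.prod_prod]
    refine measure_mono ?_
    rintro ⟨A, γ⟩ ⟨hA, hγ⟩ hv
    obtain ⟨i, hi⟩ := exists_dense_of_frp_lt hn hA hγ hxd ⟨0, rfl⟩
    obtain ⟨j, hj⟩ := hv i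
    exact absurd (hi (ls j).1 (ls j).2) (not_le.2 ((hτiff _ _ _).1 hj))
  have h2 : gaussPair m n {gh | (s : EReal) ≤ frd c a gh} ≤
      ((gaussMat m n).prod (gaussianReal 0 1)) V := by
    refine le_trans (measure_mono ?_) hG
    intro gh hgh i
    obtain ⟨j, hj⟩ := exists_lt_of_le_frd hs hgh (TopologicalSpace.denseRange_denseSeq _) (xs i)
    exact ⟨j, (hτiff _ _ _).2 (by simpa only [add_assoc] using hj)⟩
  refine h1.trans ?_
  rw [prob_compl_eq_one_sub hVm, tsub_le_iff_right]
  calc (1 : ENNReal) = gaussPair m n Set.univ := measure_univ.symm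
    _ ≤ gaussPair m n ({gh | frd c a gh < s} ∪ {gh | (s : EReal) ≤ frd c a gh}) :=
        measure_mono fun gh _ => lt_or_ge (frd c a gh) s
    _ ≤ _ := (measure_union_le _ _).trans (add_le_add_right h2 _)

/-! ### Measurability of the values -/

/-- A value below `s` is witnessed in some ball with a rational bound `q < s`. For fixed ball and
`q`, the set of such `ω` is the projection of a closed set along a compact factor, hence closed;
this allows an uncountable family of multipliers. -/
lemma measurable_iInf_iSup {Ω X Λ : Type*} [TopologicalSpace Ω] [MeasurableSpace Ω] [BorelSpace Ω]
    [PseudoMetricSpace X] [ProperSpace X] [Nonempty X] (Φ : Ω → X → Λ → ℝ)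
    (hΦ : ∀ l, Continuous fun p : Ω × X => Φ p.1 p.2 l) :
    Measurable fun ω => ⨅ x, ⨆ l, (Φ ω x l : EReal) := by
  obtain ⟨x₀⟩ := ‹Nonempty X›
  refine measurable_of_Iio fun s => ?_
  have h : (fun ω => ⨅ x, ⨆ l, (Φ ω x l : EReal)) ⁻¹' Set.Iio s =
      ⋃ (q : ℚ) (_ : ((q : ℝ) : EReal) < s) (k : ℕ),
        {ω | ∃ x ∈ Metric.closedBall x₀ k, ∀ l, Φ ω x l ≤ q} := by
    ext ω
    simp only [Set.mem_preimage, Set.mem_Iio, iInf_lt_iff, Set.mem_iUnion, Set.mem_ofPred_eq]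
    constructor
    · rintro ⟨x, hx⟩
      obtain ⟨q, hq1, hq2⟩ := EReal.lt_iff_exists_rat_btwn.1 hx
      obtain ⟨k, hk⟩ := exists_nat_ge (dist x x₀)
      exact ⟨q, hq2, k, x, hk, fun l => EReal.coe_le_coe_iff.1 ((le_iSup _ l).trans hq1.le)⟩
    · rintro ⟨q, hq, k, x, -, hx⟩
      exact ⟨x, (iSup_le fun l => EReal.coe_le_coe_iff.2 (hx l)).trans_lt hq⟩
  rw [h]
  refine MeasurableSet.iUnion fun q => MeasurableSet.iUnion fun _ => MeasurableSet.iUnion fun k => ?_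
  refine IsClosed.measurableSet ?_
  have hK : CompactSpace (Metric.closedBall x₀ (k : ℝ)) :=
    isCompact_iff_compactSpace.1 (isCompact_closedBall _ _)
  have hcl : IsClosed {p : Ω × Metric.closedBall x₀ (k : ℝ) | ∀ l, Φ p.1 p.2.1 l ≤ q} := by
    rw [Set.ofPred_forall]
    refine isClosed_iInter fun l => isClosed_le ?_ continuous_const
    exact (hΦ l).comp (continuous_fst.prodMk (continuous_subtype_val.comp continuous_snd))
  convert isClosedMap_fst_of_compactSpace _ hcl
  ext ω
  simp

lemma measurable_frp (c : Fin n → ℝ) (a : Fin m → ℝ) : Measurable (frp c a) := by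
  refine measurable_iInf_iSup (fun (A : Fin m → Fin n → ℝ) (x : Fin n → ℝ)
    (l : {l : Fin m → ℝ // 0 ≤ l}) => (1 / √(n : ℝ)) *
      (c ⬝ᵥ x + l.1 ⬝ᵥ (Matrix.of A *ᵥ x) - l.1 ⬝ᵥ a)) fun l => ?_
  simp only [dotProduct, mulVec, Matrix.of_apply]
  fun_prop

lemma measurable_frd (c : Fin n → ℝ) (a : Fin m → ℝ) : Measurable (frd c a) := by
  refine measurable_iInf_iSup (fun (gh : (Fin m → ℝ) × (Fin n → ℝ)) (x : Fin n → ℝ)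
    (l : {l : Fin m → ℝ // 0 ≤ l}) => (1 / √(n : ℝ)) *
      (c ⬝ᵥ x + l2 x * (l.1 ⬝ᵥ gh.1) + l2 l.1 * (gh.2 ⬝ᵥ x) - l.1 ⬝ᵥ a)) fun l => ?_
  have h : Continuous fun p : ((Fin m → ℝ) × (Fin n → ℝ)) × (Fin n → ℝ) => l2 p.2 :=
    continuous_l2.comp continuous_snd
  unfold dotProduct
  fun_prop

end FrpFrd

/-! ### Products of measures with densities -/

lemma pi_withDensity {ι : Type*} [Fintype ι] (μ : Measure ℝ) [SigmaFinite μ] {ρ : ℝ → ℝ}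
    (hρ0 : ∀ x, 0 ≤ ρ x) (hi : Integrable ρ μ) :
    (Measure.pi fun _ : ι => μ.withDensity fun x => ENNReal.ofReal (ρ x)) =
      (Measure.pi fun _ : ι => μ).withDensity fun x => ENNReal.ofReal (∏ i, ρ (x i)) := by
  have : IsFiniteMeasure (μ.withDensity fun x => ENNReal.ofReal (ρ x)) :=
    isFiniteMeasure_withDensity_ofReal hi.2
  refine (Measure.pi_eq fun s hs => ?_)
  rw [withDensity_apply _ (MeasurableSet.univ_pi hs), ← lintegral_indicator (MeasurableSet.univ_pi hs)]
  have e : ∀ x : ι → ℝ, (Set.univ.pi s).indicator (fun x => ENNReal.ofReal (∏ i, ρ (x i))) x =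
      ENNReal.ofReal (∏ i, (s i).indicator ρ (x i)) := by
    intro x
    by_cases hx : x ∈ Set.univ.pi s
    · rw [Set.indicator_of_mem hx]
      congr 1
      exact Finset.prod_congr rfl fun i _ => by rw [Set.indicator_of_mem (hx i (Set.mem_univ i))]
    · rw [Set.indicator_of_notMem hx]
      rw [Set.mem_univ_pi] at hx
      push Not at hx
      obtain ⟨i, hi⟩ := hx
      rw [Finset.prod_eq_zero (Finset.mem_univ i) (Set.indicator_of_notMem hi _), ENNReal.ofReal_zero]
  have hi' : ∀ i, Integrable ((s i).indicator ρ) μ := fun i => hi.indicator (hs i)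
  have h0 : ∀ i x, 0 ≤ (s i).indicator ρ x := fun i x => Set.indicator_nonneg (fun x _ => hρ0 x) x
  simp_rw [e]
  rw [← ofReal_integral_eq_lintegral_ofReal (Integrable.fintype_prod_dep hi')
    (Eventually.of_forall fun x => Finset.prod_nonneg fun i _ => h0 i _),
    integral_fintype_prod_eq_prod (fun i => (s i).indicator ρ),
    ENNReal.ofReal_prod_of_nonneg fun i _ => integral_nonneg (h0 i)]
  refine Finset.prod_congr rfl fun i _ => ?_
  rw [withDensity_apply _ (hs i), ofReal_integral_eq_lintegral_ofReal (hi' i)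
    (Eventually.of_forall (h0 i)), ← lintegral_indicator (hs i)]
  congr with x
  by_cases hx : x ∈ s i <;> simp [hx]

lemma pi_gaussian_absolutelyContinuous (ι : Type*) [Fintype ι] :
    (Measure.pi fun _ : ι => gaussianReal 0 1) ≪ volume := by
  rw [gaussianReal_of_var_ne_zero 0 one_ne_zero]
  have h := pi_withDensity (ι := ι) volume
    (gaussianPDFReal_nonneg 0 1) (integrable_gaussianPDFReal 0 1)
  have e : gaussianPDF 0 1 = fun x => ENNReal.ofReal (gaussianPDFReal 0 1 x) := rfl
  rw [e, h, volume_pi]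
  exact withDensity_absolutelyContinuous _ _

/-! ### Concentration of Lipschitz functions -/

section Poincare

variable {ι : Type*} [Fintype ι]

local notation "E" => EuclideanSpace ℝ ι

lemma stdGaussian_absolutelyContinuous :
    stdGaussian (EuclideanSpace ℝ ι) ≪ (volume : Measure (EuclideanSpace ℝ ι)) := by
  rw [← map_pi_eq_stdGaussian, ← (PiLp.volume_preserving_toLp ι).map_eq]
  exact (pi_gaussian_absolutelyContinuous ι).map (by fun_prop)

lemma integrable_norm_sq_add :
    Integrable (fun p : E × E => (Real.pi / 2 * (‖p.1‖ + ‖p.2‖)) ^ 2)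
      ((stdGaussian E).prod (stdGaussian E)) := by
  have h : MemLp (fun x : E => ‖x‖) 2 (stdGaussian E) :=
    (IsGaussian.memLp_two_id (μ := stdGaussian E)).norm
  have h1 : MemLp (fun p : E × E => ‖p.1‖) 2 ((stdGaussian E).prod (stdGaussian E)) :=
    h.comp_measurePreserving measurePreserving_fst
  have h2 : MemLp (fun p : E × E => ‖p.2‖) 2 ((stdGaussian E).prod (stdGaussian E)) :=
    h.comp_measurePreserving measurePreserving_snd
  exact ((h1.add h2).const_mul (Real.pi / 2)).integrable_sq

/-- The bound is linear in `t`, so it dominates the difference quotients along the rotation; `1 -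
cos t ≤ t²/2 ≤ t` is where `t ≤ 2` enters. -/
lemma abs_sub_le_rotation {f : E → ℝ} (hf : LipschitzWith 1 f) {t : ℝ} (ht : 0 ≤ t) (x y : E)
    (ht2 : t ≤ 2) :
    |f (Real.cos t • x + Real.sin t • y) - f x| ≤ t * (‖x‖ + ‖y‖) := by
  have h1 := hf.dist_le_mul (Real.cos t • x + Real.sin t • y) x
  rw [Real.dist_eq, dist_eq_norm, NNReal.coe_one, one_mul] at h1
  refine h1.trans ?_
  have e : Real.cos t • x + Real.sin t • y - x = (Real.cos t - 1) • x + Real.sin t • y := by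
    rw [sub_smul, one_smul]; abel
  rw [e, mul_add]
  refine (norm_add_le _ _).trans (add_le_add ?_ ?_)
  · rw [norm_smul]
    refine mul_le_mul_of_nonneg_right ?_ (norm_nonneg _)
    rw [Real.norm_eq_abs, abs_le]
    have := Real.one_sub_sq_div_two_le_cos (x := t)
    constructor
    · nlinarith
    · linarith [Real.cos_le_one t]
  · rw [norm_smul]
    refine mul_le_mul_of_nonneg_right ?_ (norm_nonneg _)
    exact (Real.abs_sin_le_abs).trans_eq (abs_of_nonneg ht)

/-- Maurey–Pisier rotation: the quarter turn from `x` to `y` is cut into `N + 1` arcs,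
Cauchy–Schwarz bounds the square of the telescoping sum, and rotation invariance of the Gaussian
pair makes all arcs contribute as much as the first. -/
lemma integral_sq_sub_le_rotation {f : E → ℝ} (hf : LipschitzWith 1 f) (N : ℕ) :
    ∫ p, (f p.2 - f p.1) ^ 2 ∂((stdGaussian E).prod (stdGaussian E)) ≤
      ∫ p, ((N + 1 : ℝ) * (f (Real.cos (Real.pi / 2 / (N + 1)) • p.1 +
        Real.sin (Real.pi / 2 / (N + 1)) • p.2) - f p.1)) ^ 2
        ∂((stdGaussian E).prod (stdGaussian E)) := by
  set μ := (stdGaussian E).prod (stdGaussian E) with hμ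
  set δ : ℝ := Real.pi / 2 / (N + 1) with hδ
  have hN : (0 : ℝ) < N + 1 := by positivity
  have hδ0 : 0 ≤ δ := by positivity
  have hδ2 : δ ≤ 2 := by
    rw [hδ, div_le_iff₀ hN]
    nlinarith [Real.pi_le_four, (Nat.cast_nonneg N : (0 : ℝ) ≤ N)]
  have hfc := hf.continuous
  set g : E × E → ℝ := fun p => (f (Real.cos δ • p.1 + Real.sin δ • p.2) - f p.1) ^ 2 with hg
  have hgc : Continuous g := by fun_prop
  have hgi : Integrable g μ := by
    refine (integrable_norm_sq_add (ι := ι)).mono' hgc.aestronglyMeasurable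
      (Eventually.of_forall fun p => ?_)
    rw [Real.norm_eq_abs, abs_of_nonneg (sq_nonneg _), sq_le_sq, abs_mul,
      abs_of_nonneg (by positivity : 0 ≤ Real.pi / 2),
      abs_of_nonneg (by positivity : 0 ≤ ‖p.1‖ + ‖p.2‖)]
    refine (abs_sub_le_rotation hf hδ0 p.1 p.2 hδ2).trans
      (mul_le_mul_of_nonneg_right ?_ (by positivity))
    rw [hδ]
    exact div_le_self (by positivity) (by linarith [(Nat.cast_nonneg N : (0 : ℝ) ≤ N)])
  have hrot : ∀ θ, MeasurePreserving (ContinuousLinearMap.rotation θ : E × E →L[ℝ] E × E) μ μ :=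
    fun θ => ⟨by fun_prop, IsGaussian.map_rotation_eq_self (by simp [integral_id_stdGaussian]) θ⟩
  have hstep : ∀ k : ℕ, Integrable (fun p : E × E => g (ContinuousLinearMap.rotation (k * δ) p)) μ ∧
      ∫ p, g (ContinuousLinearMap.rotation (k * δ) p) ∂μ = ∫ p, g p ∂μ := by
    intro k
    refine ⟨(hrot _).integrable_comp_of_integrable hgi, ?_⟩
    conv_rhs => rw [← (hrot (k * δ)).map_eq]
    rw [integral_map (hrot _).aemeasurable hgc.aestronglyMeasurable]
  have hpt : ∀ p : E × E, (f p.2 - f p.1) ^ 2 ≤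
      (N + 1) * ∑ k ∈ Finset.range (N + 1), g (ContinuousLinearMap.rotation (k * δ) p) := by
    intro p
    set Z : ℕ → E := fun k => Real.cos (k * δ) • p.1 + Real.sin (k * δ) • p.2 with hZ
    have h0 : Z 0 = p.1 := by simp [hZ]
    have h1 : Z (N + 1) = p.2 := by
      have : ((N + 1 : ℕ) : ℝ) * δ = Real.pi / 2 := by
        rw [hδ]; push_cast; field_simp
      simp only [hZ, this]; simp
    have h2 : f p.2 - f p.1 = ∑ k ∈ Finset.range (N + 1), (f (Z (k + 1)) - f (Z k)) := by
      rw [Finset.sum_range_sub (fun k => f (Z k)), h0, h1]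
    have h3 : ∀ k : ℕ, g (ContinuousLinearMap.rotation (k * δ) p) = (f (Z (k + 1)) - f (Z k)) ^ 2 := by
      intro k
      simp only [hg, ContinuousLinearMap.rotation_apply, hZ]
      congr 3
      push_cast
      rw [add_mul, one_mul, Real.cos_add, Real.sin_add]
      module
    rw [h2]
    simp_rw [h3]
    have := sq_sum_le_card_mul_sum_sq (s := Finset.range (N + 1)) (f := fun k => f (Z (k + 1)) - f (Z k))
    simpa using this
  calc ∫ p, (f p.2 - f p.1) ^ 2 ∂μ
      ≤ ∫ p, (N + 1) * ∑ k ∈ Finset.range (N + 1), g (ContinuousLinearMap.rotation (k * δ) p) ∂μ := by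
        refine integral_mono_of_nonneg (Eventually.of_forall fun p => sq_nonneg _)
          ((integrable_finsetSum _ fun k _ => (hstep k).1).const_mul _) (Eventually.of_forall hpt)
    _ = ∫ p, ((N + 1 : ℝ) * (f (Real.cos δ • p.1 + Real.sin δ • p.2) - f p.1)) ^ 2 ∂μ := by
        rw [integral_const_mul, integral_finsetSum _ fun k _ => (hstep k).1]
        simp_rw [fun k => (hstep k).2, mul_pow]
        rw [integral_const_mul]
        simp [hg]
        ring

lemma integral_sq_strongDual_stdGaussian (L : StrongDual ℝ E) :
    ∫ x, (L x) ^ 2 ∂(stdGaussian E) = ‖L‖ ^ 2 := by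
  rw [← variance_dual_stdGaussian L, variance_of_integral_eq_zero (by fun_prop)
    (integral_strongDual_stdGaussian L)]

/-- A dimension-free bound for the variance of a Lipschitz function of a Gaussian vector. -/
theorem integral_sq_sub_le_of_lipschitz {f : E → ℝ} (hf : LipschitzWith 1 f) :
    ∫ p, (f p.2 - f p.1) ^ 2 ∂((stdGaussian E).prod (stdGaussian E)) ≤ (Real.pi / 2) ^ 2 := by
  set μ := (stdGaussian E).prod (stdGaussian E) with hμ
  have hfc := hf.continuous
  have hlim : ∀ᵐ p ∂μ, Tendsto (fun N : ℕ => ((N + 1 : ℝ) *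
      (f (Real.cos (Real.pi / 2 / (N + 1)) • p.1 +
        Real.sin (Real.pi / 2 / (N + 1)) • p.2) - f p.1)) ^ 2) atTop
        (𝓝 ((Real.pi / 2 * fderiv ℝ f p.1 p.2) ^ 2)) := by
    -- Rademacher's theorem, transferred from Lebesgue to Gaussian measure.
    have hd : ∀ᵐ x ∂(stdGaussian E), DifferentiableAt ℝ f x :=
      stdGaussian_absolutelyContinuous.ae_le hf.ae_differentiableAt
    have hd' : ∀ᵐ p ∂μ, DifferentiableAt ℝ f p.1 :=
      Measure.quasiMeasurePreserving_fst.ae hd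
    filter_upwards [hd'] with p hp
    refine Tendsto.pow ?_ 2
    have hcurve : HasDerivAt (fun t : ℝ => Real.cos t • p.1 + Real.sin t • p.2) p.2 0 := by
      refine (((Real.hasDerivAt_cos 0).smul_const p.1).add
        ((Real.hasDerivAt_sin 0).smul_const p.2)).congr_deriv ?_
      simp
    have hφ : HasDerivAt (fun t : ℝ => f (Real.cos t • p.1 + Real.sin t • p.2))
        (fderiv ℝ f p.1 p.2) 0 := by
      refine HasFDerivAt.comp_hasDerivAt (0 : ℝ) ?_ hcurve
      simpa using hp.hasFDerivAt
    have hδ : Tendsto (fun N : ℕ => Real.pi / 2 / ((N : ℝ) + 1)) atTop (𝓝[≠] 0) := by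
      refine tendsto_nhdsWithin_iff.2 ⟨?_, Eventually.of_forall fun N => ?_⟩
      · exact tendsto_const_nhds.div_atTop
          (tendsto_atTop_add_const_right _ 1 tendsto_natCast_atTop_atTop)
      · have : 0 < Real.pi / 2 / ((N : ℝ) + 1) := by positivity
        exact this.ne'
    have := (hφ.tendsto_slope.comp hδ).const_mul (Real.pi / 2)
    refine this.congr fun N => ?_
    simp only [Function.comp, slope, vsub_eq_sub, smul_eq_mul, sub_zero, Real.cos_zero,
      Real.sin_zero, one_smul, zero_smul, add_zero]
    field_simp
  have hbound : ∀ N : ℕ, ∀ᵐ p ∂μ, ‖((N + 1 : ℝ) *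
      (f (Real.cos (Real.pi / 2 / (N + 1)) • p.1 +
        Real.sin (Real.pi / 2 / (N + 1)) • p.2) - f p.1)) ^ 2‖ ≤
        (Real.pi / 2 * (‖p.1‖ + ‖p.2‖)) ^ 2 := by
    intro N
    refine Eventually.of_forall fun p => ?_
    have hN : (0 : ℝ) < N + 1 := by positivity
    rw [Real.norm_eq_abs, abs_of_nonneg (sq_nonneg _), sq_le_sq, abs_mul, abs_mul,
      abs_of_nonneg (by positivity : 0 ≤ Real.pi / 2), abs_of_pos hN,
      abs_of_nonneg (by positivity : 0 ≤ ‖p.1‖ + ‖p.2‖)]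
    have hδ2 : Real.pi / 2 / ((N : ℝ) + 1) ≤ 2 := by
      rw [div_le_iff₀ hN]
      nlinarith [Real.pi_le_four, (Nat.cast_nonneg N : (0 : ℝ) ≤ N)]
    have := mul_le_mul_of_nonneg_left (abs_sub_le_rotation hf (t := Real.pi / 2 / ((N : ℝ) + 1))
      (by positivity) p.1 p.2 hδ2) hN.le
    refine this.trans_eq ?_
    field_simp
  have hmeas : ∀ N : ℕ, AEStronglyMeasurable (fun p : E × E => ((N + 1 : ℝ) *
      (f (Real.cos (Real.pi / 2 / (N + 1)) • p.1 +
        Real.sin (Real.pi / 2 / (N + 1)) • p.2) - f p.1)) ^ 2) μ := fun N =>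
    Continuous.aestronglyMeasurable (by fun_prop)
  have hT := tendsto_integral_of_dominated_convergence _ hmeas (integrable_norm_sq_add (ι := ι))
    hbound hlim
  refine (ge_of_tendsto' hT (integral_sq_sub_le_rotation hf)).trans ?_
  have hnorm : ∀ x : E, ‖fderiv ℝ f x‖ ≤ 1 := fun x => by
    simpa using norm_fderiv_le_of_lipschitz ℝ hf (x₀ := x)
  have hint : Integrable (fun p : E × E => (Real.pi / 2 * fderiv ℝ f p.1 p.2) ^ 2) μ := by
    refine (integrable_norm_sq_add (ι := ι)).mono'
      (aestronglyMeasurable_of_tendsto_ae _ hmeas hlim) (Eventually.of_forall fun p => ?_)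
    rw [Real.norm_eq_abs, abs_of_nonneg (sq_nonneg _), sq_le_sq, abs_mul, abs_mul]
    refine mul_le_mul_of_nonneg_left ?_ (abs_nonneg _)
    rw [abs_of_nonneg (by positivity : 0 ≤ ‖p.1‖ + ‖p.2‖)]
    have h1 := (fderiv ℝ f p.1).le_opNorm p.2
    have h2 := mul_le_mul_of_nonneg_right (hnorm p.1) (norm_nonneg p.2)
    rw [Real.norm_eq_abs] at h1
    linarith [norm_nonneg p.1]
  -- For fixed `x` the derivative is a linear form in the independent vector `y`, with second moment
  -- `‖fderiv ℝ f x‖² ≤ 1`.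
  rw [hμ, integral_prod _ hint]
  simp_rw [mul_pow, integral_const_mul, integral_sq_strongDual_stdGaussian]
  refine mul_le_of_le_one_right (by positivity) ?_
  calc ∫ x, ‖fderiv ℝ f x‖ ^ 2 ∂(stdGaussian E) ≤ ∫ _x, (1 : ℝ) ∂(stdGaussian E) :=
        integral_mono_of_nonneg (Eventually.of_forall fun x => by positivity) (integrable_const _)
          (Eventually.of_forall fun x => pow_le_one₀ (norm_nonneg _) (hnorm x))
    _ = 1 := by simp

/-- Two sets at distance at least `D` cannot both have large Gaussian measure. -/
theorem stdGaussian_mul_le_of_dist {S T : Set E} {D : ℝ} (hD : 0 < D)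
    (h : ∀ x ∈ S, ∀ y ∈ T, D ≤ dist y x) :
    stdGaussian E S * stdGaussian E T ≤ ENNReal.ofReal ((Real.pi / 2) ^ 2 / D ^ 2) := by
  rcases S.eq_empty_or_nonempty with rfl | hS
  · simp
  set μ := (stdGaussian E).prod (stdGaussian E) with hμ
  -- The distance to `S` vanishes on `S` and is at least `D` on `T`; Markov's inequality is applied
  -- to its squared increment.
  set f : E → ℝ := fun x => Metric.infDist x S with hf
  have hlip : LipschitzWith 1 f := Metric.lipschitz_infDist_pt S
  have hfc := hlip.continuous
  have hi : Integrable (fun p : E × E => (f p.2 - f p.1) ^ 2) μ := by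
    have hf2 : MemLp f 2 (stdGaussian E) := by
      have h1 : MemLp (fun x : E => ‖x‖ + f 0) 2 (stdGaussian E) :=
        (IsGaussian.memLp_two_id (μ := stdGaussian E)).norm.add (memLp_const _)
      refine h1.mono hfc.aestronglyMeasurable (Eventually.of_forall fun x => ?_)
      have h2 := hlip.dist_le_mul x 0
      rw [Real.dist_eq, NNReal.coe_one, one_mul, dist_zero_right] at h2
      have h3 : 0 ≤ f x := Metric.infDist_nonneg
      have h4 : 0 ≤ f 0 := Metric.infDist_nonneg
      rw [Real.norm_eq_abs, Real.norm_eq_abs, abs_of_nonneg h3, abs_of_nonneg (by positivity)]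
      linarith [le_abs_self (f x - f 0)]
    exact ((hf2.comp_measurePreserving measurePreserving_snd).sub
      (hf2.comp_measurePreserving measurePreserving_fst)).integrable_sq
  have h1 := mul_meas_ge_le_integral_of_nonneg (μ := μ)
    (Eventually.of_forall fun p : E × E => sq_nonneg (f p.2 - f p.1)) hi (D ^ 2)
  have h2 : μ.real (S ×ˢ T) ≤ μ.real {p : E × E | D ^ 2 ≤ (f p.2 - f p.1) ^ 2} := by
    refine measureReal_mono ?_
    rintro ⟨x, y⟩ ⟨hx, hy⟩
    have hx0 : f x = 0 := Metric.infDist_zero_of_mem hx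
    have hy0 : D ≤ f y := (Metric.le_infDist hS).2 fun z hz => h z hz y hy
    simp only [Set.mem_ofPred_eq, hx0, sub_zero]
    gcongr
  have h3 := integral_sq_sub_le_of_lipschitz hlip
  rw [← Measure.prod_prod, ← ENNReal.ofReal_toReal (measure_ne_top _ (S ×ˢ T))]
  refine ENNReal.ofReal_le_ofReal ?_
  rw [le_div_iff₀ (by positivity), mul_comm]
  exact (mul_le_mul_of_nonneg_left h2 (by positivity)).trans (h1.trans h3)

end Poincare

/-! ### Separated sets, dilations and tail bounds for Gaussian vectors -/

section Tools

variable {m n : ℕ}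

/-- Two sets of pairs at distance at least `D` cannot both have large Gaussian measure. -/
theorem gaussPair_mul_le_of_dist {S T : Set ((Fin m → ℝ) × (Fin n → ℝ))} {D : ℝ} (hD : 0 < D)
    (h : ∀ p ∈ S, ∀ q ∈ T, D ^ 2 ≤ l2 (q.1 - p.1) ^ 2 + l2 (q.2 - p.2) ^ 2) :
    gaussPair m n S * gaussPair m n T ≤ ENNReal.ofReal ((Real.pi / 2) ^ 2 / D ^ 2) := by
  have h1 : MeasurePreserving (MeasurableEquiv.sumPiEquivProdPi fun _ : Fin m ⊕ Fin n => ℝ)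
      (Measure.pi fun _ => gaussianReal 0 1) (gaussPair m n) :=
    measurePreserving_sumPiEquivProdPi fun _ : Fin m ⊕ Fin n => gaussianReal 0 1
  have h2 : MeasurePreserving (MeasurableEquiv.toLp 2 (Fin m ⊕ Fin n → ℝ))
      (Measure.pi fun _ => gaussianReal 0 1) (stdGaussian (EuclideanSpace ℝ (Fin m ⊕ Fin n))) :=
    ⟨by fun_prop, map_pi_eq_stdGaussian⟩
  have h3 := (h2.symm _).trans h1
  rw [← h3.measure_preimage_equiv S, ← h3.measure_preimage_equiv T]
  refine stdGaussian_mul_le_of_dist hD fun x hx y hy => ?_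
  have := h _ hx _ hy
  rw [l2_sq, l2_sq] at this
  rw [EuclideanSpace.dist_eq]
  refine Real.le_sqrt_of_sq_le (this.trans_eq ?_)
  simp [dotProduct, Fintype.sum_sum_type, MeasurableEquiv.sumPiEquivProdPi,
    Equiv.sumPiEquivProdPi, Real.dist_eq, sq]

/-! ### Dilations of a Gaussian vector -/

/-- The density of `N(0, σ²)` with respect to `N(0, 1)`. -/
noncomputable def dilationDensity (σ x : ℝ) : ℝ :=
  σ⁻¹ * Real.exp (x ^ 2 / 2 - x ^ 2 / (2 * σ ^ 2))

lemma dilationDensity_nonneg {σ : ℝ} (hσ : 0 < σ) (x : ℝ) : 0 ≤ dilationDensity σ x := by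
  unfold dilationDensity; positivity

lemma measurable_dilationDensity (σ : ℝ) : Measurable (dilationDensity σ) := by
  unfold dilationDensity; fun_prop

lemma map_mul_gaussianReal_eq_withDensity {σ : ℝ} (hσ : 0 < σ) :
    (gaussianReal 0 1).map (σ * ·) =
      (gaussianReal 0 1).withDensity fun x => ENNReal.ofReal (dilationDensity σ x) := by
  have hσ2 : NNReal.mk (σ ^ 2) (sq_nonneg σ) * 1 ≠ 0 := by
    rw [mul_one, ← NNReal.coe_ne_zero]
    exact pow_ne_zero 2 hσ.ne'
  rw [gaussianReal_map_const_mul, gaussianReal_of_var_ne_zero _ hσ2,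
    gaussianReal_of_var_ne_zero _ one_ne_zero, ← withDensity_mul _ (measurable_gaussianPDF 0 1)
    (measurable_dilationDensity σ).ennreal_ofReal]
  congr with x
  rw [Pi.mul_apply, gaussianPDF, gaussianPDF, ← ENNReal.ofReal_mul (gaussianPDFReal_nonneg _ _ _)]
  congr 1
  rw [gaussianPDFReal, gaussianPDFReal, dilationDensity]
  simp only [mul_zero, sub_zero, NNReal.coe_mk, NNReal.coe_one, mul_one]
  rw [Real.sqrt_mul (by positivity), Real.sqrt_sq hσ.le, mul_inv]
  rw [show ∀ a b c d : ℝ, a * c * (b * d) = a * b * (c * d) from fun a b c d => by ring,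
    ← Real.exp_add]
  congr 2
  ring

lemma integrable_exp_neg_mul_sq_gaussianReal {b : ℝ} (hb : -(1 / 2) < b) :
    Integrable (fun x => Real.exp (-b * x ^ 2)) (gaussianReal 0 1) ∧
      ∫ x, Real.exp (-b * x ^ 2) ∂gaussianReal 0 1 = (√(1 + 2 * b))⁻¹ := by
  have e : ∀ x : ℝ, gaussianPDFReal 0 1 x * Real.exp (-b * x ^ 2) =
      (√(2 * Real.pi))⁻¹ * Real.exp (-(b + 1 / 2) * x ^ 2) := fun x => by
    rw [gaussianPDFReal, mul_assoc, ← Real.exp_add]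
    simp only [NNReal.coe_one, mul_one, sub_zero]
    congr 2
    ring
  constructor
  · rw [gaussianReal_of_var_ne_zero _ one_ne_zero, integrable_withDensity_iff_integrable_smul'
      (measurable_gaussianPDF 0 1) (Eventually.of_forall fun x => gaussianPDF_lt_top)]
    simp only [toReal_gaussianPDF, smul_eq_mul, e]
    exact (integrable_exp_neg_mul_sq (by linarith)).const_mul _
  · rw [integral_gaussianReal_eq_integral_smul one_ne_zero]
    simp only [smul_eq_mul, e]
    rw [integral_const_mul, integral_gaussian, ← Real.sqrt_inv, ← Real.sqrt_inv, ← Real.sqrt_mul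
      (by positivity)]
    congr 1
    have : 1 + 2 * b ≠ 0 := by linarith
    rw [show b + 1 / 2 = (1 + 2 * b) / 2 by ring]
    field_simp

/-- The excess over `1` is of second order in `σ - 1`. Hence with `σ - 1` of order `1/√n` the `n`-th
power of this moment stays bounded. -/
lemma integral_dilationDensity_sq {σ : ℝ} (hσ : 0 < σ) (hσ2 : σ ^ 2 < 2) :
    Integrable (fun x => dilationDensity σ x ^ 2) (gaussianReal 0 1) ∧
      ∫ x, dilationDensity σ x ^ 2 ∂gaussianReal 0 1 = (√(1 - (σ ^ 2 - 1) ^ 2))⁻¹ := by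
  have e : ∀ x, dilationDensity σ x ^ 2 = (σ ^ 2)⁻¹ * Real.exp (-((σ ^ 2)⁻¹ - 1) * x ^ 2) := by
    intro x
    rw [dilationDensity, mul_pow, ← Real.exp_nat_mul]
    congr 1
    · rw [inv_pow]
    · congr 1
      push_cast
      field_simp
      ring
  have hb : -(1 / 2) < (σ ^ 2)⁻¹ - 1 := by
    have : (2 : ℝ)⁻¹ < (σ ^ 2)⁻¹ := inv_strictAnti₀ (by positivity) hσ2
    linarith
  simp_rw [e]
  refine ⟨(integrable_exp_neg_mul_sq_gaussianReal hb).1.const_mul _, ?_⟩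
  rw [integral_const_mul, (integrable_exp_neg_mul_sq_gaussianReal hb).2, ← mul_inv]
  congr 1
  rw [← Real.sqrt_sq (by positivity : 0 ≤ σ ^ 2), ← Real.sqrt_mul (by positivity),
    Real.sqrt_sq (by positivity : 0 ≤ σ ^ 2)]
  congr 1
  field_simp
  ring

lemma integrable_dilationDensity {σ : ℝ} (hσ : 0 < σ) :
    Integrable (dilationDensity σ) (gaussianReal 0 1) := by
  have hb : -(1 / 2) < (2 * σ ^ 2)⁻¹ - 1 / 2 := by
    have : (0 : ℝ) < (2 * σ ^ 2)⁻¹ := by positivity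
    linarith
  refine ((integrable_exp_neg_mul_sq_gaussianReal hb).1.const_mul σ⁻¹).congr
    (Eventually.of_forall fun x => ?_)
  simp only [dilationDensity]
  congr 2
  field_simp
  ring

/-- Cauchy–Schwarz between the indicator of `T` and the density of the dilated law. A vanishing
probability thus still vanishes after dilation, given a bound on the second moment. -/
lemma gaussPair_dilation_le {σ : ℝ} (hσ : 0 < σ) (hσ2 : σ ^ 2 < 2)
    {T : Set ((Fin m → ℝ) × (Fin n → ℝ))} (hT : MeasurableSet T) :
    gaussPair m n {p | (p.1, σ • p.2) ∈ T} ≤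
      gaussPair m n T ^ (1 / 2 : ℝ) *
        ENNReal.ofReal ((√(1 - (σ ^ 2 - 1) ^ 2))⁻¹ ^ n) ^ (1 / 2 : ℝ) := by
  set W : (Fin n → ℝ) → ℝ := fun h => ∏ i, dilationDensity σ (h i) with hW
  have hWm : Measurable W := by
    have := measurable_dilationDensity σ
    fun_prop
  have hmap : (gaussVec n).map (fun h => σ • h) =
      (gaussVec n).withDensity fun h => ENNReal.ofReal (W h) := by
    have h1 := pi_withDensity (ι := Fin n) (gaussianReal 0 1) (dilationDensity_nonneg hσ)
      (integrable_dilationDensity hσ)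
    rw [gaussVec, ← h1, ← map_mul_gaussianReal_eq_withDensity hσ]
    exact Measure.pi_map_pi (f := fun _ : Fin n => (σ * ·))
      fun _ => (measurable_const_mul σ).aemeasurable
  have hpair : (gaussPair m n).map (fun p => (p.1, σ • p.2)) =
      (gaussPair m n).withDensity fun p => ENNReal.ofReal (W p.2) := by
    rw [gaussPair, ← prod_withDensity_right hWm.ennreal_ofReal, ← hmap]
    have := (Measure.map_prod_map (gaussVec m) (gaussVec n) measurable_id
      (measurable_const_smul σ : Measurable fun h : Fin n → ℝ => σ • h))
    rw [Measure.map_id] at this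
    rw [this]
    rfl
  have hm : Measurable fun p : (Fin m → ℝ) × (Fin n → ℝ) => (p.1, σ • p.2) := by fun_prop
  have e1 : gaussPair m n {p | (p.1, σ • p.2) ∈ T} =
      ∫⁻ p, T.indicator (1 : (Fin m → ℝ) × (Fin n → ℝ) → ENNReal) p * ENNReal.ofReal (W p.2) ∂gaussPair m n := by
    change gaussPair m n ((fun p => (p.1, σ • p.2)) ⁻¹' T) = _
    rw [← Measure.map_apply hm hT, hpair, withDensity_apply _ hT, ← lintegral_indicator hT]
    congr with p
    by_cases hp : p ∈ T <;> simp [hp]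
  rw [e1]
  refine (ENNReal.lintegral_mul_le_Lp_mul_Lq (gaussPair m n) Real.HolderConjugate.two_two
    (measurable_one.indicator hT).aemeasurable
    (hWm.comp measurable_snd).ennreal_ofReal.aemeasurable).trans_eq ?_
  congr 2
  · rw [← lintegral_indicator_one hT]
    congr with p
    by_cases hp : p ∈ T <;> simp [hp]
  · have hms : Measurable fun h : Fin n → ℝ => ENNReal.ofReal (W h) ^ (2 : ℝ) := by fun_prop
    rw [gaussPair]
    have e2 := (measurePreserving_snd (μ := gaussVec m) (ν := gaussVec n)).lintegral_comp hms
    refine e2.trans ?_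
    have e3 : ∀ h : Fin n → ℝ, ENNReal.ofReal (W h) ^ (2 : ℝ) =
        ENNReal.ofReal (∏ i, dilationDensity σ (h i) ^ 2) := fun h => by
      rw [ENNReal.ofReal_rpow_of_nonneg (Finset.prod_nonneg fun i _ => dilationDensity_nonneg hσ _)
        (by norm_num), Finset.prod_pow]
      norm_num [hW]
    simp_rw [e3]
    rw [← ofReal_integral_eq_lintegral_ofReal, gaussVec,
      integral_fintype_prod_eq_pow (fun x => dilationDensity σ x ^ 2),
      (integral_dilationDensity_sq hσ hσ2).2, Fintype.card_fin]
    · exact Integrable.fintype_prod fun i => (integral_dilationDensity_sq hσ hσ2).1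
    · exact Eventually.of_forall fun h => Finset.prod_nonneg fun i _ => sq_nonneg _

/-- Dilating `h` by `1 + D / √n` is absolutely continuous uniformly in the dimension. -/
lemma gaussPair_dilation_le_exp {D : ℝ} (hD : 0 ≤ D) (hn : 0 < n) (hDn : 18 * D ^ 2 ≤ n)
    {T : Set ((Fin m → ℝ) × (Fin n → ℝ))} (hT : MeasurableSet T) :
    gaussPair m n {p | (p.1, (1 + D / √(n : ℝ)) • p.2) ∈ T} ≤
      gaussPair m n T ^ (1 / 2 : ℝ) * ENNReal.ofReal (Real.exp (9 * D ^ 2)) ^ (1 / 2 : ℝ) := by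
  have hn' : (0 : ℝ) < n := by exact_mod_cast hn
  have hs : 0 < √(n : ℝ) := Real.sqrt_pos.2 hn'
  have hsq : √(n : ℝ) ^ 2 = n := Real.sq_sqrt hn'.le
  set β := D / √(n : ℝ) with hβ
  have hβ0 : 0 ≤ β := by positivity
  have hβ2 : β ^ 2 * n = D ^ 2 := by rw [hβ, div_pow, hsq]; field_simp
  have hβle : β ^ 2 ≤ 1 / 18 := by
    rw [hβ, div_pow, hsq, div_le_iff₀ hn']; linarith
  have hβ1 : β ≤ 1 / 4 := by nlinarith
  have he : ((1 + β) ^ 2 - 1) ^ 2 ≤ 9 * β ^ 2 := by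
    have h1 : (1 + β) ^ 2 - 1 = β * (2 + β) := by ring
    rw [h1, mul_pow, mul_comm 9]
    exact mul_le_mul_of_nonneg_left (by nlinarith) (sq_nonneg _)
  refine (gaussPair_dilation_le (by positivity) (by nlinarith) hT).trans ?_
  gcongr
  set t := ((1 + β) ^ 2 - 1) ^ 2 with ht
  have ht0 : 0 ≤ t := sq_nonneg _
  have ht1 : t ≤ 1 / 2 := by linarith
  -- The assumption `18 D² ≤ n` was made to give `t ≤ 1/2`, where `1 - t` is bounded below by this
  -- exponential.
  have h1 : Real.exp (-(2 * t)) ≤ 1 - t := by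
    rw [Real.exp_neg, inv_le_comm₀ (Real.exp_pos _) (by linarith)]
    refine le_trans ?_ (Real.add_one_le_exp (2 * t))
    rw [inv_le_iff_one_le_mul₀ (by linarith)]
    nlinarith
  have h2 : (√(1 - t))⁻¹ ≤ Real.exp t := by
    rw [inv_le_comm₀ (Real.sqrt_pos.2 (by linarith)) (Real.exp_pos _), ← Real.exp_neg]
    refine Real.le_sqrt_of_sq_le ?_
    rw [← Real.exp_nat_mul]
    convert h1 using 2
    push_cast; ring
  calc (√(1 - t))⁻¹ ^ n ≤ Real.exp t ^ n := by gcongr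
    _ = Real.exp (n * t) := by rw [← Real.exp_nat_mul]
    _ ≤ _ := by
      refine Real.exp_le_exp.2 ?_
      calc n * t ≤ n * (9 * β ^ 2) := mul_le_mul_of_nonneg_left he hn'.le
        _ = 9 * (β ^ 2 * n) := by ring
        _ = 9 * D ^ 2 := by rw [hβ2]

/-! ### The norm and the projections of a Gaussian vector -/

/-- Chernoff's bound with `exp(-‖h‖²)`, whose expectation is `3^(-1/2)` per coordinate. -/
lemma gaussVec_norm_small (n : ℕ) :
    gaussVec n {h | l2 h ^ 2 ≤ n / 4} ≤ ENNReal.ofReal ((Real.exp (1 / 4) / √3) ^ n) := by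
  have hb : -(1 / 2 : ℝ) < 1 := by norm_num
  obtain ⟨hi, hv⟩ := integrable_exp_neg_mul_sq_gaussianReal hb
  have hi' : Integrable (fun h : Fin n → ℝ => ∏ i, Real.exp (-1 * h i ^ 2)) (gaussVec n) :=
    Integrable.fintype_prod fun _ => hi
  have hv' : ∫ h, ∏ i, Real.exp (-1 * h i ^ 2) ∂gaussVec n = (√3)⁻¹ ^ n := by
    rw [gaussVec, integral_fintype_prod_eq_pow (fun x => Real.exp (-1 * x ^ 2)), hv,
      Fintype.card_fin]
    norm_num
  have h1 := mul_meas_ge_le_integral_of_nonneg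
    (Eventually.of_forall fun h => Finset.prod_nonneg fun i _ => (Real.exp_pos _).le) hi'
    (Real.exp (-(n / 4)))
  rw [hv'] at h1
  have hsub : {h : Fin n → ℝ | l2 h ^ 2 ≤ n / 4} ⊆
      {h | Real.exp (-(n / 4)) ≤ ∏ i, Real.exp (-1 * h i ^ 2)} := by
    intro h hh
    simp only [Set.mem_ofPred_eq, ← Real.exp_sum, Real.exp_le_exp] at hh ⊢
    rw [l2_sq, dotProduct] at hh
    rw [← Finset.mul_sum]
    have : ∑ i, h i ^ 2 = ∑ i, h i * h i := Finset.sum_congr rfl fun i _ => sq _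
    linarith
  refine (measure_mono hsub).trans ?_
  rw [← ENNReal.ofReal_toReal (measure_ne_top (gaussVec n) _)]
  refine ENNReal.ofReal_le_ofReal ?_
  rw [measureReal_def] at h1
  have h2 := (le_div_iff₀' (Real.exp_pos (-(n / 4 : ℝ)))).2 h1
  refine h2.trans_eq ?_
  rw [Real.exp_neg, div_inv_eq_mul, mul_comm, div_pow, ← Real.exp_nat_mul, inv_pow, div_eq_mul_inv]
  congr 2
  ring

lemma tendsto_gaussVec_norm_small :
    Tendsto (fun n : ℕ => gaussVec n {h | l2 h ^ 2 ≤ n / 4}) atTop (𝓝 0) := by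
  have h3 : (0 : ℝ) < √3 := by positivity
  have hlt : Real.exp (1 / 4) / √3 < 1 := by
    rw [div_lt_one h3]
    refine Real.lt_sqrt_of_sq_lt ?_
    rw [← Real.exp_nat_mul]
    have h1 : Real.exp ((2 : ℕ) * (1 / 4)) ≤ Real.exp 1 := Real.exp_le_exp.2 (by norm_num)
    linarith [Real.exp_one_lt_d9]
  have h1 := tendsto_pow_atTop_nhds_zero_of_lt_one (by positivity) hlt
  have h2 := ENNReal.tendsto_ofReal h1
  rw [ENNReal.ofReal_zero] at h2
  exact tendsto_of_tendsto_of_tendsto_of_le_of_le tendsto_const_nhds h2 (fun _ => zero_le)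
    gaussVec_norm_small

/-- Chebyshev: a projection on a unit vector has variance one in every dimension. -/
lemma gaussVec_proj_large {u : Fin n → ℝ} (hu : l2 u = 1) {K : ℝ} (hK : 0 < K) :
    gaussVec n {h | K ≤ |h ⬝ᵥ u|} ≤ ENNReal.ofReal (1 / K ^ 2) := by
  have h2 : MeasurePreserving (MeasurableEquiv.toLp 2 (Fin n → ℝ))
      (gaussVec n) (stdGaussian (EuclideanSpace ℝ (Fin n))) :=
    ⟨by fun_prop, map_pi_eq_stdGaussian⟩
  set L : StrongDual ℝ (EuclideanSpace ℝ (Fin n)) := innerSL ℝ (WithLp.toLp 2 u) with hL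
  have hLn : ‖L‖ = 1 := by rw [hL, innerSL_apply_norm]; exact hu
  have hv := integral_sq_strongDual_stdGaussian L
  rw [hLn] at hv
  have hi : Integrable (fun x => L x ^ 2) (stdGaussian (EuclideanSpace ℝ (Fin n))) :=
    (IsGaussian.memLp_dual _ L 2 (by norm_num)).integrable_sq
  have h1 := mul_meas_ge_le_integral_of_nonneg
    (Eventually.of_forall fun x => sq_nonneg (L x)) hi (K ^ 2)
  rw [hv] at h1
  have hsub : {h : Fin n → ℝ | K ≤ |h ⬝ᵥ u|} ⊆
      (MeasurableEquiv.toLp 2 (Fin n → ℝ)) ⁻¹' {x | K ^ 2 ≤ L x ^ 2} := by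
    intro h hh
    have e : L (WithLp.toLp 2 h) = h ⬝ᵥ u := by
      rw [hL, innerSL_apply_apply, EuclideanSpace.inner_toLp_toLp]
      simp [dotProduct_comm]
    change K ^ 2 ≤ L (WithLp.toLp 2 h) ^ 2
    rw [e, ← sq_abs (h ⬝ᵥ u)]
    have : K ≤ |h ⬝ᵥ u| := hh
    gcongr
  refine (measure_mono hsub).trans ?_
  rw [h2.measure_preimage_equiv, ← ENNReal.ofReal_toReal (measure_ne_top (stdGaussian _) _)]
  refine ENNReal.ofReal_le_ofReal ?_
  rw [le_div_iff₀ (by positivity), mul_comm]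
  simpa [measureReal_def] using h1

end Tools

/-! ### The random dual in the variables `y` and `r` -/

section DualGeometry

variable {m n : ℕ}

/-- The norm of the component of `h` orthogonal to the unit vector `u`. -/
noncomputable def perpNorm (u h : Fin n → ℝ) : ℝ := l2 (h - (h ⬝ᵥ u) • u)

/-- `(y, r)` is attained as `(-uᵀx, ‖x‖)` by a feasible point `x` of the random dual. -/
def IsDualPoint (a : Fin m → ℝ) (u : Fin n → ℝ) (g : Fin m → ℝ) (h : Fin n → ℝ) (y r : ℝ) : Prop :=
  |y| ≤ r ∧ ∀ l : Fin m → ℝ, 0 ≤ l →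
    r * (l ⬝ᵥ g) - l ⬝ᵥ a ≤ l2 l * ((h ⬝ᵥ u) * y + perpNorm u h * √(r ^ 2 - y ^ 2))

lemma perpNorm_sq {u : Fin n → ℝ} (hu : l2 u = 1) (h : Fin n → ℝ) :
    perpNorm u h ^ 2 = l2 h ^ 2 - (h ⬝ᵥ u) ^ 2 := by
  have hu' : u ⬝ᵥ u = 1 := by rw [← l2_sq, hu]; norm_num
  rw [perpNorm, l2_sq, l2_sq]
  simp only [sub_dotProduct, dotProduct_sub, smul_dotProduct, dotProduct_smul, smul_eq_mul, hu',
    dotProduct_comm u h]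
  ring

lemma perpNorm_nonneg (u h : Fin n → ℝ) : 0 ≤ perpNorm u h := l2_nonneg _

lemma abs_perpNorm_sub_le {u : Fin n → ℝ} (hu : l2 u = 1) (h h' : Fin n → ℝ) :
    |perpNorm u h - perpNorm u h'| ≤ l2 (h - h') := by
  have h1 := l2_sub_le (h - (h ⬝ᵥ u) • u) (h' - (h' ⬝ᵥ u) • u)
  have e : h - (h ⬝ᵥ u) • u - (h' - (h' ⬝ᵥ u) • u) = (h - h') - ((h - h') ⬝ᵥ u) • u := by
    rw [sub_dotProduct, sub_smul]; abel
  rw [e] at h1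
  refine h1.trans ?_
  change perpNorm u (h - h') ≤ _
  refine abs_le_of_sq_le_sq' ?_ (l2_nonneg _) |>.2
  rw [perpNorm_sq hu]
  linarith [sq_nonneg ((h - h') ⬝ᵥ u)]

lemma perpNorm_smul (u h : Fin n → ℝ) {t : ℝ} (ht : 0 ≤ t) :
    perpNorm u (t • h) = t * perpNorm u h := by
  rw [perpNorm, perpNorm, smul_dotProduct, smul_eq_mul, mul_smul, ← smul_sub, l2_smul,
    abs_of_nonneg ht]

/-- If the dual value is less than `s`, then some point is feasible with objective below `s`. -/
lemma exists_feasible_of_frd_lt {c : Fin n → ℝ} {a : Fin m → ℝ}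
    {gh : (Fin m → ℝ) × (Fin n → ℝ)} {s : ℝ} (hn : 0 < n) (h : frd c a gh < s) :
    ∃ x : Fin n → ℝ, (1 / √(n : ℝ)) * (c ⬝ᵥ x) < s ∧ ∀ l : Fin m → ℝ, 0 ≤ l →
      l2 x * (l ⬝ᵥ gh.1) + l2 l * (gh.2 ⬝ᵥ x) - l ⬝ᵥ a ≤ 0 := by
  obtain ⟨x, hx⟩ := iInf_lt_iff.1 h
  have hx' : ∀ l : Fin m → ℝ, 0 ≤ l → (1 / √(n : ℝ)) *
      (c ⬝ᵥ x + l2 x * (l ⬝ᵥ gh.1) + l2 l * (gh.2 ⬝ᵥ x) - l ⬝ᵥ a) < s := fun l hl =>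
    EReal.coe_lt_coe_iff.1 ((le_iSup (fun l : {l : Fin m → ℝ // 0 ≤ l} =>
      (((1 / √(n : ℝ)) * (c ⬝ᵥ x + l2 x * (l.1 ⬝ᵥ gh.1) + l2 l.1 * (gh.2 ⬝ᵥ x) - l.1 ⬝ᵥ a) : ℝ) :
        EReal)) ⟨l, hl⟩).trans_lt hx)
  refine ⟨x, by simpa [l2_zero] using hx' 0 le_rfl, fun l hl => ?_⟩
  by_contra! hpos
  set w := l2 x * (l ⬝ᵥ gh.1) + l2 l * (gh.2 ⬝ᵥ x) - l ⬝ᵥ a with hw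
  set t := |s * √n - c ⬝ᵥ x| / w with ht
  have ht0 : 0 ≤ t := by positivity
  have h1 := hx' (t • l) (smul_nonneg ht0 hl)
  have e : c ⬝ᵥ x + l2 x * ((t • l) ⬝ᵥ gh.1) + l2 (t • l) * (gh.2 ⬝ᵥ x) - (t • l) ⬝ᵥ a =
      c ⬝ᵥ x + t * w := by
    rw [smul_dotProduct, smul_dotProduct, l2_smul, abs_of_nonneg ht0, hw, smul_eq_mul, smul_eq_mul]
    ring
  rw [e, ht, div_mul_cancel₀ _ hpos.ne', one_div, inv_mul_lt_iff₀ (by positivity)] at h1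
  linarith [le_abs_self (s * √n - c ⬝ᵥ x)]

variable {c : Fin n → ℝ} {a : Fin m → ℝ} {u : Fin n → ℝ} {g : Fin m → ℝ} {h : Fin n → ℝ}

/-- Splitting `hᵀx` along `u` and its orthogonal complement, the orthogonal part is at least
`-perpNorm u h * √(r² - y²)` by Cauchy–Schwarz. -/
lemma exists_isDualPoint_of_frd_lt (hn : 0 < n) (hu : l2 u = 1) (hcu : u = (1 / √(n : ℝ)) • c)
    {s : ℝ} (hs : frd c a (g, h) < s) : ∃ y r, -s < y ∧ IsDualPoint a u g h y r := by
  obtain ⟨x, hxs, hx⟩ := exists_feasible_of_frd_lt hn hs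
  have hux : (1 / √(n : ℝ)) * (c ⬝ᵥ x) = u ⬝ᵥ x := by rw [hcu, smul_dotProduct, smul_eq_mul]
  have hu' : u ⬝ᵥ u = 1 := by rw [← l2_sq, hu]; norm_num
  rw [hux] at hxs
  refine ⟨-(u ⬝ᵥ x), l2 x, by linarith, ?_, fun l hl => ?_⟩
  · rw [abs_neg]
    simpa [hu] using abs_dotProduct_le_l2 u x
  · have h1 := hx l hl
    have hperp : √(l2 x ^ 2 - (-(u ⬝ᵥ x)) ^ 2) = l2 (x - (x ⬝ᵥ u) • u) := by
      rw [neg_sq, dotProduct_comm u x, ← perpNorm_sq hu x, Real.sqrt_sq (perpNorm_nonneg _ _),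
        perpNorm]
    have h2 := abs_dotProduct_le_l2 (h - (h ⬝ᵥ u) • u) (x - (x ⬝ᵥ u) • u)
    have e : (h - (h ⬝ᵥ u) • u) ⬝ᵥ (x - (x ⬝ᵥ u) • u) = h ⬝ᵥ x - (h ⬝ᵥ u) * (u ⬝ᵥ x) := by
      simp only [sub_dotProduct, dotProduct_sub, smul_dotProduct, dotProduct_smul, smul_eq_mul, hu',
        dotProduct_comm x u]
      ring
    rw [e] at h2
    rw [hperp, perpNorm]
    have h3 := neg_abs_le (h ⬝ᵥ x - (h ⬝ᵥ u) * (u ⬝ᵥ x))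
    have h4 := mul_le_mul_of_nonneg_left (show -(h ⬝ᵥ x) ≤ (h ⬝ᵥ u) * -(u ⬝ᵥ x) +
      l2 (h - (h ⬝ᵥ u) • u) * l2 (x - (x ⬝ᵥ u) • u) by linarith) (l2_nonneg l)
    simp only at h1
    linarith

/-- Converse of the reduction: the equality case of Cauchy–Schwarz is attained by pointing the
orthogonal part of `x` against that of `h`, which has to be nonzero. -/
lemma frd_le_of_isDualPoint (hu : l2 u = 1) (hcu : u = (1 / √(n : ℝ)) • c)
    (hχ : 0 < perpNorm u h) {y r : ℝ} (hp : IsDualPoint a u g h y r) :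
    frd c a (g, h) ≤ (-y : ℝ) := by
  have hu' : u ⬝ᵥ u = 1 := by rw [← l2_sq, hu]; norm_num
  obtain ⟨hyr, hl⟩ := hp
  have hr : 0 ≤ r := (abs_nonneg y).trans hyr
  have hyr2 : 0 ≤ r ^ 2 - y ^ 2 := sub_nonneg.2 (sq_le_sq' (by linarith [neg_abs_le y])
    (by linarith [le_abs_self y]))
  set z := √(r ^ 2 - y ^ 2) with hz
  set v := h - (h ⬝ᵥ u) • u with hv
  have hvu : v ⬝ᵥ u = 0 := by
    rw [hv, sub_dotProduct, smul_dotProduct, hu', smul_eq_mul, mul_one, sub_self]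
  have hvv : v ⬝ᵥ v = perpNorm u h ^ 2 := by rw [perpNorm, l2_sq]
  have hhv : h ⬝ᵥ v = perpNorm u h ^ 2 := by
    rw [perpNorm_sq hu, l2_sq, hv, dotProduct_sub, dotProduct_smul, smul_eq_mul, sq]
  set χ := perpNorm u h with hχ'
  set x := (-y) • u - (z / χ) • v with hx
  have hux : u ⬝ᵥ x = -y := by
    rw [hx, dotProduct_sub, dotProduct_smul, dotProduct_smul, hu', dotProduct_comm u v, hvu]
    simp
  have hhx : h ⬝ᵥ x = -((h ⬝ᵥ u) * y + χ * z) := by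
    rw [hx, dotProduct_sub, dotProduct_smul, dotProduct_smul, hhv, smul_eq_mul, smul_eq_mul]
    field_simp
    ring
  have hxr : l2 x = r := by
    have h1 : l2 x ^ 2 = r ^ 2 := by
      rw [l2_sq, hx]
      simp only [sub_dotProduct, dotProduct_sub, smul_dotProduct, dotProduct_smul, smul_eq_mul, hu',
        dotProduct_comm u v, hvu, hvv]
      have hz2 : z ^ 2 = r ^ 2 - y ^ 2 := Real.sq_sqrt hyr2
      rw [show r ^ 2 = y ^ 2 + z ^ 2 by rw [hz2]; ring]
      clear_value z
      field_simp
      ring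
    exact (sq_eq_sq₀ (l2_nonneg _) hr).1 h1
  refine (iInf_le _ x).trans (iSup_le fun l => EReal.coe_le_coe_iff.2 ?_)
  have h2 := hl l.1 l.2
  have h3 : (1 / √(n : ℝ)) * (c ⬝ᵥ x) = -y := by
    rw [← hux, hcu, smul_dotProduct, smul_eq_mul]
  rw [← h3]
  refine mul_le_mul_of_nonneg_left ?_ (by positivity)
  simp only [hxr, hhx]
  linarith

/-! ### Perturbations of feasible points -/

/-- With `s` the root, `(r - s)(r + s) = y²` and `r ≤ r + s ≤ 2r`. -/
lemma sub_sqrt_bounds {r y : ℝ} (hy : |y| ≤ r) (hr : 0 < r) :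
    y ^ 2 / (2 * r) ≤ r - √(r ^ 2 - y ^ 2) ∧ r - √(r ^ 2 - y ^ 2) ≤ y ^ 2 / r := by
  have hyr : y ^ 2 ≤ r ^ 2 := sq_le_sq' (by linarith [neg_abs_le y]) (by linarith [le_abs_self y])
  have hs := Real.sq_sqrt (sub_nonneg.2 hyr)
  have hs0 := Real.sqrt_nonneg (r ^ 2 - y ^ 2)
  set s := √(r ^ 2 - y ^ 2)
  have hsr : s ≤ r := by nlinarith [sq_nonneg y]
  constructor
  · rw [div_le_iff₀ (by positivity)]; nlinarith
  · rw [le_div_iff₀ hr]; nlinarith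

/-- Dilating `h` makes a point with large norm attain every bounded objective value. -/
lemma IsDualPoint.dilate {y r B D K ε : ℝ} (hp : IsDualPoint a u g h y r) (hn : 0 < n)
    (hB : 0 ≤ B) (hK : 0 ≤ K) (hD : 0 ≤ D)
    (hy : |y| ≤ B) (hr : ε * √(n : ℝ) < r ^ 2) (hDε : 4 * (B + 1) ^ 2 ≤ D * ε)
    (hDn : D ≤ √(n : ℝ)) (hη : |h ⬝ᵥ u| ≤ K) (hχ : √(n : ℝ) / 4 ≤ perpNorm u h)
    (hrB : B + 1 ≤ r) (hDr : 24 * K * (B + 1) ≤ D * r) :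
    IsDualPoint a u g ((1 + D / √(n : ℝ)) • h) (B + 1) r := by
  obtain ⟨hyr, hl⟩ := hp
  have hr0 : 0 < r := by linarith
  have hs : 0 < √(n : ℝ) := by positivity
  set β := D / √(n : ℝ) with hβ
  have hβ0 : 0 ≤ β := by positivity
  have hβ1 : β ≤ 1 := (div_le_one hs).2 hDn
  have hyB : |B + 1| ≤ r := by rwa [abs_of_nonneg (by linarith)]
  refine ⟨hyB, fun l hl0 => (hl l hl0).trans (mul_le_mul_of_nonneg_left ?_ (l2_nonneg l))⟩
  rw [perpNorm_smul _ _ (by linarith), smul_dotProduct, smul_eq_mul]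
  have h1 := (sub_sqrt_bounds hyB hr0).2
  have h2 : √(r ^ 2 - y ^ 2) ≤ r := 
    Real.sqrt_le_iff.2 ⟨hr0.le, by linarith [sq_nonneg y]⟩
  set χ := perpNorm u h
  have hχ0 : 0 < χ := by linarith [show 0 < √(n : ℝ) / 4 by positivity]
  -- Raising `y` to `B + 1` lowers the root by at most `(B + 1)²/r ≤ βr/4`, whereas the factor `1 +
  -- β` adds about `βr`. The net gain kept in `h7` is `χβr/2`.
  have h3 : 4 * (B + 1) ^ 2 ≤ β * r ^ 2 := by
    have : D * ε ≤ β * r ^ 2 := by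
      rw [hβ, div_mul_eq_mul_div, le_div_iff₀ hs]
      nlinarith [mul_le_mul_of_nonneg_left hr.le hD]
    linarith
  have h4 : (B + 1) ^ 2 / r ≤ β * r / 4 := by
    rw [div_le_iff₀ hr0]; nlinarith
  have h5 : D * r / 4 ≤ χ * (β * r) := by
    have : √(n : ℝ) / 4 * (β * r) = D * r / 4 := by rw [hβ]; field_simp
    rw [← this]
    exact mul_le_mul_of_nonneg_right hχ (by positivity)
  have h6 : χ * √(r ^ 2 - y ^ 2) ≤ χ * r := mul_le_mul_of_nonneg_left h2 hχ0.le
  have h7 : χ * (r + β * r / 2) ≤ (1 + β) * χ * √(r ^ 2 - (B + 1) ^ 2) := by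
    rw [mul_comm (1 + β), mul_assoc]
    refine mul_le_mul_of_nonneg_left ?_ hχ0.le
    have : (1 + β) * (r - β * r / 4) ≤ (1 + β) * √(r ^ 2 - (B + 1) ^ 2) :=
      mul_le_mul_of_nonneg_left (by linarith) (by linarith)
    nlinarith [mul_nonneg hβ0 hr0.le, mul_nonneg (mul_nonneg hβ0 hr0.le) (sub_nonneg.2 hβ1)]
  have h8 : (h ⬝ᵥ u) * y ≤ K * B := by
    refine (le_abs_self _).trans ?_
    rw [abs_mul]
    exact mul_le_mul hη hy (abs_nonneg _) hK
  have h9 : -(2 * K * (B + 1)) ≤ (1 + β) * (h ⬝ᵥ u) * (B + 1) := by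
    have h10 : |(1 + β) * (h ⬝ᵥ u)| ≤ 2 * K := by
      rw [abs_mul, abs_of_nonneg (by linarith : 0 ≤ 1 + β)]
      exact mul_le_mul (by linarith) hη (abs_nonneg _) (by norm_num)
    have := mul_le_mul_of_nonneg_right (abs_le.1 h10).1 (by linarith : 0 ≤ B + 1)
    linarith
  -- The gain `χβr/2 ≥ Dr/8 ≥ 3K(B + 1)` pays for the terms in `h ⬝ᵥ u`, at most `KB + 2K(B + 1)`.
  nlinarith

/-- A point with negative `y` and moderate norm can be moved to `y = 0`. -/
lemma IsDualPoint.zero_of_neg {y r K : ℝ} (hp : IsDualPoint a u g h y r) (hy : y ≠ 0)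
    (hη : |h ⬝ᵥ u| ≤ K) (hr : 2 * K * r ≤ perpNorm u h * |y|) :
    IsDualPoint a u g h 0 r := by
  obtain ⟨hyr, hl⟩ := hp
  have hy0 : 0 < |y| := abs_pos.2 hy
  have hr0 : 0 < r := hy0.trans_le hyr
  refine ⟨by simpa using hr0.le, fun l hl0 =>
    (hl l hl0).trans (mul_le_mul_of_nonneg_left ?_ (l2_nonneg l))⟩
  have h1 := (sub_sqrt_bounds hyr hr0).1
  have e : √(r ^ 2 - 0 ^ 2) = r := by rw [zero_pow two_ne_zero, sub_zero, Real.sqrt_sq hr0.le]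
  rw [e, mul_zero, zero_add]
  have h2 : (h ⬝ᵥ u) * y ≤ K * |y| := by
    refine (le_abs_self _).trans ?_
    rw [abs_mul]
    exact mul_le_mul_of_nonneg_right hη hy0.le
  -- Setting `y = 0` raises the root by at least `y²/(2r)`; times `perpNorm u h` this covers the
  -- loss of `(h ⬝ᵥ u) * y`.
  have h3 : K * |y| ≤ perpNorm u h * (y ^ 2 / (2 * r)) := by
    rw [← sq_abs y, mul_div_assoc', le_div_iff₀ (by positivity)]
    nlinarith
  have h4 := mul_le_mul_of_nonneg_left h1 (perpNorm_nonneg u h)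
  linarith

/-- A point with moderate norm stays feasible under bounded perturbations of `(g, h)` after
decreasing `y`. -/
lemma IsDualPoint.perturb {g' : Fin m → ℝ} {h' : Fin n → ℝ} {y r y₁ T D K : ℝ}
    (hp : IsDualPoint a u g h y r) (hu : l2 u = 1)
    (hy₁ : 0 ≤ y₁) (hT : y₁ < T) (hy : T < y) (hg : l2 (g' - g) ≤ D) (hh : l2 (h' - h) ≤ D)
    (hη : |h' ⬝ᵥ u| ≤ K) (hr : 2 * (3 * D + K) * r ^ 2 ≤ perpNorm u h' * (T ^ 2 - y₁ ^ 2)) :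
    IsDualPoint a u g' h' y₁ r := by
  obtain ⟨hyr, hl⟩ := hp
  have hy0 : 0 < y := by linarith
  rw [abs_of_pos hy0] at hyr
  have hr0 : 0 < r := by linarith
  have hy₁r : |y₁| ≤ r := by rw [abs_of_nonneg hy₁]; linarith
  have hyr' : y ^ 2 ≤ r ^ 2 := by nlinarith
  have hy₁r' : y₁ ^ 2 ≤ r ^ 2 := by nlinarith
  refine ⟨hy₁r, fun l hl0 => ?_⟩
  have hD : 0 ≤ D := (l2_nonneg _).trans hg
  have h1 : r * (l ⬝ᵥ g') - l ⬝ᵥ a ≤ (r * (l ⬝ᵥ g) - l ⬝ᵥ a) + l2 l * (r * D) := by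
    have h2 := dotProduct_le_l2 l (g' - g)
    rw [dotProduct_sub] at h2
    have h3 := mul_le_mul_of_nonneg_left hg (l2_nonneg l)
    nlinarith
  refine h1.trans ((add_le_add_left (hl l hl0) _).trans ?_)
  rw [← mul_add]
  refine mul_le_mul_of_nonneg_left ?_ (l2_nonneg l)
  set z := √(r ^ 2 - y ^ 2) with hz
  set z₁ := √(r ^ 2 - y₁ ^ 2) with hz₁
  have hz2 : z ^ 2 = r ^ 2 - y ^ 2 := Real.sq_sqrt (by linarith)
  have hz₁2 : z₁ ^ 2 = r ^ 2 - y₁ ^ 2 := Real.sq_sqrt (by linarith)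
  have hz0 : 0 ≤ z := Real.sqrt_nonneg _
  have hz₁0 : 0 ≤ z₁ := Real.sqrt_nonneg _
  have hzr : z ≤ r := by nlinarith
  have hz₁r : z₁ ≤ r := by nlinarith
  have hzz : z ≤ z₁ := Real.sqrt_le_sqrt (by nlinarith)
  -- The costs per unit of `‖l‖` are `Dr` each for the changes of `g`, `h ⬝ᵥ u` and `perpNorm`, and
  -- `Kr` for lowering `y`: together `(3D + K)r`.
  have e1 : (h ⬝ᵥ u) * y ≤ (h' ⬝ᵥ u) * y + D * r := by
    have h2 := abs_dotProduct_le_l2 (h' - h) u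
    rw [hu, mul_one, sub_dotProduct] at h2
    have h3 := (abs_le.1 (h2.trans hh)).1
    nlinarith [mul_le_mul_of_nonneg_left hyr hD]
  have e2 : perpNorm u h * z ≤ perpNorm u h' * z + D * r := by
    have h2 := (abs_le.1 ((abs_perpNorm_sub_le hu h' h).trans hh)).1
    nlinarith [mul_le_mul_of_nonneg_left hzr hD]
  have e3 : (h' ⬝ᵥ u) * y ≤ (h' ⬝ᵥ u) * y₁ + K * r := by
    have h2 : (h' ⬝ᵥ u) * (y - y₁) ≤ K * (y - y₁) :=
      mul_le_mul_of_nonneg_right ((le_abs_self _).trans hη) (by linarith)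
    have h3 : K * (y - y₁) ≤ K * r :=
      mul_le_mul_of_nonneg_left (by linarith) ((abs_nonneg _).trans hη)
    linarith
  -- The gain: `z₁² - z² = y² - y₁² ≥ T² - y₁²` and `z₁ + z ≤ 2r`.
  have e4 : (T ^ 2 - y₁ ^ 2) / (2 * r) ≤ z₁ - z := by
    rw [div_le_iff₀ (by positivity)]
    have h2 : T ^ 2 ≤ y ^ 2 := pow_le_pow_left₀ (by linarith) hy.le 2
    have h3 : (z₁ - z) * (z₁ + z) ≤ (z₁ - z) * (2 * r) :=
      mul_le_mul_of_nonneg_left (by linarith) (by linarith)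
    have h4 : (z₁ - z) * (z₁ + z) = z₁ ^ 2 - z ^ 2 := by ring
    linarith
  have e5 : (3 * D + K) * r ≤ perpNorm u h' * ((T ^ 2 - y₁ ^ 2) / (2 * r)) := by
    rw [mul_div_assoc', le_div_iff₀ (by positivity)]
    linarith [show (3 * D + K) * r * (2 * r) = 2 * (3 * D + K) * r ^ 2 by ring]
  have e6 := mul_le_mul_of_nonneg_left e4 (perpNorm_nonneg u h')
  linarith

end DualGeometry

/-! ### Asymptotics of the random dual -/

lemma measureReal_preimage_snd {α β : Type*} [MeasurableSpace α] [MeasurableSpace β]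
    (μ : Measure α) (ν : Measure β) [IsProbabilityMeasure μ] [IsProbabilityMeasure ν] (s : Set β) :
    (μ.prod ν).real {p | p.2 ∈ s} = ν.real s := by
  have : {p : α × β | p.2 ∈ s} = Set.univ ×ˢ s := by ext; simp
  rw [this, measureReal_prod_prod]
  simp

lemma gaussPair_real_proj_large {m n : ℕ} {u : Fin n → ℝ} (hu : l2 u = 1) {K : ℝ} (hK : 0 < K) :
    (gaussPair m n).real {p | K ≤ |p.2 ⬝ᵥ u|} ≤ 1 / K ^ 2 := by
  have h := measureReal_preimage_snd (gaussVec m) (gaussVec n) {h | K ≤ |h ⬝ᵥ u|}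
  simp only [Set.mem_ofPred_eq] at h
  rw [gaussPair, h, measureReal_def]
  exact ENNReal.toReal_le_of_le_ofReal (by positivity) (gaussVec_proj_large hu hK)

lemma tendsto_gaussPair_real_norm_small (m : ℕ → ℕ) :
    Tendsto (fun n : ℕ => (gaussPair (m n) n).real {p | l2 p.2 ^ 2 ≤ n / 4}) atTop (𝓝 0) := by
  have h : ∀ n : ℕ, (gaussPair (m n) n).real {p | l2 p.2 ^ 2 ≤ n / 4} =
      (gaussVec n {h | l2 h ^ 2 ≤ n / 4}).toReal := fun n => by
    have h := measureReal_preimage_snd (gaussVec (m n)) (gaussVec n) {h | l2 h ^ 2 ≤ n / 4}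
    simp only [Set.mem_ofPred_eq] at h
    rw [gaussPair, h, measureReal_def]
  simp_rw [h]
  exact (ENNReal.tendsto_toReal_zero_iff fun n => measure_ne_top _ _).2 tendsto_gaussVec_norm_small

lemma tendsto_gaussPair_real_dilation (m : ℕ → ℕ) {D : ℝ} (hD : 0 ≤ D)
    {T : (n : ℕ) → Set ((Fin (m n) → ℝ) × (Fin n → ℝ))} (hT : ∀ n, MeasurableSet (T n))
    (h0 : Tendsto (fun n => (gaussPair (m n) n).real (T n)) atTop (𝓝 0)) :
    Tendsto (fun n : ℕ => (gaussPair (m n) n).real {p | (p.1, (1 + D / √(n : ℝ)) • p.2) ∈ T n})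
      atTop (𝓝 0) := by
  have h1 : Tendsto (fun n => gaussPair (m n) n (T n)) atTop (𝓝 0) :=
    (ENNReal.tendsto_toReal_zero_iff fun n => measure_ne_top _ _).1 h0
  have h2 : Tendsto (fun n => gaussPair (m n) n (T n) ^ (1 / 2 : ℝ) *
      ENNReal.ofReal (Real.exp (9 * D ^ 2)) ^ (1 / 2 : ℝ)) atTop (𝓝 0) := by
    have h3 := ((ENNReal.continuous_rpow_const (y := (1 / 2 : ℝ))).tendsto 0).comp h1
    rw [ENNReal.zero_rpow_of_pos (by norm_num)] at h3
    have h4 := ENNReal.Tendsto.mul_const h3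
      (Or.inr (ENNReal.rpow_ne_top_of_nonneg (by norm_num : (0 : ℝ) ≤ 1 / 2)
        (ENNReal.ofReal_ne_top (r := Real.exp (9 * D ^ 2)))))
    rw [zero_mul] at h4
    exact h4
  refine (ENNReal.tendsto_toReal_zero_iff fun n => measure_ne_top _ _).2 ?_
  refine tendsto_of_tendsto_of_tendsto_of_le_of_le' tendsto_const_nhds h2
    (Eventually.of_forall fun n => zero_le) ?_
  filter_upwards [eventually_gt_atTop 0,
    tendsto_natCast_atTop_atTop.eventually_ge_atTop (18 * D ^ 2)] with n hn hDn
  exact gaussPair_dilation_le_exp hD hn hDn (hT n)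

lemma gaussPair_real_mul_le_of_dist {m n : ℕ} {S T : Set ((Fin m → ℝ) × (Fin n → ℝ))} {D : ℝ}
    (hD : 0 < D) (h : ∀ p ∈ S, ∀ q ∈ T, D ^ 2 ≤ l2 (q.1 - p.1) ^ 2 + l2 (q.2 - p.2) ^ 2) :
    (gaussPair m n).real S * (gaussPair m n).real T ≤ (Real.pi / 2) ^ 2 / D ^ 2 := by
  rw [measureReal_def, measureReal_def, ← ENNReal.toReal_mul]
  exact ENNReal.toReal_le_of_le_ofReal (by positivity) (gaussPair_mul_le_of_dist hD h)

/-- The event `K ≤ |h ⬝ᵥ u|` is only bounded by `1 / K²` uniformly in `n`, so `K` is chosen after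
the target accuracy and before `n`. -/
lemma tendsto_zero_of_le_inv_sq_add {f : ℕ → ℝ} (hf : ∀ n, 0 ≤ f n)
    (h : ∀ K : ℝ, 0 < K → ∃ g : ℕ → ℝ, Tendsto g atTop (𝓝 0) ∧
      ∀ᶠ n in atTop, f n ≤ 1 / K ^ 2 + g n) : Tendsto f atTop (𝓝 0) := by
  rw [Metric.tendsto_atTop']
  intro ε hε
  set K := √(2 / ε) with hK
  have hK0 : 0 < K := Real.sqrt_pos.2 (by positivity)
  have hK2 : 1 / K ^ 2 = ε / 2 := by
    rw [hK, Real.sq_sqrt (by positivity), one_div_div]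
  obtain ⟨g, hg, hfg⟩ := h K hK0
  obtain ⟨N, hN⟩ := eventually_atTop.1 (hfg.and (hg.eventually_lt_const (half_pos hε)))
  refine ⟨N, fun n hn => ?_⟩
  obtain ⟨h1, h2⟩ := hN n hn.le
  rw [Real.dist_eq, sub_zero, abs_of_nonneg (hf n)]
  linarith

/-- By Pythagoras the squared norm is at least `n/4 - n/16`. -/
lemma sqrt_div_four_le_perpNorm {n : ℕ} {u h : Fin n → ℝ} (hu : l2 u = 1) {K : ℝ}
    (hη : |h ⬝ᵥ u| ≤ K) (hh : (n : ℝ) / 4 ≤ l2 h ^ 2) (hn : 16 * K ^ 2 ≤ n) :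
    √(n : ℝ) / 4 ≤ perpNorm u h := by
  refine abs_le_of_sq_le_sq' ?_ (perpNorm_nonneg u h) |>.2
  rw [perpNorm_sq hu, div_pow, Real.sq_sqrt (Nat.cast_nonneg n)]
  have : (h ⬝ᵥ u) ^ 2 ≤ K ^ 2 := sq_le_sq' (abs_le.1 hη).1 (abs_le.1 hη).2
  linarith

/-! ### Feasible points of bounded objective have small norm -/

section Asymptotics

variable {m : ℕ → ℕ} {c : (n : ℕ) → Fin n → ℝ} {a : ℕ → ℝ} {B : ℝ}

lemma l2_normalize (hc : ∀ n, l2 (c n) = √(n : ℝ)) {n : ℕ} (hn : 0 < n) :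
    l2 ((1 / √(n : ℝ)) • c n) = 1 := by
  have : 0 < √(n : ℝ) := by positivity
  rw [l2_smul, hc, abs_of_pos (by positivity)]
  field_simp

/-- The set of samples for which a dual feasible point has bounded objective and large norm. -/
def largeNormSet {m n : ℕ} (a : Fin m → ℝ) (u : Fin n → ℝ) (B ε : ℝ) :
    Set ((Fin m → ℝ) × (Fin n → ℝ)) :=
  {p | ∃ y r, IsDualPoint a u p.1 p.2 y r ∧ |y| ≤ B ∧ ε * √(n : ℝ) < r ^ 2}

/-- Off the first two exceptional sets, the dilated sample attains `y = B' + 1`, so its dual value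
is at most `-(B' + 1) < -B` and leaves the bounded event. -/
lemma largeNormSet_subset {m n : ℕ} {c : Fin n → ℝ} {a : Fin m → ℝ} {u : Fin n → ℝ}
    (hu : l2 u = 1) (hcu : u = (1 / √(n : ℝ)) • c) (hn : 0 < n) {B B' ε K D : ℝ}
    (hB' : B ≤ B') (hB'0 : 0 ≤ B') (hε : 0 < ε) (hK : 0 < K) (hD0 : 0 < D)
    (hDε : 4 * (B' + 1) ^ 2 ≤ D * ε) (hDn : D ≤ √(n : ℝ)) (hKn : 16 * K ^ 2 ≤ n)
    (hrn : (B' + 1 + 24 * K * (B' + 1) / D) ^ 2 / ε ≤ √(n : ℝ)) :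
    largeNormSet a u B' ε ⊆ ({p | K ≤ |p.2 ⬝ᵥ u|} ∪ {p | l2 p.2 ^ 2 ≤ n / 4}) ∪
      {p | (p.1, (1 + D / √(n : ℝ)) • p.2) ∈ (bddEvent (frd c a) B)ᶜ} := by
  rintro ⟨g, h⟩ ⟨y, r, hp, hy, hr⟩
  by_cases h1 : K ≤ |h ⬝ᵥ u|
  · exact Or.inl (Or.inl h1)
  by_cases h2 : l2 h ^ 2 ≤ n / 4
  · exact Or.inl (Or.inr h2)
  refine Or.inr fun hbd => ?_
  push Not at h1 h2
  have hχ := sqrt_div_four_le_perpNorm hu h1.le h2.le hKn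
  have hs : 0 < √(n : ℝ) := by positivity
  have hq0 : 0 ≤ 24 * K * (B' + 1) / D := by positivity
  have hr0 : 0 ≤ r := (abs_nonneg y).trans hp.1
  have hrle : B' + 1 + 24 * K * (B' + 1) / D ≤ r := by
    rw [div_le_iff₀ hε] at hrn
    refine abs_le_of_sq_le_sq' ?_ hr0 |>.2
    linarith
  have hp' := hp.dilate hn hB'0 hK.le hD0.le hy hr hDε hDn h1.le hχ (by linarith)
    (by
      rw [← div_le_iff₀' hD0]
      linarith)
  have hχ' : 0 < perpNorm u ((1 + D / √(n : ℝ)) • h) := by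
    rw [perpNorm_smul _ _ (by positivity)]
    have : 0 < perpNorm u h := lt_of_lt_of_le (by positivity) hχ
    positivity
  have hle := frd_le_of_isDualPoint hu hcu hχ' hp'
  have := EReal.coe_le_coe_iff.1 (hbd.1.trans hle)
  linarith

/-- Boundedness of the dual value forces the feasible points of bounded objective to satisfy
`‖x‖² = o(√n)`. -/
theorem tendsto_largeNormSet (hc : ∀ n, l2 (c n) = √(n : ℝ))
    (hBd : Tendsto (fun n => (gaussPair (m n) n).real
      (bddEvent (frd (c n) (fun i : Fin (m n) => a i)) B)ᶜ) atTop (𝓝 0))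
    {B' ε : ℝ} (hB' : B ≤ B') (hB'0 : 0 ≤ B') (hε : 0 < ε) :
    Tendsto (fun n : ℕ => (gaussPair (m n) n).real
      (largeNormSet (fun i : Fin (m n) => a i) ((1 / √(n : ℝ)) • c n) B' ε)) atTop (𝓝 0) := by
  refine tendsto_zero_of_le_inv_sq_add (fun n => measureReal_nonneg) fun K hK => ?_
  -- `D` is independent of `n`, so comparing the dilated law with the original costs a fixed factor.
  obtain ⟨D, hD0, hDε⟩ : ∃ D : ℝ, 0 < D ∧ 4 * (B' + 1) ^ 2 ≤ D * ε :=
    ⟨4 * (B' + 1) ^ 2 / ε, by positivity, by rw [div_mul_cancel₀ _ hε.ne']⟩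
  have hTm : ∀ n, MeasurableSet (bddEvent (frd (c n) (fun i : Fin (m n) => a i)) B)ᶜ := fun n =>
    ((measurableSet_le measurable_const (measurable_frd _ _)).inter
      (measurableSet_le (measurable_frd _ _) measurable_const)).compl
  have hlim := (tendsto_gaussPair_real_norm_small m).add
      (tendsto_gaussPair_real_dilation m hD0.le hTm hBd)
  rw [add_zero] at hlim
  refine ⟨_, hlim, ?_⟩
  have hsqrt : Tendsto (fun n : ℕ => √(n : ℝ)) atTop atTop :=
    Real.tendsto_sqrt_atTop.comp tendsto_natCast_atTop_atTop
  filter_upwards [eventually_gt_atTop 0, hsqrt.eventually_ge_atTop D,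
    tendsto_natCast_atTop_atTop.eventually_ge_atTop (16 * K ^ 2),
    hsqrt.eventually_ge_atTop ((B' + 1 + 24 * K * (B' + 1) / D) ^ 2 / ε)] with n hn hDn hKn hrn
  have hu := l2_normalize hc hn
  have h1 := measureReal_mono (μ := gaussPair (m n) n)
    (largeNormSet_subset (a := fun i : Fin (m n) => a i) hu rfl hn hB' hB'0 hε hK hD0 hDε hDn hKn hrn)
  have h2 := gaussPair_real_proj_large (m := m n) hu hK
  have h3 := measureReal_union_le (μ := gaussPair (m n) n)
    ({p | K ≤ |p.2 ⬝ᵥ ((1 / √(n : ℝ)) • c n)|} ∪ {p | l2 p.2 ^ 2 ≤ n / 4})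
    {p | (p.1, (1 + D / √(n : ℝ)) • p.2) ∈ (bddEvent (frd (c n) fun i : Fin (m n) => a i) B)ᶜ}
  have h4 := measureReal_union_le (μ := gaussPair (m n) n)
    {p | K ≤ |p.2 ⬝ᵥ ((1 / √(n : ℝ)) • c n)|} {p | l2 p.2 ^ 2 ≤ n / 4}
  linarith

end Asymptotics

/-! ### Concentration of the random dual -/

section Concentration

/-- A finite value comes with a feasible point, and a value at least `τ` gives it `y ≤ -τ`. If its
norm is moderate it can be moved to `y = 0`, making the value nonpositive, a contradiction. -/
lemma le_frd_subset {m n : ℕ} {c : Fin n → ℝ} {a : Fin m → ℝ} {u : Fin n → ℝ}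
    (hu : l2 u = 1) (hcu : u = (1 / √(n : ℝ)) • c) (hn : 0 < n) {B K τ : ℝ}
    (hK : 0 < K) (hτ : 0 < τ) (hKn : 16 * K ^ 2 ≤ n) (hrn : 256 * K ^ 2 / τ ^ 2 ≤ √(n : ℝ)) :
    {p | (τ : EReal) ≤ frd c a p} ⊆ ({p | K ≤ |p.2 ⬝ᵥ u|} ∪ {p | l2 p.2 ^ 2 ≤ n / 4}) ∪
      ((bddEvent (frd c a) B)ᶜ ∪ largeNormSet a u (B + 1) 1) := by
  rintro ⟨g, h⟩ hτf
  by_cases h1 : K ≤ |h ⬝ᵥ u|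
  · exact Or.inl (Or.inl h1)
  by_cases h2 : l2 h ^ 2 ≤ n / 4
  · exact Or.inl (Or.inr h2)
  by_cases hbd : (g, h) ∈ bddEvent (frd c a) B
  swap
  · exact Or.inr (Or.inl hbd)
  push Not at h1 h2
  have hχ := sqrt_div_four_le_perpNorm hu h1.le h2.le hKn
  have hs : 0 < √(n : ℝ) := by positivity
  have hχ0 : 0 < perpNorm u h := lt_of_lt_of_le (by positivity) hχ
  obtain ⟨y, r, hy, hp⟩ := exists_isDualPoint_of_frd_lt hn hu hcu
    (lt_of_le_of_lt hbd.2 (EReal.coe_lt_coe_iff.2 (lt_add_one B)))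
  have hyB : y ≤ B := by
    have := EReal.coe_le_coe_iff.1 (hbd.1.trans (frd_le_of_isDualPoint hu hcu hχ0 hp))
    linarith
  refine Or.inr (Or.inr ⟨y, r, hp, abs_le.2 ⟨by linarith, by linarith⟩, ?_⟩)
  by_contra! hr
  rw [one_mul] at hr
  have hyτ : y ≤ -τ := by
    have := EReal.coe_le_coe_iff.1 (le_trans hτf (frd_le_of_isDualPoint hu hcu hχ0 hp))
    linarith
  have hp0 : IsDualPoint a u g h 0 r := by
    refine hp.zero_of_neg (by linarith) h1.le ?_
    have hyabs : τ ≤ |y| := by rw [abs_of_neg (by linarith)]; linarith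
    have hr1 : 2 * K * r ≤ √(n : ℝ) / 4 * τ := by
      refine abs_le_of_sq_le_sq' ?_ (by positivity) |>.2
      rw [div_le_iff₀ (by positivity)] at hrn
      have h3 : (2 * K * r) ^ 2 ≤ 4 * K ^ 2 * √(n : ℝ) := by
        calc (2 * K * r) ^ 2 = 4 * K ^ 2 * r ^ 2 := by ring
          _ ≤ _ := mul_le_mul_of_nonneg_left hr (by positivity)
      have h4 : 256 * K ^ 2 * √(n : ℝ) ≤ √(n : ℝ) * τ ^ 2 * √(n : ℝ) :=
        mul_le_mul_of_nonneg_right hrn hs.le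
      have h5 : (√(n : ℝ) / 4 * τ) ^ 2 = √(n : ℝ) * τ ^ 2 * √(n : ℝ) / 16 := by ring
      rw [h5]
      have : 0 ≤ K ^ 2 * √(n : ℝ) := by positivity
      linarith
    exact hr1.trans (mul_le_mul hχ hyabs hτ.le hχ0.le)
  have := EReal.coe_le_coe_iff.1 (le_trans hτf (frd_le_of_isDualPoint hu hcu hχ0 hp0))
  linarith

lemma frd_lt_subset {m n : ℕ} {c : Fin n → ℝ} {a : Fin m → ℝ} {u : Fin n → ℝ}
    (hu : l2 u = 1) (hcu : u = (1 / √(n : ℝ)) • c) (hn : 0 < n) {B K T ε : ℝ} (hT : 0 ≤ T)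
    (hKn : 16 * K ^ 2 ≤ n) :
    {p | frd c a p < ((-T : ℝ) : EReal)} ⊆
      ({p | K ≤ |p.2 ⬝ᵥ u|} ∪ {p | l2 p.2 ^ 2 ≤ n / 4}) ∪
        ((bddEvent (frd c a) B)ᶜ ∪ largeNormSet a u B ε) ∪
      {p | ∃ y r, IsDualPoint a u p.1 p.2 y r ∧ T < y ∧ r ^ 2 ≤ ε * √(n : ℝ)} := by
  rintro ⟨g, h⟩ hf
  by_cases h1 : K ≤ |h ⬝ᵥ u|
  · exact Or.inl (Or.inl (Or.inl h1))
  by_cases h2 : l2 h ^ 2 ≤ n / 4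
  · exact Or.inl (Or.inl (Or.inr h2))
  by_cases hbd : (g, h) ∈ bddEvent (frd c a) B
  swap
  · exact Or.inl (Or.inr (Or.inl hbd))
  push Not at h1 h2
  have hχ := sqrt_div_four_le_perpNorm hu h1.le h2.le hKn
  have hχ0 : 0 < perpNorm u h := lt_of_lt_of_le (by positivity) hχ
  obtain ⟨y, r, hy, hp⟩ := exists_isDualPoint_of_frd_lt hn hu hcu hf
  have hyB : y ≤ B := by
    have := EReal.coe_le_coe_iff.1 (hbd.1.trans (frd_le_of_isDualPoint hu hcu hχ0 hp))
    linarith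
  rw [neg_neg] at hy
  by_cases hr : r ^ 2 ≤ ε * √(n : ℝ)
  · exact Or.inr ⟨y, r, hp, hy, hr⟩
  · exact Or.inl (Or.inr (Or.inr ⟨y, r, hp, abs_le.2 ⟨by linarith, hyB⟩, not_le.1 hr⟩))

/-- Samples with a dual point of moderate norm are far from samples with a larger dual value. -/
lemma le_dist_of_isDualPoint {m n : ℕ} {c : Fin n → ℝ} {a : Fin m → ℝ} {u : Fin n → ℝ}
    (hu : l2 u = 1) (hcu : u = (1 / √(n : ℝ)) • c) (hn : 0 < n) {K T₁ y₁ T₂ D ε : ℝ}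
    (hT₁ : T₁ < y₁) (hy₁ : 0 ≤ y₁) (hT₂ : y₁ < T₂) (hD : 0 < D) (hK : 0 < K)
    (hKn : 16 * K ^ 2 ≤ n) (hε : 8 * (3 * D + K) * ε ≤ T₂ ^ 2 - y₁ ^ 2)
    {p q : (Fin m → ℝ) × (Fin n → ℝ)}
    (hp : ∃ y r, IsDualPoint a u p.1 p.2 y r ∧ T₂ < y ∧ r ^ 2 ≤ ε * √(n : ℝ))
    (hq : ((-T₁ : ℝ) : EReal) ≤ frd c a q) (hqK : |q.2 ⬝ᵥ u| ≤ K)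
    (hqn : (n : ℝ) / 4 ≤ l2 q.2 ^ 2) :
    D ^ 2 ≤ l2 (q.1 - p.1) ^ 2 + l2 (q.2 - p.2) ^ 2 := by
  by_contra! hlt
  obtain ⟨y, r, hp, hy, hr⟩ := hp
  have hχ := sqrt_div_four_le_perpNorm hu hqK hqn hKn
  have hs : 0 < √(n : ℝ) := by positivity
  have hχ0 : 0 < perpNorm u q.2 := lt_of_lt_of_le (by positivity) hχ
  have hT0 : 0 ≤ T₂ ^ 2 - y₁ ^ 2 := by nlinarith
  have hp' : IsDualPoint a u q.1 q.2 y₁ r := by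
    refine hp.perturb hu hy₁ hT₂ hy (D := D) (K := K) ?_ ?_ hqK ?_
    · exact (abs_le_of_sq_le_sq' (by linarith [sq_nonneg (l2 (q.2 - p.2))]) hD.le).2
    · exact (abs_le_of_sq_le_sq' (by linarith [sq_nonneg (l2 (q.1 - p.1))]) hD.le).2
    · calc 2 * (3 * D + K) * r ^ 2 ≤ 2 * (3 * D + K) * (ε * √(n : ℝ)) :=
            mul_le_mul_of_nonneg_left hr (by positivity)
        _ = (8 * (3 * D + K) * ε) * (√(n : ℝ) / 4) := by ring
        _ ≤ (T₂ ^ 2 - y₁ ^ 2) * perpNorm u q.2 := mul_le_mul hε hχ (by positivity) hT0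
        _ = _ := mul_comm _ _
  have hle := frd_le_of_isDualPoint (g := q.1) (h := q.2) hu hcu hχ0 hp'
  have := EReal.coe_le_coe_iff.1 (hq.trans hle)
  linarith

variable {m : ℕ → ℕ} {c : (n : ℕ) → Fin n → ℝ} {a : ℕ → ℝ} {B : ℝ}

theorem tendsto_measure_le_frd_of_pos (hc : ∀ n, l2 (c n) = √(n : ℝ))
    (hBd : Tendsto (fun n => (gaussPair (m n) n).real
      (bddEvent (frd (c n) (fun i : Fin (m n) => a i)) B)ᶜ) atTop (𝓝 0)) (hB : 0 ≤ B)
    {τ : ℝ} (hτ : 0 < τ) :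
    Tendsto (fun n : ℕ => (gaussPair (m n) n).real
      {p | (τ : EReal) ≤ frd (c n) (fun i : Fin (m n) => a i) p}) atTop (𝓝 0) := by
  refine tendsto_zero_of_le_inv_sq_add (fun n => measureReal_nonneg) fun K hK => ?_
  have hlim := (tendsto_gaussPair_real_norm_small m).add
    (hBd.add (tendsto_largeNormSet hc hBd (B' := B + 1) (by linarith) (by linarith) one_pos))
  simp only [add_zero] at hlim
  refine ⟨_, hlim, ?_⟩
  have hsqrt : Tendsto (fun n : ℕ => √(n : ℝ)) atTop atTop :=
    Real.tendsto_sqrt_atTop.comp tendsto_natCast_atTop_atTop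
  filter_upwards [eventually_gt_atTop 0,
    tendsto_natCast_atTop_atTop.eventually_ge_atTop (16 * K ^ 2),
    hsqrt.eventually_ge_atTop (256 * K ^ 2 / τ ^ 2)] with n hn hKn hrn
  have hu := l2_normalize hc hn
  have h1 := measureReal_mono (μ := gaussPair (m n) n)
    (le_frd_subset (a := fun i : Fin (m n) => a i) (B := B) hu rfl hn hK hτ hKn hrn)
  have h2 := gaussPair_real_proj_large (m := m n) hu hK
  have h3 := measureReal_union_le (μ := gaussPair (m n) n)
    ({p | K ≤ |p.2 ⬝ᵥ ((1 / √(n : ℝ)) • c n)|} ∪ {p | l2 p.2 ^ 2 ≤ n / 4})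
    ((bddEvent (frd (c n) fun i : Fin (m n) => a i) B)ᶜ ∪
      largeNormSet (fun i : Fin (m n) => a i) ((1 / √(n : ℝ)) • c n) (B + 1) 1)
  have h4 := measureReal_union_le (μ := gaussPair (m n) n)
    {p | K ≤ |p.2 ⬝ᵥ ((1 / √(n : ℝ)) • c n)|} {p | l2 p.2 ^ 2 ≤ n / 4}
  have h5 := measureReal_union_le (μ := gaussPair (m n) n)
    (bddEvent (frd (c n) fun i : Fin (m n) => a i) B)ᶜ
    (largeNormSet (fun i : Fin (m n) => a i) ((1 / √(n : ℝ)) • c n) (B + 1) 1)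
  linarith

/-- For each large `n` the two events, cleaned of negligible sets, are at distance at least `D`, so
the product of their probabilities is at most `(κ/2)²`. Which factor is small may still depend on
`n`. -/
theorem eventually_measure_frd_small (hc : ∀ n, l2 (c n) = √(n : ℝ))
    (hBd : Tendsto (fun n => (gaussPair (m n) n).real
      (bddEvent (frd (c n) (fun i : Fin (m n) => a i)) B)ᶜ) atTop (𝓝 0)) (hB : 0 ≤ B)
    {T₁ T₂ κ : ℝ} (hT₁ : 0 ≤ T₁) (hT : T₁ < T₂) (hκ : 0 < κ) :
    ∀ᶠ n : ℕ in atTop,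
      (gaussPair (m n) n).real
        {p | frd (c n) (fun i : Fin (m n) => a i) p < ((-T₂ : ℝ) : EReal)} ≤ κ ∨
      (gaussPair (m n) n).real
        {p | ((-T₁ : ℝ) : EReal) ≤ frd (c n) (fun i : Fin (m n) => a i) p} ≤ κ := by
  obtain ⟨K, hK, hK2⟩ : ∃ K : ℝ, 0 < K ∧ 1 / K ^ 2 = κ / 4 :=
    ⟨√(4 / κ), Real.sqrt_pos.2 (by positivity), by
      rw [Real.sq_sqrt (by positivity), one_div_div]⟩
  obtain ⟨D, hD, hD2⟩ : ∃ D : ℝ, 0 < D ∧ (Real.pi / 2) ^ 2 / D ^ 2 = κ / 2 * (κ / 2) :=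
    ⟨Real.pi / κ, by positivity, by field_simp⟩
  -- The intermediate level leaves room on both sides: `y` falls from above `T₂` to `y₁`, and a dual
  -- value at most `-y₁` contradicts one at least `-T₁`.
  obtain ⟨y₁, hy₁, hy₁'⟩ := exists_between hT
  have hTy : 0 < T₂ ^ 2 - y₁ ^ 2 := by nlinarith
  obtain ⟨ε, hε, hε2⟩ : ∃ ε : ℝ, 0 < ε ∧ 8 * (3 * D + K) * ε ≤ T₂ ^ 2 - y₁ ^ 2 :=
    ⟨(T₂ ^ 2 - y₁ ^ 2) / (8 * (3 * D + K)), by positivity, by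
      rw [mul_div_cancel₀ _ (by positivity : 8 * (3 * D + K) ≠ 0)]⟩
  have hlim := (tendsto_gaussPair_real_norm_small m).add
    (hBd.add (tendsto_largeNormSet hc hBd (B' := B) le_rfl hB hε))
  simp only [add_zero] at hlim
  filter_upwards [eventually_gt_atTop 0,
    tendsto_natCast_atTop_atTop.eventually_ge_atTop (16 * K ^ 2),
    hlim.eventually_le_const (show (0 : ℝ) < κ / 4 by positivity)] with n hn hKn hsmall
  have hu := l2_normalize hc hn
  have hproj := gaussPair_real_proj_large (m := m n) hu hK
  rw [hK2] at hproj
  set μ := gaussPair (m n) n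
  set av : Fin (m n) → ℝ := fun i => a i
  set u := (1 / √(n : ℝ)) • c n with hcu
  set S : Set ((Fin (m n) → ℝ) × (Fin n → ℝ)) :=
    {p | ∃ y r, IsDualPoint av u p.1 p.2 y r ∧ T₂ < y ∧ r ^ 2 ≤ ε * √(n : ℝ)} with hS
  set P : Set ((Fin (m n) → ℝ) × (Fin n → ℝ)) := {p | K ≤ |p.2 ⬝ᵥ u|} with hP
  set N : Set ((Fin (m n) → ℝ) × (Fin n → ℝ)) := {p | l2 p.2 ^ 2 ≤ n / 4} with hN
  set Q : Set ((Fin (m n) → ℝ) × (Fin n → ℝ)) :=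
    {p | ((-T₁ : ℝ) : EReal) ≤ frd (c n) av p} with hQ
  have hprod : μ.real S * μ.real (Q \ (P ∪ N)) ≤ κ / 2 * (κ / 2) := by
    rw [← hD2]
    refine gaussPair_real_mul_le_of_dist hD fun p hp q hq => ?_
    have hq2 : ¬ K ≤ |q.2 ⬝ᵥ u| := fun h => hq.2 (Or.inl h)
    have hq3 : ¬ l2 q.2 ^ 2 ≤ n / 4 := fun h => hq.2 (Or.inr h)
    exact le_dist_of_isDualPoint hu hcu hn hy₁ (hT₁.trans hy₁.le) hy₁' hD hK hKn hε2 hp hq.1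
      (not_le.1 hq2).le (not_le.1 hq3).le
  have hPN := measureReal_union_le (μ := μ) P N
  have hn1 : 0 ≤ μ.real N := measureReal_nonneg
  have hn2 : 0 ≤ μ.real (bddEvent (frd (c n) av) B)ᶜ := measureReal_nonneg
  have hn3 : 0 ≤ μ.real (largeNormSet av u B ε) := measureReal_nonneg
  by_cases hSκ : μ.real S ≤ κ / 2
  · left
    have h1 := measureReal_mono (μ := μ)
      (frd_lt_subset (a := av) (B := B) (K := K) (T := T₂) (ε := ε) hu hcu hn (by linarith) hKn)
    have h3 := measureReal_union_le (μ := μ) (P ∪ N ∪ ((bddEvent (frd (c n) av) B)ᶜ ∪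
      largeNormSet av u B ε)) S
    have h4 := measureReal_union_le (μ := μ) (P ∪ N) ((bddEvent (frd (c n) av) B)ᶜ ∪
      largeNormSet av u B ε)
    have h5 := measureReal_union_le (μ := μ) (bddEvent (frd (c n) av) B)ᶜ (largeNormSet av u B ε)
    linarith
  · right
    have h1 : μ.real (Q \ (P ∪ N)) ≤ κ / 2 := by
      by_contra! hcon
      exact absurd hprod (not_le.2 (mul_lt_mul'' (not_le.1 hSκ) hcon (by positivity) (by positivity)))
    have h2 : μ.real Q ≤ μ.real ((Q \ (P ∪ N)) ∪ (P ∪ N)) := by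
      refine measureReal_mono ?_
      rw [Set.sdiff_union_self]
      exact Set.subset_union_left
    have h3 := measureReal_union_le (μ := μ) (Q \ (P ∪ N)) (P ∪ N)
    linarith

/-- The dual value does not oscillate: for `s < s'` one of the two tails is asymptotically null. -/
theorem eventually_measure_frd_lt_or_le (hc : ∀ n, l2 (c n) = √(n : ℝ))
    (hBd : Tendsto (fun n => (gaussPair (m n) n).real
      (bddEvent (frd (c n) (fun i : Fin (m n) => a i)) B)ᶜ) atTop (𝓝 0)) (hB : 0 ≤ B)
    {s s' κ : ℝ} (hs : s < s') (hκ : 0 < κ) :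
    ∀ᶠ n : ℕ in atTop,
      (gaussPair (m n) n).real {p | frd (c n) (fun i : Fin (m n) => a i) p < (s : EReal)} ≤ κ ∨
      (gaussPair (m n) n).real {p | (s' : EReal) ≤ frd (c n) (fun i : Fin (m n) => a i) p} ≤ κ := by
  -- Trading `y` for slack needs `y` to stay nonnegative, so a positive level `s'` is handled by its
  -- own vanishing tail.
  rcases lt_or_ge 0 s' with h | h
  · filter_upwards [(tendsto_measure_le_frd_of_pos hc hBd hB h).eventually_le_const hκ] with n hn
    exact Or.inr hn
  · have := eventually_measure_frd_small hc hBd hB (T₁ := -s') (T₂ := -s) (by linarith)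
      (by linarith) hκ
    simpa only [neg_neg] using this

end Concentration

/-! ### Expectations on the bounded event against tail probabilities -/

section BddExp

variable {Ω : Type*} {f : Ω → EReal} {B : ℝ}

lemma coe_toReal_of_mem_bddEvent {ω : Ω} (h : ω ∈ bddEvent f B) :
    ((f ω).toReal : EReal) = f ω :=
  EReal.coe_toReal (fun h1 => by have := h.2; rw [h1] at this; simp at this)
    (fun h1 => by have := h.1; rw [h1] at this; simp at this)

lemma abs_toReal_le_of_mem_bddEvent {ω : Ω} (h : ω ∈ bddEvent f B) : |(f ω).toReal| ≤ B := by
  have e := coe_toReal_of_mem_bddEvent h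
  obtain ⟨h1, h2⟩ := h
  rw [← e] at h1 h2
  exact abs_le.2 ⟨EReal.coe_le_coe_iff.1 h1, EReal.coe_le_coe_iff.1 h2⟩

variable [MeasurableSpace Ω] {μ : Measure Ω}

lemma measurableSet_bddEvent (hf : Measurable f) (B : ℝ) : MeasurableSet (bddEvent f B) :=
  (measurableSet_le measurable_const hf).inter (measurableSet_le hf measurable_const)

variable [IsProbabilityMeasure μ]

lemma integrableOn_toReal_bddEvent (hf : Measurable f) (B : ℝ) :
    IntegrableOn (fun ω => (f ω).toReal) (bddEvent f B) μ :=
  Integrable.of_bound (hf.ereal_toReal.aestronglyMeasurable) B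
    ((ae_restrict_iff' (measurableSet_bddEvent hf B)).2
      (Eventually.of_forall fun _ => abs_toReal_le_of_mem_bddEvent))

lemma abs_bddExp_le (hB : 0 ≤ B) : |bddExp μ f B| ≤ B := by
  have h := norm_setIntegral_le_of_norm_le_const (μ := μ) (C := B) (s := bddEvent f B)
    (f := fun ω => (f ω).toReal) (measure_lt_top μ _)
    (fun ω hω => abs_toReal_le_of_mem_bddEvent hω)
  refine h.trans (mul_le_of_le_one_right hB measureReal_le_one)

/-- On the bounded event the value is at most `t`, plus `B + |t|` where it reaches `t`. The mass
missing from the event accounts for the last term. -/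
lemma bddExp_le (hf : Measurable f) (hB : 0 ≤ B) (t : ℝ) :
    bddExp μ f B ≤ t + (B + |t|) * (μ.real {ω | (t : EReal) ≤ f ω} + μ.real (bddEvent f B)ᶜ) := by
  have hE := measurableSet_bddEvent hf B
  have hs : MeasurableSet {ω | (t : EReal) ≤ f ω} := measurableSet_le measurable_const hf
  have ht : 0 ≤ B + |t| := by positivity
  have h1 : bddExp μ f B ≤ ∫ ω in bddEvent f B,
      (t + {ω | (t : EReal) ≤ f ω}.indicator (fun _ => B + |t|) ω) ∂μ := by
    refine setIntegral_mono_on (integrableOn_toReal_bddEvent hf B)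
      ((integrable_const t).add ((integrable_const (B + |t|)).indicator hs)) hE fun ω hω => ?_
    by_cases hω' : (t : EReal) ≤ f ω
    · rw [Set.indicator_of_mem (by exact hω')]
      linarith [(abs_le.1 (abs_toReal_le_of_mem_bddEvent hω)).2, neg_abs_le t]
    · rw [Set.indicator_of_notMem (by exact hω'), add_zero]
      rw [← coe_toReal_of_mem_bddEvent hω, EReal.coe_le_coe_iff] at hω'
      linarith
  have h2 : ∫ ω in bddEvent f B,
      (t + {ω | (t : EReal) ≤ f ω}.indicator (fun _ => B + |t|) ω) ∂μ =
      t * μ.real (bddEvent f B) +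
        (B + |t|) * (μ.restrict (bddEvent f B)).real {ω | (t : EReal) ≤ f ω} := by
    rw [integral_add (integrable_const t) ((integrable_const (B + |t|)).indicator hs),
      setIntegral_const, integral_indicator_const _ hs, smul_eq_mul, smul_eq_mul]
    ring
  have h3 : (μ.restrict (bddEvent f B)).real {ω | (t : EReal) ≤ f ω} ≤
      μ.real {ω | (t : EReal) ≤ f ω} :=
    ENNReal.toReal_mono (measure_ne_top _ _) (Measure.restrict_apply_le _ _)
  have h4 : μ.real (bddEvent f B) = 1 - μ.real (bddEvent f B)ᶜ := by
    rw [measureReal_compl hE, probReal_univ]; ring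
  have h5 : 0 ≤ μ.real (bddEvent f B)ᶜ := measureReal_nonneg
  rw [h2, h4] at h1
  have h6 := mul_le_mul_of_nonneg_left h3 ht
  have h7 := mul_le_mul_of_nonneg_right (neg_abs_le t) h5
  have h8 := mul_nonneg hB h5
  linarith

lemma le_bddExp (hf : Measurable f) (hB : 0 ≤ B) (t : ℝ) :
    t - (B + |t|) * (μ.real {ω | f ω < (t : EReal)} + μ.real (bddEvent f B)ᶜ) ≤ bddExp μ f B := by
  have hE := measurableSet_bddEvent hf B
  have hs : MeasurableSet {ω | f ω < (t : EReal)} := measurableSet_lt hf measurable_const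
  have ht : 0 ≤ B + |t| := by positivity
  have h1 : ∫ ω in bddEvent f B,
      (t - {ω | f ω < (t : EReal)}.indicator (fun _ => B + |t|) ω) ∂μ ≤ bddExp μ f B := by
    refine setIntegral_mono_on ((integrable_const t).sub
      ((integrable_const (B + |t|)).indicator hs)) (integrableOn_toReal_bddEvent hf B)
      hE fun ω hω => ?_
    by_cases hω' : f ω < (t : EReal)
    · rw [Set.indicator_of_mem (by exact hω')]
      linarith [(abs_le.1 (abs_toReal_le_of_mem_bddEvent hω)).1, le_abs_self t]
    · rw [Set.indicator_of_notMem (by exact hω'), sub_zero]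
      rw [← coe_toReal_of_mem_bddEvent hω, EReal.coe_lt_coe_iff] at hω'
      linarith
  have h2 : ∫ ω in bddEvent f B,
      (t - {ω | f ω < (t : EReal)}.indicator (fun _ => B + |t|) ω) ∂μ =
      t * μ.real (bddEvent f B) -
        (B + |t|) * (μ.restrict (bddEvent f B)).real {ω | f ω < (t : EReal)} := by
    rw [integral_sub (integrable_const t) ((integrable_const (B + |t|)).indicator hs),
      setIntegral_const, integral_indicator_const _ hs, smul_eq_mul, smul_eq_mul]
    ring
  have h3 : (μ.restrict (bddEvent f B)).real {ω | f ω < (t : EReal)} ≤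
      μ.real {ω | f ω < (t : EReal)} :=
    ENNReal.toReal_mono (measure_ne_top _ _) (Measure.restrict_apply_le _ _)
  have h4 : μ.real (bddEvent f B) = 1 - μ.real (bddEvent f B)ᶜ := by
    rw [measureReal_compl hE, probReal_univ]; ring
  have h5 : 0 ≤ μ.real (bddEvent f B)ᶜ := measureReal_nonneg
  rw [h2, h4] at h1
  have h6 := mul_le_mul_of_nonneg_left h3 ht
  have h7 := mul_le_mul_of_nonneg_right (le_abs_self t) h5
  have h8 := mul_nonneg hB h5
  linarith

end BddExp

/-! ### From vanishing tails to limits of expectations -/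

section Sequences

variable {Ω : ℕ → Type*} [∀ n, MeasurableSpace (Ω n)] {μ : (n : ℕ) → Measure (Ω n)}
  {f : (n : ℕ) → Ω n → EReal} {B : ℝ}

lemma nonneg_of_tendsto_bddEvent
    (h : Tendsto (fun n => μ n (bddEvent (f n) B)) atTop (𝓝 1)) : 0 ≤ B := by
  by_contra! hB
  have : ∀ n, bddEvent (f n) B = ∅ := fun n => by
    rw [Set.eq_empty_iff_forall_notMem]
    rintro ω ⟨h1, h2⟩
    have := EReal.coe_le_coe_iff.1 (h1.trans h2)
    linarith
  simp only [this, measure_empty] at h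
  exact zero_ne_one (tendsto_nhds_unique tendsto_const_nhds h)

variable [∀ n, IsProbabilityMeasure (μ n)]

lemma tendsto_bddEvent_compl (hf : ∀ n, Measurable (f n))
    (h : Tendsto (fun n => μ n (bddEvent (f n) B)) atTop (𝓝 1)) :
    Tendsto (fun n => (μ n).real (bddEvent (f n) B)ᶜ) atTop (𝓝 0) := by
  have h1 := ((ENNReal.tendsto_toReal ENNReal.one_ne_top).comp h).const_sub 1
  simp only [ENNReal.toReal_one, sub_self] at h1
  refine h1.congr fun n => ?_
  rw [measureReal_compl (measurableSet_bddEvent (hf n) B), probReal_univ]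
  rfl

/-- Only lower tails are needed: each level `s < ξ` bounds the expectations from below up to a
vanishing error. -/
lemma le_liminf_bddExp (hf : ∀ n, Measurable (f n)) (hB : 0 ≤ B)
    (hE : Tendsto (fun n => (μ n).real (bddEvent (f n) B)ᶜ) atTop (𝓝 0)) {ξ : ℝ} (h : ∀ s < ξ,
    Tendsto (fun n => (μ n).real {ω | f n ω < (s : EReal)}) atTop (𝓝 0)) :
    ξ ≤ liminf (fun n => bddExp (μ n) (f n) B) atTop := by
  have hco : IsCoboundedUnder (· ≥ ·) atTop (fun n => bddExp (μ n) (f n) B) := by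
    refine IsBoundedUnder.isCoboundedUnder_ge ?_
    exact isBoundedUnder_of ⟨B, fun n => (abs_le.1 (abs_bddExp_le hB)).2⟩
  refine le_of_forall_lt fun t ht => ?_
  obtain ⟨t', ht1, ht2⟩ := exists_between ht
  obtain ⟨s, hs1, hs2⟩ := exists_between ht2
  refine ht1.trans_le (le_liminf_of_le hco ?_)
  have h1 := (((h s hs2).add hE).const_mul (B + |s|)).const_sub s
  rw [add_zero, mul_zero, sub_zero] at h1
  filter_upwards [h1.eventually_const_lt hs1] with n hn
  exact hn.le.trans (le_bddExp (hf n) hB s)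

variable (hf : ∀ n, Measurable (f n)) (hB : 0 ≤ B)
  (hE : Tendsto (fun n => (μ n).real (bddEvent (f n) B)ᶜ) atTop (𝓝 0))
  (hdich : ∀ s s' κ : ℝ, s < s' → 0 < κ → ∀ᶠ n in atTop,
    (μ n).real {ω | f n ω < (s : EReal)} ≤ κ ∨ (μ n).real {ω | (s' : EReal) ≤ f n ω} ≤ κ)
  {ξ : ℝ} (hξ : Tendsto (fun n => bddExp (μ n) (f n) B) atTop (𝓝 ξ))

include hf hB hE hdich hξ

/-- A bounded sequence without oscillations concentrates at its limiting expectation: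
lower tail. -/
lemma tendsto_measure_lt_of_dichotomy {s : ℝ} (hs : s < ξ) :
    Tendsto (fun n => (μ n).real {ω | f n ω < (s : EReal)}) atTop (𝓝 0) := by
  obtain ⟨s', hs', hs''⟩ := exists_between hs
  set d := ξ - s' with hd
  have hd0 : 0 < d := by linarith
  set C := B + |s'| with hC
  have hC0 : 0 ≤ C := by positivity
  rw [Metric.tendsto_atTop']
  intro κ hκ
  -- If instead the upper tail at `s'` were at most `κ'`, the expectation would be at most `s' + d/4
  -- + d/4 = ξ - d/2`, contradicting its convergence to `ξ`.
  set κ' := min (κ / 2) (d / 4 / (C + 1)) with hκ'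
  have hκ'0 : 0 < κ' := lt_min (by positivity) (by positivity)
  have hCκ : C * κ' ≤ d / 4 := by
    have h1 : κ' ≤ d / 4 / (C + 1) := min_le_right _ _
    have h2 : C * (d / 4 / (C + 1)) ≤ d / 4 := by
      rw [mul_div_assoc', div_le_iff₀ (by linarith)]
      nlinarith
    exact (mul_le_mul_of_nonneg_left h1 hC0).trans h2
  have hE' := hE.const_mul C
  rw [mul_zero] at hE'
  obtain ⟨N, hN⟩ := eventually_atTop.1 ((hdich s s' κ' hs' hκ'0).and
    ((hE'.eventually_lt_const (show (0 : ℝ) < d / 4 by positivity)).and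
      (hξ.eventually_const_lt (show ξ - d / 2 < ξ by linarith))))
  refine ⟨N, fun n hn => ?_⟩
  obtain ⟨h1, h2, h3⟩ := hN n hn.le
  rw [Real.dist_eq, sub_zero, abs_of_nonneg measureReal_nonneg]
  rcases h1 with h1 | h1
  · exact (h1.trans (min_le_left _ _)).trans_lt (by linarith)
  · have h4 := bddExp_le (μ := μ n) (hf n) hB s'
    have h5 := mul_le_mul_of_nonneg_left h1 hC0
    rw [← hC] at h4
    linarith

/-- A bounded sequence without oscillations concentrates at its limiting expectation:
upper tail. -/
lemma tendsto_measure_le_of_dichotomy {s : ℝ} (hs : ξ < s) :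
    Tendsto (fun n => (μ n).real {ω | (s : EReal) ≤ f n ω}) atTop (𝓝 0) := by
  obtain ⟨s', hs', hs''⟩ := exists_between hs
  set d := s' - ξ with hd
  have hd0 : 0 < d := by linarith
  set C := B + |s'| with hC
  have hC0 : 0 ≤ C := by positivity
  rw [Metric.tendsto_atTop']
  intro κ hκ
  set κ' := min (κ / 2) (d / 4 / (C + 1)) with hκ'
  have hκ'0 : 0 < κ' := lt_min (by positivity) (by positivity)
  have hCκ : C * κ' ≤ d / 4 := by
    have h1 : κ' ≤ d / 4 / (C + 1) := min_le_right _ _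
    have h2 : C * (d / 4 / (C + 1)) ≤ d / 4 := by
      rw [mul_div_assoc', div_le_iff₀ (by linarith)]
      nlinarith
    exact (mul_le_mul_of_nonneg_left h1 hC0).trans h2
  have hE' := hE.const_mul C
  rw [mul_zero] at hE'
  obtain ⟨N, hN⟩ := eventually_atTop.1 ((hdich s' s κ' hs'' hκ'0).and
    ((hE'.eventually_lt_const (show (0 : ℝ) < d / 4 by positivity)).and
      (hξ.eventually_lt_const (show ξ < ξ + d / 2 by linarith))))
  refine ⟨N, fun n hn => ?_⟩
  obtain ⟨h1, h2, h3⟩ := hN n hn.le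
  rw [Real.dist_eq, sub_zero, abs_of_nonneg measureReal_nonneg]
  rcases h1 with h1 | h1
  · have h4 := le_bddExp (μ := μ n) (hf n) hB s'
    have h5 := mul_le_mul_of_nonneg_left h1 hC0
    rw [← hC] at h4
    linarith
  · exact (h1.trans (min_le_left _ _)).trans_lt (by linarith)

end Sequences

end RandomLP

/-! ### The main theorem -/

theorem theorem1
    -- linear regime
    (m : ℕ → ℕ) (α : ℝ) (hα : 0 < α)
    (hm : Tendsto (fun n : ℕ => (m n : ℝ) / (n : ℝ)) atTop (𝓝 α))
    -- the objective vectors, and the right-hand side with fixed components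
    (c : (n : ℕ) → Fin n → ℝ) (hc : ∀ n, RandomLP.l2 (c n) = √(n : ℝ))
    (a : ℕ → ℝ)
    -- the random primal and the random dual are bounded with probability going to 1
    (Bp Bd : ℝ)
    (hBp : Tendsto (fun n => RandomLP.gaussMat (m n) n
      (RandomLP.bddEvent (RandomLP.frp (c n) (fun i : Fin (m n) => a i)) Bp)) atTop (𝓝 1))
    (hBd : Tendsto (fun n => RandomLP.gaussPair (m n) n
      (RandomLP.bddEvent (RandomLP.frd (c n) (fun i : Fin (m n) => a i)) Bd)) atTop (𝓝 1))
    -- the limiting expected value of the random dual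
    (ξrd : ℝ)
    (hξrd : Tendsto (fun n => RandomLP.bddExp (RandomLP.gaussPair (m n) n)
      (RandomLP.frd (c n) (fun i : Fin (m n) => a i)) Bd) atTop (𝓝 ξrd)) :
    ξrd ≤ liminf (fun n => RandomLP.bddExp (RandomLP.gaussMat (m n) n)
        (RandomLP.frp (c n) (fun i : Fin (m n) => a i)) Bp) atTop ∧
    (∀ ξrp : ℝ, Tendsto (fun n => RandomLP.bddExp (RandomLP.gaussMat (m n) n)
        (RandomLP.frp (c n) (fun i : Fin (m n) => a i)) Bp) atTop (𝓝 ξrp) → ξrd ≤ ξrp) ∧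
    (ξrd ≠ 0 → ∀ ε : ℝ, ε ≠ 0 →
      limsup (fun n => RandomLP.gaussPair (m n) n
        {gh | (((1 - ε) * ξrd : ℝ) : EReal) ≤
          RandomLP.frd (c n) (fun i : Fin (m n) => a i) gh}) atTop ≤
      liminf (fun n => RandomLP.gaussMat (m n) n
        {A | (((1 - ε) * ξrd : ℝ) : EReal) ≤
          RandomLP.frp (c n) (fun i : Fin (m n) => a i) A}) atTop) := by
  open RandomLP in
  have hfd : ∀ n, Measurable (frd (c n) (fun i : Fin (m n) => a i)) := fun n => measurable_frd _ _
  have hfp : ∀ n, Measurable (frp (c n) (fun i : Fin (m n) => a i)) := fun n => measurable_frp _ _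
  have hBd0 := nonneg_of_tendsto_bddEvent hBd
  have hBp0 := nonneg_of_tendsto_bddEvent hBp
  have hEd := tendsto_bddEvent_compl hfd hBd
  have hEp := tendsto_bddEvent_compl hfp hBp
  have hdich := fun (s s' κ : ℝ) (hs : s < s') (hκ : 0 < κ) =>
    eventually_measure_frd_lt_or_le hc hEd hBd0 hs hκ
  have hlow := fun (s : ℝ) (hs : s < ξrd) =>
    tendsto_measure_lt_of_dichotomy hfd hBd0 hEd hdich hξrd hs
  have hup := fun (s : ℝ) (hs : ξrd < s) =>
    tendsto_measure_le_of_dichotomy hfd hBd0 hEd hdich hξrd hs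
  have hprimal : ∀ s < ξrd, Tendsto (fun n => (gaussMat (m n) n).real
      {A | frp (c n) (fun i : Fin (m n) => a i) A < (s : EReal)}) atTop (𝓝 0) := by
    intro s hs
    obtain ⟨s', hs1, hs2⟩ := exists_between hs
    -- The probability of `γ < 0` is a positive constant, so dividing by it keeps the dual's lower
    -- tail negligible.
    set p : ℝ := (gaussianReal 0 1).real (Set.Iio 0) with hp
    have hp0 : 0 < p := by
      refine ENNReal.toReal_pos (fun h0 => ?_) (measure_ne_top _ _)
      have := gaussianReal_absolutelyContinuous' 0 one_ne_zero h0
      simp at this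
    have h1 := (hlow s' hs2).const_mul p⁻¹
    rw [mul_zero] at h1
    refine tendsto_of_tendsto_of_tendsto_of_le_of_le' tendsto_const_nhds h1
      (Eventually.of_forall fun n => measureReal_nonneg) ?_
    filter_upwards [eventually_gt_atTop 0] with n hn
    rw [le_inv_mul_iff₀ hp0, mul_comm, hp, measureReal_def, measureReal_def, ← ENNReal.toReal_mul]
    exact ENNReal.toReal_mono (measure_ne_top _ _) (measure_frp_lt_mul_le hn _ _ hs1)
  have hfirst := le_liminf_bddExp hfp hBp0 hEp hprimal
  refine ⟨hfirst, fun ξrp hξrp => hξrp.liminf_eq ▸ hfirst, fun hξ0 ε hε => ?_⟩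
  have hne : (1 - ε) * ξrd ≠ ξrd := fun h => by
    have : ε * ξrd = 0 := by linarith
    rcases mul_eq_zero.1 this with h | h
    · exact hε h
    · exact hξ0 h
  -- Below `ξrd` the primal probability tends to one; above it the dual probability tends to zero.
  -- Only the level `ξrd` itself would be undecided.
  rcases lt_or_gt_of_ne hne with hs | hs
  · have h1 := (ENNReal.tendsto_toReal_zero_iff fun n => measure_ne_top _ _).1 (hprimal _ hs)
    have h2 : Tendsto (fun n => gaussMat (m n) n {A | (((1 - ε) * ξrd : ℝ) : EReal) ≤
        frp (c n) (fun i : Fin (m n) => a i) A}) atTop (𝓝 1) := by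
      have h3 := ENNReal.Tendsto.sub (tendsto_const_nhds (x := (1 : ENNReal))) h1
        (Or.inl ENNReal.one_ne_top)
      rw [tsub_zero] at h3
      refine h3.congr fun n => ?_
      rw [← prob_compl_eq_one_sub (measurableSet_lt (hfp n) measurable_const)]
      congr 1
      ext A
      simp
    rw [h2.liminf_eq]
    exact limsup_le_of_le (h := Eventually.of_forall fun n => prob_le_one)
  · have h1 := (ENNReal.tendsto_toReal_zero_iff fun n => measure_ne_top _ _).1 (hup _ hs)
    rw [h1.limsup_eq]
    exact zero_le
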